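/- The paw is the graph on four vertices formed by a triangle and one further vertex that is adjacent to exactly one vertex of the triangle. In the problem Paw-free Edge Editing, an instance is a pair $(G,k)$ of a finite simple graph $G$ and a non-negative integer $k$ (the parameter), and the question is whether there is a set $A$ of at most $k$ pairs of vertices of $G$ such that the graph $G \,\Delta\, A$, with vertex set $V(G)$ and edge set the symmetric difference $E(G)\,\Delta\, A$, has no induced subgraph isomorphic to the paw. **Theorem.** Paw-free Edge Editing has a polynomial kernel with $O(k^6)$ vertices. That is, there are a polynomial-time algorithm and a constant $C$ such that the algorithm maps every instance $(G,k)$ to an instance $(G',k')$ of Paw-free Edge Editing for which 1. $(G',k')$ is a yes-instance if and only if $(G,k)$ is a yes-instance; 2. $|G'| + k'$ is bounded by a polynomial in $k$, where $|G'| = |V(G')|^2$ is the size of the adjacency matrix of $G'$; 3. $|V(G')| \le C\,(k^6+1)$. Here polynomial time means that the number of steps on a random access machine (with addition and truncated subtraction at unit cost, and without multiplication), together with the length of the output, is bounded by a polynomial in $|V(G)|^2$ plus the number of binary digits of $k$. -/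

import Mathlib

namespace PawEditing

/-! ### Paw-free graphs and the editing problem -/

/-- The paw: the triangle `0, 1, 2` together with the vertex `3`, which is adjacent only to `2`. -/
def paw : SimpleGraph (Fin 4) :=
  SimpleGraph.fromEdgeSet {s(0, 1), s(0, 2), s(1, 2), s(2, 3)}

/-- A graph is paw-free if it has no induced subgraph isomorphic to the paw. -/
def PawFree {V : Type*} (G : SimpleGraph V) : Prop :=
  ¬ paw.IsIndContained G

/-- `G Δ A`: the graph on the vertices of `G` whose edge set is the symmetric difference of
`E(G)` and the set `A` of pairs of vertices (loops, if `A` has any, are ignored). -/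
def edit {V : Type*} (G : SimpleGraph V) (A : Set (Sym2 V)) : SimpleGraph V :=
  SimpleGraph.fromEdgeSet (symmDiff G.edgeSet A)

/-- An instance `(G, k)` of a parameterized graph problem: a graph `G` on the vertices
`0, …, order - 1`, and a parameter `k`. -/
structure GraphInstance where
  order : ℕ
  graph : SimpleGraph (Fin order)
  param : ℕ

/-- The size `|G|` of the graph of an instance: the number of bits of its adjacency matrix. -/
def GraphInstance.size (I : GraphInstance) : ℕ :=
  I.order ^ 2

/-- The length of an encoding of `(G, k)`: the adjacency matrix of `G`, and `k` in binary. -/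
def GraphInstance.length (I : GraphInstance) : ℕ :=
  I.size + Nat.size I.param

/-- Paw-free Edge Editing: the instances `(G, k)` such that adding or deleting at most `k` edges
turns `G` into a paw-free graph. -/
def PawFreeEditing : Set GraphInstance :=
  {I | ∃ A : Finset (Sym2 (Fin I.order)), A.card ≤ I.param ∧ PawFree (edit I.graph (A : Set _))}

/-! ### Polynomial time

The machine model is a random access machine, programmed in structured form. It has registers
`0, 1, 2, …` and arrays `0, 1, 2, …` indexed by pairs of natural numbers; all cells hold natural
numbers. A program is a fixed finite text, and each assignment and each test costs one step.
The arithmetic operations are addition and truncated subtraction, and there is no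
multiplication. Hence the numbers that occur in the first `t` steps have `O(t)` more bits than the
input numbers, and polynomial time on this machine is polynomial time on a Turing machine. -/

/-- The memory of the machine. -/
structure Memory where
  reg : ℕ → ℕ
  arr : ℕ → ℕ → ℕ → ℕ

/-- Arithmetic expressions; `cell a i j` is the entry of array `a` at the position given by the
values of `i` and `j`; `lt` and `eq` have value `1` (true) or `0` (false). -/
inductive Expr : Type
  | const (c : ℕ) : Expr
  | reg (x : ℕ) : Expr
  | cell (a : ℕ) (i j : Expr) : Expr
  | add (e₁ e₂ : Expr) : Expr
  | sub (e₁ e₂ : Expr) : Expr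
  | lt (e₁ e₂ : Expr) : Expr
  | eq (e₁ e₂ : Expr) : Expr

/-- The value of an expression. -/
def Expr.eval (m : Memory) : Expr → ℕ
  | const c => c
  | reg x => m.reg x
  | cell a i j => m.arr a (i.eval m) (j.eval m)
  | add e₁ e₂ => e₁.eval m + e₂.eval m
  | sub e₁ e₂ => e₁.eval m - e₂.eval m
  | lt e₁ e₂ => if e₁.eval m < e₂.eval m then 1 else 0
  | eq e₁ e₂ => if e₁.eval m = e₂.eval m then 1 else 0

/-- Write `v` to register `x`. -/
def Memory.setReg (m : Memory) (x v : ℕ) : Memory where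
  reg y := if y = x then v else m.reg y
  arr := m.arr

/-- Write `v` to the entry `(i, j)` of array `a`. -/
def Memory.setCell (m : Memory) (a i j v : ℕ) : Memory where
  reg := m.reg
  arr b r c := if b = a ∧ r = i ∧ c = j then v else m.arr b r c

/-- Programs; a test `e` succeeds if the value of `e` is not `0`. -/
inductive Prog : Type
  | skip : Prog
  | assign (x : ℕ) (e : Expr) : Prog
  | store (a : ℕ) (i j e : Expr) : Prog
  | seq (p q : Prog) : Prog
  | ite (e : Expr) (p q : Prog) : Prog
  | loop (e : Expr) (p : Prog) : Prog

/-- `Runs p m t m'`: started in memory `m`, the program `p` halts after exactly `t` steps with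
memory `m'`. -/
inductive Runs : Prog → Memory → ℕ → Memory → Prop
  | skip (m : Memory) : Runs Prog.skip m 1 m
  | assign (x : ℕ) (e : Expr) (m : Memory) :
      Runs (Prog.assign x e) m 1 (m.setReg x (e.eval m))
  | store (a : ℕ) (i j e : Expr) (m : Memory) :
      Runs (Prog.store a i j e) m 1 (m.setCell a (i.eval m) (j.eval m) (e.eval m))
  | seq {p q : Prog} {m₁ m₂ m₃ : Memory} {t u : ℕ} :
      Runs p m₁ t m₂ → Runs q m₂ u m₃ → Runs (Prog.seq p q) m₁ (t + u) m₃
  | iteTrue {e : Expr} {p q : Prog} {m m' : Memory} {t : ℕ} :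
      e.eval m ≠ 0 → Runs p m t m' → Runs (Prog.ite e p q) m (t + 1) m'
  | iteFalse {e : Expr} {p q : Prog} {m m' : Memory} {t : ℕ} :
      e.eval m = 0 → Runs q m t m' → Runs (Prog.ite e p q) m (t + 1) m'
  | loopTrue {e : Expr} {p : Prog} {m₁ m₂ m₃ : Memory} {t u : ℕ} :
      e.eval m₁ ≠ 0 → Runs p m₁ t m₂ → Runs (Prog.loop e p) m₂ u m₃ →
        Runs (Prog.loop e p) m₁ (t + u + 1) m₃
  | loopFalse {e : Expr} {p : Prog} {m : Memory} :
      e.eval m = 0 → Runs (Prog.loop e p) m 1 m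

open Classical in
/-- The initial memory on input `(G, k)`: the number of vertices in register `0`, the parameter
in register `1`, the adjacency matrix in array `0`, and `0` everywhere else. -/
noncomputable def inputMemory (I : GraphInstance) : Memory where
  reg x := if x = 0 then I.order else if x = 1 then I.param else 0
  arr a i j :=
    if a = 0 ∧ ∃ (hi : i < I.order) (hj : j < I.order), I.graph.Adj ⟨i, hi⟩ ⟨j, hj⟩ then 1 else 0

open Classical in
/-- The memory `m` holds the output `(G, k)`: the number of vertices in register `0`, the
parameter in register `1`, and the adjacency matrix in array `0`. -/
def HoldsOutput (m : Memory) (I : GraphInstance) : Prop :=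
  m.reg 0 = I.order ∧ m.reg 1 = I.param ∧
    ∀ i j : Fin I.order, m.arr 0 i j = if I.graph.Adj i j then 1 else 0

/-- `κ` is computable in polynomial time: some program computes it so that the number of its
steps, plus the length of the output (which has to be written), is at most a polynomial in the
length of the input. -/
def PolyTimeComputable (κ : GraphInstance → GraphInstance) : Prop :=
  ∃ (P : Prog) (p : Polynomial ℕ), ∀ I : GraphInstance, ∃ (t : ℕ) (m : Memory),
    Runs P (inputMemory I) t m ∧ HoldsOutput m (κ I) ∧
      t + (κ I).length ≤ p.eval I.length

/-! ### Kernelization -/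

/-- `κ` is a polynomial kernelization for the problem `L`: it is computable in polynomial time,
it maps each instance `(G, k)` to an equivalent instance `(G', k')`, and `|G'| + k'` is at most a
polynomial in `k`. -/
structure IsPolynomialKernelization (L : Set GraphInstance)
    (κ : GraphInstance → GraphInstance) : Prop where
  polyTime : PolyTimeComputable κ
  equivalent : ∀ I : GraphInstance, κ I ∈ L ↔ I ∈ L
  size_le : ∃ f : Polynomial ℕ, ∀ I : GraphInstance, (κ I).size + (κ I).param ≤ f.eval I.param

end PawEditing

namespace PawEditing

/-! ### Paw-free graphs -/

section Graphs

variable {V : Type*}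

/-! A component of a paw-free graph is triangle-free or complete multipartite
(`LocallyPawFree.adj_or_adj`). Edits are counted as ordered pairs in `diff`, so k edits touch at
most 2k vertices, and every set of more than 2k vertices has a member all of whose adjacencies a
given solution keeps (`exists_not_touched`).

There are two kinds of reduction. An edge ab that more than k disjoint pairs complete to paws must
be deleted, since otherwise each pair costs an edit of its own (`IsPetalSet.not_adj`); for every
other edge, a greedy maximal family of pairs yields 2k vertices that meet all such pairs. After
that, a vertex v is isolated whenever a solution for G − v can be turned into one for G at no extra
cost. `PatternRule` does this because some untouched vertex imitates v towards any three vertices.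
`MateRule` does it because untouched mates of v fix the component into which v has to go.
`ComponentRule` does it because the component of v needs no edit. `TriangleFreeRule` does it
because, in an optimal solution for G − v, the neighbours of v lie in no triangle. The last rule
rests on an exchange argument, `IsOptimal.exists_adj_inTriangle`: a component with triangles cannot
be worth its added edges around a triangle-free vertex q of G unless q has a neighbour in it that
lies in a triangle of G.

For the size, let M be the set of at most 2K vertices touched by a solution with budget K of the
original graph. Every paw has two vertices in M, so G − M together with any single vertex of M is
paw-free. The non-isolated vertices of an irreducible graph are of four kinds (`card_support_le`).
There are O(K^3) vertices in M or in the sets that cover the paws on edges inside M. Vertices in no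
triangle are within two steps of these, with O(K) choices per step, which gives O(K^5). For each of
the O(K^2) edges inside M there are O(K^4) vertices whose neighbours all lie in one set of O(K)
vertices. Finally, each vertex of M has at most one component with triangles, with O(K) parts by
`MateRule` and O(K^4) vertices in each part by `PatternRule`. A larger irreducible graph certifies a
no-instance.

For the running time, the algorithm is written in a language whose sums and loops all range over the
n vertices; every such program compiles to a polynomial-time one (`Cmd.correct`). The rules only
quantify over vertices and count them, so they are terms of this language. -/

/-- Paw-freeness in terms of adjacency: a neighbour of a vertex of a triangle is adjacent to
another vertex of the triangle. -/
def LocallyPawFree (G : SimpleGraph V) : Prop :=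
  ∀ a b c d, G.Adj a b → G.Adj b c → G.Adj a c → G.Adj c d → G.Adj d a ∨ G.Adj d b

/-- For `d = a` and `d = b` the local condition holds trivially, so it needs no distinctness
hypotheses. -/
theorem pawFree_iff {G : SimpleGraph V} : PawFree G ↔ LocallyPawFree G := by
  constructor
  · intro h a b c d hab hbc hac hcd
    by_contra hcon
    push Not at hcon
    obtain ⟨hda, hdb⟩ := hcon
    have h1 := hab.ne
    have h2 := hbc.ne
    have h3 := hac.ne
    have h4 := hcd.ne
    have h5 : d ≠ a := by rintro rfl; exact hdb hab
    have h6 : d ≠ b := by rintro rfl; exact hda hab.symm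
    apply h
    refine ⟨⟨⟨![a, b, c, d], ?_⟩, ?_⟩⟩
    · intro i j hij
      fin_cases i <;> fin_cases j <;> simp_all
    · intro i j
      have e1 : ¬ G.Adj a d := fun h => hda h.symm
      have e2 : ¬ G.Adj b d := fun h => hdb h.symm
      change G.Adj (![a, b, c, d] i) (![a, b, c, d] j) ↔ _
      fin_cases i <;> fin_cases j <;>
        simp [paw, hab, hbc, hac, hcd, hab.symm, hbc.symm, hac.symm, hcd.symm, hda, hdb, e1, e2]
  · rintro h ⟨f⟩
    have key : ∀ i j, G.Adj (f i) (f j) ↔ paw.Adj i j := fun i j => f.map_rel_iff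
    have := h (f 0) (f 1) (f 2) (f 3) ((key _ _).2 (by simp [paw])) ((key _ _).2 (by simp [paw]))
      ((key _ _).2 (by simp [paw])) ((key _ _).2 (by simp [paw]))
    rw [key, key] at this
    simp [paw] at this

/-- `x` lies in a triangle of `G`. -/
def InTriangle (G : SimpleGraph V) (x : V) : Prop :=
  ∃ y z, G.Adj x y ∧ G.Adj x z ∧ G.Adj y z

/-- The condition at a triangle through `x` puts every edge at `x` into a triangle. So being in a
triangle spreads along edges to the whole component. -/
theorem LocallyPawFree.edge_in_triangle {G : SimpleGraph V} (h : LocallyPawFree G) {x d : V}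
    (hx : InTriangle G x) (hd : G.Adj x d) : ∃ y, G.Adj x y ∧ G.Adj d y := by
  obtain ⟨y, z, hy, hz, hyz⟩ := hx
  rcases h y z x d hyz hz.symm hy.symm hd with h1 | h1
  · exact ⟨y, hy, h1⟩
  · exact ⟨z, hz, h1⟩

theorem LocallyPawFree.inTriangle_of_adj {G : SimpleGraph V} (h : LocallyPawFree G) {x d : V}
    (hx : InTriangle G x) (hd : G.Adj x d) : InTriangle G d := by
  obtain ⟨y, hy, hdy⟩ := h.edge_in_triangle hx hd
  exact ⟨x, y, hd.symm, hdy, hy⟩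

theorem LocallyPawFree.inTriangle_of_reachable {G : SimpleGraph V} (h : LocallyPawFree G)
    {x d : V} (hx : InTriangle G x) (hd : G.Reachable x d) : InTriangle G d := by
  obtain ⟨w⟩ := hd
  induction w with
  | nil => exact hx
  | cons hadj _ ih => exact ih (h.inTriangle_of_adj hx hadj)

/-- A component of a paw-free graph that contains a triangle is complete multipartite. -/
theorem LocallyPawFree.adj_or_adj {G : SimpleGraph V} (h : LocallyPawFree G) {d f e : V}
    (hd : InTriangle G d) (hdf : G.Adj d f) (he : G.Reachable d e) : G.Adj e d ∨ G.Adj e f := by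
  rw [SimpleGraph.reachable_iff_reflTransGen] at he
  induction he with
  | refl => exact Or.inr hdf
  -- If `e` sees only one end of the edge `df`, the third vertex `y` of a triangle on `df` is
  -- adjacent to `e` as well; the triangle on `e`, `y` and the visible end then carries the claim
  -- over to `g`.
  | @tail e g _ heg ih =>
    by_cases hed : G.Adj e d <;> by_cases hef : G.Adj e f
    · exact h d f e g hdf hef.symm hed.symm heg
    · obtain ⟨y, hdy, hfy⟩ := h.edge_in_triangle hd hdf
      have hey : G.Adj e y := by
        rcases h f y d e hfy hdy.symm hdf.symm hed.symm with h1 | h1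
        · exact absurd h1 hef
        · exact h1
      rcases h d y e g hdy hey.symm hed.symm heg with h1 | h1
      · exact Or.inl h1
      · exact h d f y g hdf hfy hdy h1.symm
    · obtain ⟨y, hdy, hfy⟩ := h.edge_in_triangle hd hdf
      have hey : G.Adj e y := by
        rcases h d y f e hdy hfy.symm hdf hef.symm with h1 | h1
        · exact absurd h1 hed
        · exact h1
      rcases h f y e g hfy hey.symm hef.symm heg with h1 | h1
      · exact Or.inr h1
      · exact h d f y g hdf hfy hdy h1.symm
    · tauto

theorem LocallyPawFree.mono_set {G H : SimpleGraph V} (h : LocallyPawFree H) {S : Set V}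
    (hGH : ∀ a b, G.Adj a b ↔ (H.Adj a b ∧ a ∈ S ∧ b ∈ S)) : LocallyPawFree G := by
  intro a b c d hab hbc hac hcd
  rw [hGH] at hab hbc hac hcd
  simp only [hGH]
  have := h a b c d hab.1 hbc.1 hac.1 hcd.1
  tauto

/-- Paw-freeness of a graph that agrees with a paw-free graph outside a union of components. -/
theorem LocallyPawFree.of_split {H H' : SimpleGraph V} (h : LocallyPawFree H) (D : Set V)
    (h1 : ∀ a b, H'.Adj a b → (a ∈ D ↔ b ∈ D))
    (h2 : ∀ a b, a ∉ D → b ∉ D → (H'.Adj a b ↔ H.Adj a b))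
    (h3 : ∀ a ∈ D, ∀ b ∈ D, ∀ c ∈ D, ∀ d ∈ D, H'.Adj a b → H'.Adj b c → H'.Adj a c →
      H'.Adj c d → H'.Adj d a ∨ H'.Adj d b) : LocallyPawFree H' := by
  intro a b c d hab hbc hac hcd
  have e1 := h1 _ _ hab
  have e2 := h1 _ _ hbc
  have e3 := h1 _ _ hcd
  by_cases ha : a ∈ D
  · exact h3 a ha b (by tauto) c (by tauto) d (by tauto) hab hbc hac hcd
  · have hb : b ∉ D := by tauto
    have hc : c ∉ D := by tauto
    have hd : d ∉ D := by tauto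
    rw [h2 _ _ hd ha, h2 _ _ hd hb]
    exact h a b c d ((h2 _ _ ha hb).1 hab) ((h2 _ _ hb hc).1 hbc) ((h2 _ _ ha hc).1 hac)
      ((h2 _ _ hc hd).1 hcd)

/-- `G` without the edges at `v`. -/
def isolate (G : SimpleGraph V) (v : V) : SimpleGraph V where
  Adj a b := G.Adj a b ∧ a ≠ v ∧ b ≠ v
  symm := ⟨fun _ _ h => ⟨h.1.symm, h.2.2, h.2.1⟩⟩
  loopless := ⟨fun _ h => h.1.ne rfl⟩

@[simp] theorem isolate_adj {G : SimpleGraph V} {v a b : V} :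
    (isolate G v).Adj a b ↔ G.Adj a b ∧ a ≠ v ∧ b ≠ v := Iff.rfl

theorem LocallyPawFree.isolate {H : SimpleGraph V} (h : LocallyPawFree H) (v : V) :
    LocallyPawFree (isolate H v) :=
  h.mono_set (S := {x | x ≠ v}) fun a b => by simp

/-! ### Edit distance -/

theorem edit_edgeSet (G : SimpleGraph V) (A : Set (Sym2 V)) :
    symmDiff G.edgeSet (edit G A).edgeSet ⊆ A := by
  intro e
  induction e with
  | h a b =>
    simp only [Set.mem_symmDiff, edit, SimpleGraph.mem_edgeSet, SimpleGraph.fromEdgeSet_adj]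
    intro h
    have : G.Adj a b → a ≠ b := fun h => h.ne
    tauto

theorem edit_symmDiff (G H : SimpleGraph V) : edit G (symmDiff G.edgeSet H.edgeSet) = H := by
  ext a b
  have h1 : G.Adj a b → a ≠ b := fun h => h.ne
  have h2 : H.Adj a b → a ≠ b := fun h => h.ne
  simp only [edit, SimpleGraph.fromEdgeSet_adj, symmDiff_symmDiff_cancel_left,
    SimpleGraph.mem_edgeSet]
  tauto

/-- `x` is incident to an edited pair. -/
def Touched (G H : SimpleGraph V) (x : V) : Prop :=
  ∃ y, ¬ (G.Adj x y ↔ H.Adj x y)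

theorem adj_iff_of_not_touched {G H : SimpleGraph V} {x : V} (h : ¬ Touched G H x) (y : V) :
    H.Adj x y ↔ G.Adj x y := by
  by_contra hc
  exact h ⟨y, fun h' => hc h'.symm⟩

theorem adj_iff_of_not_touched' {G H : SimpleGraph V} {x : V} (h : ¬ Touched G H x) (y : V) :
    H.Adj y x ↔ G.Adj y x := by
  rw [H.adj_comm, G.adj_comm, adj_iff_of_not_touched h]

variable [Fintype V]

open Classical in
/-- The ordered pairs of vertices on which `G` and `H` differ. -/
noncomputable def diff (G H : SimpleGraph V) : Finset (V × V) :=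
  Finset.univ.filter fun p => ¬ (G.Adj p.1 p.2 ↔ H.Adj p.1 p.2)

@[simp] theorem mem_diff {G H : SimpleGraph V} {p : V × V} :
    p ∈ diff G H ↔ ¬ (G.Adj p.1 p.2 ↔ H.Adj p.1 p.2) := by
  simp [diff]

/-- `G` can be made paw-free by editing at most `k` pairs. -/
def Editable (G : SimpleGraph V) (k : ℕ) : Prop :=
  ∃ H : SimpleGraph V, LocallyPawFree H ∧ (diff G H).card ≤ 2 * k

/-- The differing ordered pairs are the darts of the graph of differences. This is where the bound
`2 * k` for k edits comes from. -/
theorem card_diff_eq (G H : SimpleGraph V) :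
    (diff G H).card = 2 * (symmDiff G.edgeSet H.edgeSet).ncard := by
  classical
  let D : SimpleGraph V :=
    { Adj := fun a b => ¬ (G.Adj a b ↔ H.Adj a b)
      symm := ⟨fun a b h => by rwa [G.adj_comm, H.adj_comm]⟩
      loopless := ⟨fun a h => by simp at h⟩ }
  have h1 : symmDiff G.edgeSet H.edgeSet = (D.edgeFinset : Set (Sym2 V)) := by
    ext e
    induction e with
    | h a b => simp [Set.mem_symmDiff, D]; tauto
  have h2 : (diff G H).card = Fintype.card D.Dart := by
    rw [← Finset.card_univ]
    symm
    refine Finset.card_bij (fun d _ => d.toProd) ?_ ?_ ?_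
    · intro d _
      exact mem_diff.2 d.adj
    · intro d _ d' _ h
      exact SimpleGraph.Dart.ext _ _ h
    · intro p hp
      exact ⟨⟨p, mem_diff.1 hp⟩, Finset.mem_univ _, rfl⟩
  rw [h1, h2, D.dart_card_eq_twice_card_edges, Set.ncard_coe_finset]

theorem editable_iff {G : SimpleGraph V} {k : ℕ} :
    Editable G k ↔ ∃ A : Finset (Sym2 V), A.card ≤ k ∧ PawFree (edit G (A : Set _)) := by
  classical
  constructor
  · rintro ⟨H, hH, hk⟩
    refine ⟨(symmDiff G.edgeSet H.edgeSet).toFinset, ?_, ?_⟩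
    · rw [card_diff_eq, Set.ncard_eq_toFinset_card'] at hk
      omega
    · rw [Set.coe_toFinset, edit_symmDiff]
      exact pawFree_iff.2 hH
  · rintro ⟨A, hA, h⟩
    refine ⟨_, pawFree_iff.1 h, ?_⟩
    rw [card_diff_eq]
    have := Set.ncard_le_ncard (edit_edgeSet G (A : Set _)) A.finite_toSet
    rw [Set.ncard_coe_finset] at this
    omega

-- Every touched vertex is the first coordinate of some differing ordered pair.
open Classical in
theorem card_touched_le (G H : SimpleGraph V) :
    (Finset.univ.filter (Touched G H)).card ≤ (diff G H).card := by
  refine (Finset.card_le_card ?_).trans (Finset.card_image_le (s := diff G H) (f := Prod.fst))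
  intro x hx
  obtain ⟨y, hy⟩ := (Finset.mem_filter.1 hx).2
  exact Finset.mem_image.2 ⟨(x, y), mem_diff.2 hy, rfl⟩

open Classical in
/-- More vertices than edited pairs can touch include an untouched one. -/
theorem exists_not_touched {G H : SimpleGraph V} {k : ℕ} (hk : (diff G H).card ≤ 2 * k)
    {S : Finset V} (hS : 2 * k < S.card) : ∃ x ∈ S, ¬ Touched G H x := by
  by_contra hc
  push Not at hc
  have : S ⊆ Finset.univ.filter (Touched G H) := fun x hx => by simpa using hc x hx
  have := (Finset.card_le_card this).trans (card_touched_le G H)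
  omega

theorem Editable.isolate {G : SimpleGraph V} {k : ℕ} (h : Editable G k) (v : V) :
    Editable (isolate G v) k := by
  obtain ⟨H, hH, hk⟩ := h
  refine ⟨_, hH.isolate v, (Finset.card_le_card ?_).trans hk⟩
  intro p
  simp only [mem_diff, isolate_adj]
  tauto

/-- An optimal solution. -/
def IsOptimal (G H : SimpleGraph V) : Prop :=
  LocallyPawFree H ∧ ∀ H', LocallyPawFree H' → (diff G H).card ≤ (diff G H').card

theorem Editable.exists_isOptimal {G : SimpleGraph V} {k : ℕ} (h : Editable G k) :
    ∃ H, IsOptimal G H ∧ (diff G H).card ≤ 2 * k := by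
  obtain ⟨H, hH, hk⟩ := h
  obtain ⟨H', h1, h2⟩ := Set.exists_min_image {H | LocallyPawFree H} (fun H => (diff G H).card)
    (Set.toFinite _) ⟨H, hH⟩
  exact ⟨H', ⟨h1, h2⟩, (h2 H hH).trans hk⟩

end Graphs

end PawEditing
namespace PawEditing

/-! ### Reduction rules -/

section Rules

variable {V : Type*}

theorem locallyPawFree_of_ne {G : SimpleGraph V}
    (h : ∀ a b c d, d ≠ a → d ≠ b → G.Adj a b → G.Adj b c → G.Adj a c → G.Adj c d →
      G.Adj d a ∨ G.Adj d b) : LocallyPawFree G := by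
  intro a b c d hab hbc hac hcd
  by_cases hda : d = a
  · subst hda; exact Or.inr hab
  by_cases hdb : d = b
  · subst hdb; exact Or.inl hab.symm
  exact h a b c d hda hdb hab hbc hac hcd

/-- `H`, but with the edges of `G` at `v`. -/
def restore (G H : SimpleGraph V) (v : V) : SimpleGraph V where
  Adj a b := ((a = v ∨ b = v) ∧ G.Adj a b) ∨ (a ≠ v ∧ b ≠ v ∧ H.Adj a b)
  symm := ⟨fun a b h => by rw [G.adj_comm, H.adj_comm]; tauto⟩
  loopless := ⟨fun a h => by simp at h⟩

theorem restore_adj {G H : SimpleGraph V} {v a b : V} (ha : a ≠ v) (hb : b ≠ v) :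
    (restore G H v).Adj a b ↔ H.Adj a b := by
  simp [restore, ha, hb]

theorem restore_adj_left {G H : SimpleGraph V} {v a : V} :
    (restore G H v).Adj v a ↔ G.Adj v a := by
  simp [restore]

theorem restore_adj_right {G H : SimpleGraph V} {v a : V} :
    (restore G H v).Adj a v ↔ G.Adj a v := by
  simp [restore]

variable [Fintype V]

theorem diff_restore_subset (G H : SimpleGraph V) (v : V) :
    diff G (restore G H v) ⊆ diff (isolate G v) H := by
  rintro ⟨a, b⟩
  simp only [mem_diff, isolate_adj, restore]
  tauto

open Classical in
/-- Each adjacency pattern of `v` towards three vertices is shared by many vertices. -/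
def PatternRule (G : SimpleGraph V) (k : ℕ) (v : V) : Prop :=
  ∀ a b c, a ≠ v → b ≠ v → c ≠ v →
    2 * k < (Finset.univ.filter fun x => x ≠ v ∧ x ≠ a ∧ x ≠ b ∧ x ≠ c ∧
      (G.Adj x a ↔ G.Adj v a) ∧ (G.Adj x b ↔ G.Adj v b) ∧ (G.Adj x c ↔ G.Adj v c)).card

/-- A paw at `v` in the restored graph has three other vertices. Some untouched `x` has the same
adjacencies to them as `v`, so replacing `v` by `x` gives a paw of `H'`. The cases are the possible
positions of `v`. -/
theorem PatternRule.editable {G : SimpleGraph V} {k : ℕ} {v : V} (hv : PatternRule G k v)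
    (h : Editable (isolate G v) k) : Editable G k := by
  classical
  obtain ⟨H', hH', hk⟩ := h
  refine ⟨restore G H' v, ?_, (Finset.card_le_card (diff_restore_subset G H' v)).trans hk⟩
  have key : ∀ a b c, a ≠ v → b ≠ v → c ≠ v → ∃ x, x ≠ v ∧ (H'.Adj x a ↔ G.Adj v a) ∧
      (H'.Adj x b ↔ G.Adj v b) ∧ (H'.Adj x c ↔ G.Adj v c) := by
    intro a b c ha hb hc
    obtain ⟨x, hx, hxt⟩ := exists_not_touched hk (hv a b c ha hb hc)
    obtain ⟨hxv, -, -, -, h1, h2, h3⟩ := (Finset.mem_filter.1 hx).2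
    refine ⟨x, hxv, ?_, ?_, ?_⟩ <;> rw [adj_iff_of_not_touched hxt, isolate_adj] <;> tauto
  apply locallyPawFree_of_ne
  intro a b c d hda hdb hab hbc hac hcd
  by_cases ha : a = v
  · subst ha
    have hb : b ≠ a := hab.ne.symm
    have hc : c ≠ a := hac.ne.symm
    obtain ⟨x, hx, h1, h2, h3⟩ := key b c d hb hc hda
    rw [restore_adj_left] at hab hac
    rw [restore_adj hb hc] at hbc
    rw [restore_adj hc hda] at hcd
    rw [restore_adj_right, restore_adj hda hb, G.adj_comm, ← h3, H'.adj_comm]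
    exact hH' x b c d (h1.2 hab) hbc (h2.2 hac) hcd
  by_cases hb : b = v
  · subst hb
    have hc : c ≠ b := hbc.ne.symm
    obtain ⟨x, hx, h1, h2, h3⟩ := key a c d ha hc hdb
    rw [restore_adj_right] at hab
    rw [restore_adj_left] at hbc
    rw [restore_adj ha hc] at hac
    rw [restore_adj hc hdb] at hcd
    rw [restore_adj_right, restore_adj hdb ha, G.adj_comm, ← h3, H'.adj_comm x]
    exact hH' a x c d (h1.2 hab.symm).symm (h2.2 hbc) hac hcd
  by_cases hc : c = v
  · subst hc
    have hd : d ≠ c := hcd.ne.symm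
    obtain ⟨x, hx, h1, h2, h3⟩ := key a b d ha hb hd
    rw [restore_adj_right] at hbc hac
    rw [restore_adj_left] at hcd
    rw [restore_adj ha hb] at hab
    rw [restore_adj hd ha, restore_adj hd hb]
    exact hH' a b x d hab (h2.2 hbc.symm).symm (h1.2 hac.symm).symm (h3.2 hcd)
  rw [restore_adj ha hb] at hab
  rw [restore_adj hb hc] at hbc
  rw [restore_adj ha hc] at hac
  by_cases hd : d = v
  · subst hd
    obtain ⟨x, hx, h1, h2, h3⟩ := key a b c ha hb hc
    rw [restore_adj_right] at hcd
    rw [restore_adj_left, restore_adj_left, ← h1, ← h2]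
    exact hH' a b c x hab hbc hac (h3.2 hcd.symm).symm
  · rw [restore_adj hc hd] at hcd
    rw [restore_adj hd ha, restore_adj hd hb]
    exact hH' a b c d hab hbc hac hcd

/-- `u` and `v` are true twins up to false twins: they are adjacent, and every vertex that
distinguishes them is a false twin of one of them. -/
def Mate (G : SimpleGraph V) (v u : V) : Prop :=
  G.Adj v u ∧ (∀ w, G.Adj w v → ¬ G.Adj w u → ∀ x, G.Adj w x ↔ G.Adj u x) ∧
    ∀ w, G.Adj w u → ¬ G.Adj w v → ∀ x, G.Adj w x ↔ G.Adj v x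

open Classical in
/-- The mates of `v` belong to many classes of false twins. -/
def MateRule [LinearOrder V] (G : SimpleGraph V) (k : ℕ) (v : V) : Prop :=
  2 * k + 2 < (Finset.univ.filter fun u => Mate G v u ∧
    ∀ u', u' < u → ¬ ∀ x, G.Adj u' x ↔ G.Adj u x).card

/-- Three untouched mates form a triangle of `H'`, so their component is complete multipartite. As
they keep their neighbourhoods, it consists exactly of the neighbours of `v` and the false twins of
`v`. Hence `v` and its false twins can become one part of it. -/
theorem MateRule.editable [LinearOrder V] {G : SimpleGraph V} {k : ℕ} {v : V}
    (hv : MateRule G k v) (h : Editable (isolate G v) k) : Editable G k := by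
  classical
  obtain ⟨H', hH', hk⟩ := h
  set S := Finset.univ.filter fun u => Mate G v u ∧
    ∀ u', u' < u → ¬ ∀ x, G.Adj u' x ↔ G.Adj u x with hS
  have hv' : 2 * k + 2 < S.card := hv
  -- Non-adjacent mates of `v` are false twins, and `S` contains only the least vertex of each twin
  -- class.
  have hadj : ∀ x ∈ S, ∀ y ∈ S, x ≠ y → G.Adj x y := by
    intro x hx y hy hxy
    have hx := (Finset.mem_filter.1 hx).2
    have hy := (Finset.mem_filter.1 hy).2
    by_contra hc
    have h1 := hx.1.2.1 y hy.1.1.symm (fun h => hc h.symm)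
    rcases lt_or_gt_of_ne hxy with h | h
    · exact hy.2 x h fun z => (h1 z).symm
    · exact hx.2 y h h1
  obtain ⟨x₁, hx₁, t₁⟩ := exists_not_touched hk (S := S) (by omega)
  obtain ⟨x₂, hx₂, t₂⟩ := exists_not_touched hk (S := S.erase x₁) (by
    have := Finset.pred_card_le_card_erase (s := S) (a := x₁); omega)
  obtain ⟨x₃, hx₃, t₃⟩ := exists_not_touched hk (S := (S.erase x₁).erase x₂) (by
    have := Finset.pred_card_le_card_erase (s := S) (a := x₁)
    have := Finset.pred_card_le_card_erase (s := S.erase x₁) (a := x₂)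
    omega)
  simp only [Finset.mem_erase] at hx₂ hx₃
  have a₁₂ := hadj _ hx₁ _ hx₂.2 hx₂.1.symm
  have a₁₃ := hadj _ hx₁ _ hx₃.2.2 hx₃.2.1.symm
  have a₂₃ := hadj _ hx₂.2 _ hx₃.2.2 hx₃.1.symm
  have m₁ := (Finset.mem_filter.1 hx₁).2.1
  have m₂ := (Finset.mem_filter.1 hx₂.2).2.1
  have m₃ := (Finset.mem_filter.1 hx₃.2.2).2.1
  have n₁ := m₁.1.ne.symm
  have n₂ := m₂.1.ne.symm
  have n₃ := m₃.1.ne.symm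
  have hN₁ : ∀ y, H'.Adj x₁ y ↔ G.Adj x₁ y ∧ y ≠ v := fun y => by
    rw [adj_iff_of_not_touched t₁, isolate_adj]; tauto
  have hN₂ : ∀ y, H'.Adj x₂ y ↔ G.Adj x₂ y ∧ y ≠ v := fun y => by
    rw [adj_iff_of_not_touched t₂, isolate_adj]; tauto
  have tri : InTriangle H' x₁ := ⟨x₂, x₃, (hN₁ _).2 ⟨a₁₂, n₂⟩, (hN₁ _).2 ⟨a₁₃, n₃⟩,
    (hN₂ _).2 ⟨a₂₃, n₃⟩⟩
  have h₁₂ : H'.Adj x₁ x₂ := (hN₁ _).2 ⟨a₁₂, n₂⟩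
  -- the component of `x₁`
  have hD : ∀ y, H'.Reachable x₁ y ↔ y ≠ v ∧ (G.Adj v y ∨ ∀ x, G.Adj y x ↔ G.Adj v x) := by
    intro y
    constructor
    · intro hy
      have h12 := hH'.adj_or_adj tri h₁₂ hy
      rw [H'.adj_comm, hN₁, H'.adj_comm, hN₂] at h12
      refine ⟨by tauto, ?_⟩
      by_cases hvy : G.Adj v y
      · exact Or.inl hvy
      · right
        rcases h12 with h | h
        · exact m₁.2.2 y h.1.symm (fun h => hvy h.symm)
        · exact m₂.2.2 y h.1.symm (fun h => hvy h.symm)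
    · rintro ⟨hyv, hy | hy⟩
      · by_cases h1 : G.Adj y x₁
        · exact ((hN₁ y).2 ⟨h1.symm, hyv⟩).reachable
        · have := (m₁.2.1 y hy.symm h1 x₂).2 a₁₂
          exact h₁₂.reachable.trans ((hN₂ y).2 ⟨this.symm, hyv⟩).reachable
      · exact ((hN₁ y).2 ⟨((hy x₁).2 m₁.1).symm, hyv⟩).reachable
  -- `H'` may have edited the other false twins of `v`; all of `X`, including `v`, gets back its
  -- edges of `G`, which costs nothing.
  let X : Set V := {w | ∀ x, G.Adj w x ↔ G.Adj v x}
  have hvX : v ∈ X := fun x => Iff.rfl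
  have hXv : ∀ w ∈ X, ¬ G.Adj v w := fun w hw h => G.loopless.irrefl w ((hw w).2 h)
  let H : SimpleGraph V :=
    { Adj := fun a b => (a ∈ X ∧ G.Adj v b) ∨ (b ∈ X ∧ G.Adj v a) ∨ (a ∉ X ∧ b ∉ X ∧ H'.Adj a b)
      symm := ⟨fun a b h => by rw [H'.adj_comm]; tauto⟩
      loopless := ⟨fun a h => by
        rcases h with h | h | h
        · exact hXv a h.1 h.2
        · exact hXv a h.1 h.2
        · exact H'.loopless.irrefl a h.2.2⟩ }
  have HX : ∀ a b, a ∈ X → (H.Adj a b ↔ G.Adj v b) := by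
    intro a b ha
    have := hXv a ha
    change (_ ∨ _ ∨ _) ↔ _
    tauto
  have HX' : ∀ a b, b ∈ X → (H.Adj a b ↔ G.Adj v a) := by
    intro a b hb
    rw [H.adj_comm, HX b a hb]
  have HH : ∀ a b, a ∉ X → b ∉ X → (H.Adj a b ↔ H'.Adj a b) := by
    intro a b ha hb
    change (_ ∨ _ ∨ _) ↔ _
    tauto
  refine ⟨H, ?_, (Finset.card_le_card ?_).trans hk⟩
  · refine hH'.of_split (H' := H) {y | G.Adj v y ∨ y ∈ X} ?_ ?_ ?_
    · have aux : ∀ a b, H.Adj a b → (G.Adj v a ∨ a ∈ X) → (G.Adj v b ∨ b ∈ X) := by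
        intro a b hab ha
        by_cases haX : a ∈ X
        · exact Or.inl ((HX a b haX).1 hab)
        by_cases hbX : b ∈ X
        · exact Or.inr hbX
        rw [HH a b haX hbX] at hab
        have hav : G.Adj v a := ha.resolve_right haX
        exact ((hD b).1 (((hD a).2 ⟨hav.ne.symm, Or.inl hav⟩).trans hab.reachable)).2
      exact fun a b hab => ⟨aux a b hab, aux b a hab.symm⟩
    · intro a b ha hb
      exact HH a b (fun h => ha (Or.inr h)) (fun h => hb (Or.inr h))
    · intro a ha b hb c hc d hd hab hbc hac hcd
      simp only [Set.mem_ofPred_eq] at ha hb hc hd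
      by_cases hdX : d ∈ X
      · rw [HX _ _ hdX, HX _ _ hdX]
        by_cases haX : a ∈ X
        · exact Or.inr ((HX _ _ haX).1 hab)
        · exact Or.inl (ha.resolve_right haX)
      by_cases haX : a ∈ X
      · exact Or.inl ((HX' _ _ haX).2 (hd.resolve_right hdX))
      by_cases hbX : b ∈ X
      · exact Or.inr ((HX' _ _ hbX).2 (hd.resolve_right hdX))
      rw [HH _ _ hdX haX, HH _ _ hdX hbX]
      rw [HH _ _ haX hbX] at hab
      have hva : G.Adj v a := ha.resolve_right haX
      have hvd : G.Adj v d := hd.resolve_right hdX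
      have r1 := (hD a).2 ⟨hva.ne.symm, Or.inl hva⟩
      have r2 := (hD d).2 ⟨hvd.ne.symm, Or.inl hvd⟩
      exact hH'.adj_or_adj (hH'.inTriangle_of_reachable tri r1) hab (r1.symm.trans r2)
  · rintro ⟨a, b⟩
    simp only [mem_diff, isolate_adj]
    by_cases haX : a ∈ X
    · rw [HX _ _ haX, haX b]; tauto
    by_cases hbX : b ∈ X
    · rw [HX' _ _ hbX, G.adj_comm a b, hbX a]; tauto
    rw [HH _ _ haX hbX]
    have : a ≠ v := by rintro rfl; exact haX hvX
    have : b ≠ v := by rintro rfl; exact hbX hvX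
    tauto

/-- `v` lies in a complete multipartite component. -/
def ComponentRule (G : SimpleGraph V) (v : V) : Prop :=
  ∃ x, G.Adj v x ∧
    (∀ d e, (G.Adj d v ∨ G.Adj d x) → G.Adj d e → (G.Adj e v ∨ G.Adj e x)) ∧
    ∀ d f e, (G.Adj d v ∨ G.Adj d x) → (G.Adj f v ∨ G.Adj f x) → (G.Adj e v ∨ G.Adj e x) →
      G.Adj d f → (G.Adj e d ∨ G.Adj e f)

/-- The neighbours of `v` and `x` form a component of `G` that is already paw-free. So `G` is kept
there and `H'` is used elsewhere. -/
theorem ComponentRule.editable {G : SimpleGraph V} {k : ℕ} {v : V} (hv : ComponentRule G v)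
    (h : Editable (isolate G v) k) : Editable G k := by
  obtain ⟨x, hx, h1, h2⟩ := hv
  obtain ⟨H', hH', hk⟩ := h
  let D : Set V := {d | G.Adj d v ∨ G.Adj d x}
  have hvD : v ∈ D := Or.inr hx
  have hcl : ∀ a b, G.Adj a b → (a ∈ D ↔ b ∈ D) := fun a b hab =>
    ⟨fun ha => h1 a b ha hab, fun hb => h1 b a hb hab.symm⟩
  let H : SimpleGraph V :=
    { Adj := fun a b => (a ∈ D ∧ b ∈ D ∧ G.Adj a b) ∨ (a ∉ D ∧ b ∉ D ∧ H'.Adj a b)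
      symm := ⟨fun a b h => by rw [G.adj_comm, H'.adj_comm]; tauto⟩
      loopless := ⟨fun a h => by simp at h⟩ }
  have HD : ∀ a b, a ∈ D → b ∈ D → (H.Adj a b ↔ G.Adj a b) := fun a b ha hb => by
    change (_ ∨ _) ↔ _; tauto
  have HH : ∀ a b, a ∉ D → b ∉ D → (H.Adj a b ↔ H'.Adj a b) := fun a b ha hb => by
    change (_ ∨ _) ↔ _; tauto
  refine ⟨H, ?_, (Finset.card_le_card ?_).trans hk⟩
  · refine hH'.of_split (H' := H) D ?_ HH ?_
    · intro a b hab
      rcases hab with h | h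
      · exact iff_of_true h.1 h.2.1
      · exact iff_of_false h.1 h.2.1
    · intro a ha b hb c hc d hd hab hbc hac hcd
      rw [HD _ _ hd ha, HD _ _ hd hb]
      exact h2 a b d ha hb hd ((HD _ _ ha hb).1 hab)
  · rintro ⟨a, b⟩
    simp only [mem_diff, isolate_adj]
    have hc := hcl a b
    by_cases ha : a ∈ D <;> by_cases hb : b ∈ D
    · rw [HD _ _ ha hb]; tauto
    · have : ¬ H.Adj a b := by change ¬ (_ ∨ _); tauto
      tauto
    · have : ¬ H.Adj a b := by change ¬ (_ ∨ _); tauto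
      tauto
    · rw [HH _ _ ha hb]
      have : a ≠ v := by rintro rfl; exact ha hvD
      have : b ≠ v := by rintro rfl; exact hb hvD
      tauto

end Rules

end PawEditing
namespace PawEditing

/-! ### Vertices in no triangle -/

section TriangleFree

variable {V : Type*}

/-- The condition is vacuous where there are no triangles, so edges of one component may be deleted
at will once this destroys all its triangles. The improvements of solutions below are of this kind.
-/
theorem LocallyPawFree.of_triangleFree_on {H H' : SimpleGraph V} (h : LocallyPawFree H)
    {q : V} (h1 : ∀ a b, H'.Adj a b → H.Adj a b)
    (h2 : ∀ a b, H.Adj a b → ¬ H.Reachable q a → ¬ H.Reachable q b → H'.Adj a b)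
    (h3 : ∀ a b c, H.Reachable q a → H.Reachable q b → H.Reachable q c → H'.Adj a b →
      H'.Adj b c → ¬ H'.Adj a c) : LocallyPawFree H' := by
  refine h.of_split {d | H.Reachable q d} ?_ ?_ ?_
  · exact fun a b hab => ⟨fun ha => SimpleGraph.Reachable.trans ha (h1 a b hab).reachable,
      fun hb => SimpleGraph.Reachable.trans hb (h1 a b hab).symm.reachable⟩
  · exact fun a b ha hb => ⟨h1 a b, fun hab => h2 a b hab ha hb⟩
  · exact fun a ha b hb c hc d hd hab hbc hac => absurd hac (h3 a b c ha hb hc hab hbc)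

variable [Fintype V]

theorem IsOptimal.false_of_subset {G H H' : SimpleGraph V} (h : IsOptimal G H)
    (h' : LocallyPawFree H') (hsub : diff G H' ⊆ diff G H) {p : V × V} (hp : p ∈ diff G H)
    (hp' : p ∉ diff G H') : False := by
  have := Finset.card_lt_card (Finset.ssubset_iff_subset_ne.2
    ⟨hsub, fun h => hp' (by rw [h]; exact hp)⟩)
  have := h.2 H' h'
  omega

/-- Otherwise the component of `x` in `H` is triangle-free, and it stays so when the added edge is
taken back, which saves an edit. -/
theorem IsOptimal.inTriangle_of_added {G H : SimpleGraph V} (h : IsOptimal G H) {x y : V}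
    (hH : H.Adj x y) (hG : ¬ G.Adj x y) : InTriangle H x := by
  by_contra hx
  let H' : SimpleGraph V :=
    { Adj := fun a b => H.Adj a b ∧ ¬ (a = x ∧ b = y) ∧ ¬ (a = y ∧ b = x)
      symm := ⟨fun a b h => by rw [H.adj_comm]; tauto⟩
      loopless := ⟨fun a h => by simp at h⟩ }
  have HH : ∀ a b, H'.Adj a b ↔ H.Adj a b ∧ ¬ (a = x ∧ b = y) ∧ ¬ (a = y ∧ b = x) :=
    fun a b => Iff.rfl
  refine h.false_of_subset (H' := H') (p := (x, y)) ?_ ?_ ?_ ?_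
  · refine h.1.of_triangleFree_on (q := x) (fun a b hab => hab.1) ?_ ?_
    · intro a b hab ha hb
      refine ⟨hab, ?_, ?_⟩
      · rintro ⟨rfl, rfl⟩; exact ha (SimpleGraph.Reachable.refl _)
      · rintro ⟨rfl, rfl⟩; exact hb (SimpleGraph.Reachable.refl _)
    · intro a b c ha hb hc hab hbc hac
      exact hx (h.1.inTriangle_of_reachable ⟨b, c, hab.1, hac.1, hbc.1⟩ ha.symm)
  · rintro ⟨a, b⟩
    simp only [mem_diff, HH]
    intro hab hab'
    apply hab
    refine ⟨fun hG' => ⟨hab'.1 hG', ?_, ?_⟩, fun h => hab'.2 h.1⟩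
    · rintro ⟨rfl, rfl⟩; exact hG hG'
    · rintro ⟨rfl, rfl⟩; exact hG hG'.symm
  · simp [hH, hG]
  · simp [HH, hG]

/-- If `z` were in a triangle of `H`, its component would be complete multipartite. The edges inside
the neighbourhood of `z`, which is the same in both graphs, are all added. Without them the
component is bipartite between the neighbours of `z` and the part of `z`, at a lower cost. -/
theorem IsOptimal.not_inTriangle_of_not_touched {G H : SimpleGraph V} (h : IsOptimal G H) {z : V}
    (hz : ¬ InTriangle G z) (ht : ¬ Touched G H z) : ¬ InTriangle H z := by
  intro hzH
  obtain ⟨y, w, hy, hw, hyw⟩ := id hzH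
  let H' : SimpleGraph V :=
    { Adj := fun a b => H.Adj a b ∧ ¬ (H.Adj z a ∧ H.Adj z b)
      symm := ⟨fun a b h => by rw [H.adj_comm]; tauto⟩
      loopless := ⟨fun a h => by simp at h⟩ }
  have HH : ∀ a b, H'.Adj a b ↔ H.Adj a b ∧ ¬ (H.Adj z a ∧ H.Adj z b) := fun a b => Iff.rfl
  have hadd : ∀ a b, H.Adj z a → H.Adj z b → ¬ G.Adj a b := by
    intro a b ha hb hab
    rw [adj_iff_of_not_touched ht] at ha hb
    exact hz ⟨a, b, ha, hb, hab⟩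
  refine h.false_of_subset (H' := H') (p := (y, w)) ?_ ?_ ?_ ?_
  · refine h.1.of_triangleFree_on (q := z) (fun a b hab => hab.1) ?_ ?_
    · exact fun a b hab ha hb => ⟨hab, fun h' => ha h'.1.reachable⟩
    · intro a b c ha hb hc hab hbc hac
      have k := fun (d f : V) (hd : H.Reachable z d) (hdf : H.Adj d f) =>
        h.1.adj_or_adj (h.1.inTriangle_of_reachable hzH hd) hdf hd.symm
      have k1 := k a b ha hab.1
      have k2 := k b c hb hbc.1
      have k3 := k a c ha hac.1
      have := hab.2
      have := hbc.2
      have := hac.2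
      tauto
  · rintro ⟨a, b⟩
    simp only [mem_diff, HH]
    have := hadd a b
    tauto
  · have := hadd y w hy hw
    simp [this, hyw]
  · have := hadd y w hy hw
    simp [this, HH, hy, hw]

set_option maxHeartbeats 2000000 in
/-- In an optimal solution, a vertex that is in no triangle of `G` but in one of the solution has
a neighbour in its component that is in a triangle of `G`. -/
theorem IsOptimal.exists_adj_inTriangle {G H : SimpleGraph V} (h : IsOptimal G H) {q : V}
    (hq : ¬ InTriangle G q) (hqH : InTriangle H q) :
    ∃ y, H.Reachable q y ∧ InTriangle G y ∧ G.Adj q y := by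
  classical
  by_contra hcon
  push Not at hcon
  have hK : ∀ d f e, H.Reachable q d → H.Reachable q e → H.Adj d f → H.Adj e d ∨ H.Adj e f :=
    fun d f e hd he hdf =>
      h.1.adj_or_adj (h.1.inTriangle_of_reachable hqH hd) hdf (hd.symm.trans he)
  -- By assumption `q` has no neighbour of `G` in `L`, so its edges to `R` are all added, as are
  -- those from `u` to `J u`. For a suitable `u` in `I`, the component can be made triangle-free by
  -- at most |J u|·|R| deletions, which makes at least |I|·|J u| + |R| additions superfluous. Since
  -- |R| ≤ |I|, this contradicts optimality if `R` is nonempty.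
  let L : Finset V := Finset.univ.filter fun y => H.Reachable q y ∧ InTriangle G y
  let R : Finset V := L.filter fun y => H.Adj q y
  let I : Finset V := Finset.univ.filter fun y => G.Adj q y ∧ H.Adj q y
  let J : V → Finset V := fun u => L.filter fun y => H.Adj u y ∧ ¬ G.Adj u y
  have hL : ∀ y, y ∈ L ↔ H.Reachable q y ∧ InTriangle G y := fun y => by simp [L]
  have hR : ∀ y, y ∈ R ↔ y ∈ L ∧ H.Adj q y := fun y => by simp [R]
  have hI : ∀ y, y ∈ I ↔ G.Adj q y ∧ H.Adj q y := fun y => by simp [I]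
  have hJ : ∀ u y, y ∈ J u ↔ y ∈ L ∧ H.Adj u y ∧ ¬ G.Adj u y := fun u y => by simp [J]
  have hqL : ∀ y ∈ L, ¬ G.Adj q y := fun y hy => hcon y ((hL y).1 hy).1 ((hL y).1 hy).2
  have hIL : ∀ u ∈ I, u ∉ L := fun u hu huL => hqL u huL ((hI u).1 hu).1
  -- isolating `q` is not cheaper
  have hRI : R.card ≤ I.card := by
    let A : Finset V := Finset.univ.filter fun y => ¬ (G.Adj q y ↔ H.Adj q y)
    let B : Finset V := Finset.univ.filter fun y => G.Adj q y
    have hA : ∀ y, y ∈ A ↔ ¬ (G.Adj q y ↔ H.Adj q y) := fun y => by simp [A]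
    have hB : ∀ y, y ∈ B ↔ G.Adj q y := fun y => by simp [B]
    let E : Finset (V × V) := (diff G H).filter fun p => p.1 ≠ q ∧ p.2 ≠ q
    have e1 : (diff G H).card = E.card + (A.card + A.card) := by
      have : diff G H = E ∪ (A.image (fun y => (q, y)) ∪ A.image fun y => (y, q)) := by
        ext ⟨a, b⟩
        simp only [E, Finset.mem_union, Finset.mem_filter, mem_diff, Finset.mem_image, hA,
          Prod.mk.injEq]
        constructor
        · intro hab
          by_cases ha : a = q
          · subst ha; exact Or.inr (Or.inl ⟨b, hab, rfl, rfl⟩)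
          by_cases hb : b = q
          · subst hb
            rw [G.adj_comm, H.adj_comm] at hab
            exact Or.inr (Or.inr ⟨a, hab, rfl, rfl⟩)
          · exact Or.inl ⟨hab, ha, hb⟩
        · rintro (h | ⟨y, hy, rfl, rfl⟩ | ⟨y, hy, rfl, rfl⟩)
          · exact h.1
          · exact hy
          · rwa [G.adj_comm, H.adj_comm]
      rw [this, Finset.card_union_of_disjoint, Finset.card_union_of_disjoint,
        Finset.card_image_of_injective, Finset.card_image_of_injective]
      · intro a b hab; exact (Prod.mk.inj hab).1
      · intro a b hab; exact (Prod.mk.inj hab).2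
      · rw [Finset.disjoint_left]
        rintro ⟨a, b⟩ h1 h2
        simp only [Finset.mem_image, hA, Prod.mk.injEq] at h1 h2
        obtain ⟨y, hy, rfl, rfl⟩ := h1
        obtain ⟨y', hy', rfl, rfl⟩ := h2
        simp at hy
      · rw [Finset.disjoint_left]
        rintro ⟨a, b⟩ h1 h2
        simp only [E, Finset.mem_filter, Finset.mem_union, Finset.mem_image, Prod.mk.injEq] at h1 h2
        rcases h2 with ⟨y, hy, rfl, rfl⟩ | ⟨y, hy, rfl, rfl⟩
        · exact h1.2.1 rfl
        · exact h1.2.2 rfl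
    have e2 : (diff G (isolate H q)).card ≤ E.card + (B.card + B.card) := by
      have : diff G (isolate H q) ⊆
          E ∪ (B.image (fun y => (q, y)) ∪ B.image fun y => (y, q)) := by
        rintro ⟨a, b⟩
        simp only [E, Finset.mem_union, Finset.mem_filter, mem_diff, Finset.mem_image, hB,
          Prod.mk.injEq, isolate_adj]
        intro hab
        by_cases ha : a = q
        · subst ha; exact Or.inr (Or.inl ⟨b, by tauto, rfl, rfl⟩)
        by_cases hb : b = q
        · subst hb
          exact Or.inr (Or.inr ⟨a, (by rw [G.adj_comm]; tauto), rfl, rfl⟩)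
        · exact Or.inl ⟨by tauto, ha, hb⟩
      refine (Finset.card_le_card this).trans ((Finset.card_union_le _ _).trans ?_)
      refine Nat.add_le_add_left ((Finset.card_union_le _ _).trans ?_) _
      exact Nat.add_le_add Finset.card_image_le Finset.card_image_le
    have e3 := h.2 _ (h.1.isolate q)
    -- At `q` the solution pays `A`, which contains the additions `R` and the deletions `B \ I`;
    -- isolating `q` pays at most `B`.
    have e4 : A.card ≤ B.card := by omega
    have e5 : R.card + (B \ I).card ≤ A.card := by
      rw [← Finset.card_union_of_disjoint]
      · apply Finset.card_le_card
        intro y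
        simp only [Finset.mem_union, Finset.mem_sdiff, hA, hB, hI, hR]
        have := hqL y
        tauto
      · rw [Finset.disjoint_left]
        intro y hy hy'
        exact hqL y ((hR y).1 hy).1 ((hB y).1 (Finset.mem_sdiff.1 hy').1)
    have e6 : (B \ I).card + I.card = B.card := Finset.card_sdiff_add_card_eq_card fun y hy =>
      (hB y).2 ((hI y).1 hy).1
    omega
  have hRne : R.Nonempty → ∃ u ∈ I, ∀ u' ∈ I, (J u).card ≤ (J u').card := by
    intro hRn
    exact Finset.exists_min_image I _ (Finset.card_pos.1
      (lt_of_lt_of_le (Finset.card_pos.2 hRn) hRI))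
  -- make the component triangle-free
  have hcover : ∀ T : Finset V, (∀ a b c, H.Reachable q a → H.Adj a b → G.Adj a b → H.Adj b c →
      G.Adj b c → H.Adj a c → G.Adj a c → (a ∈ T ∧ (b ∈ R ∨ c ∈ R)) ∨ (b ∈ T ∧ (a ∈ R ∨ c ∈ R)) ∨
        (c ∈ T ∧ (a ∈ R ∨ b ∈ R))) →
      ((Finset.univ : Finset (V × V)).filter fun p => H.Reachable q p.1 ∧ H.Adj p.1 p.2 ∧
        ¬ G.Adj p.1 p.2).card ≤ 2 * (T.card * R.card) := by
    intro T hT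
    -- In this component, take back all additions and delete the edges between `T` and `R`; by `hT`
    -- these meet all remaining triangles.
    let H' : SimpleGraph V :=
      { Adj := fun a b => H.Adj a b ∧ (H.Reachable q a ∨ H.Reachable q b → G.Adj a b ∧
          ¬ (a ∈ T ∧ b ∈ R) ∧ ¬ (b ∈ T ∧ a ∈ R))
        symm := ⟨fun a b h => by rw [H.adj_comm, G.adj_comm]; tauto⟩
        loopless := ⟨fun a h => by simp at h⟩ }
    have HH : ∀ a b, H'.Adj a b ↔ H.Adj a b ∧ (H.Reachable q a ∨ H.Reachable q b → G.Adj a b ∧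
          ¬ (a ∈ T ∧ b ∈ R) ∧ ¬ (b ∈ T ∧ a ∈ R)) := fun a b => Iff.rfl
    clear_value H'
    have hH' : LocallyPawFree H' := by
      refine h.1.of_triangleFree_on (q := q) (fun a b hab => ((HH a b).1 hab).1) ?_ ?_
      · exact fun a b hab ha hb => (HH a b).2 ⟨hab, fun h => by tauto⟩
      · intro a b c ha hb hc hab hbc hac
        rw [HH] at hab hbc hac
        have h1 := hab.2 (Or.inl ha)
        have h2 := hbc.2 (Or.inl hb)
        have h3 := hac.2 (Or.inl ha)
        rcases hT a b c ha hab.1 h1.1 hbc.1 h2.1 hac.1 h3.1 with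
          ⟨t, r | r⟩ | ⟨t, r | r⟩ | ⟨t, r | r⟩
        · exact h1.2.1 ⟨t, r⟩
        · exact h3.2.1 ⟨t, r⟩
        · exact h1.2.2 ⟨t, r⟩
        · exact h2.2.1 ⟨t, r⟩
        · exact h3.2.2 ⟨t, r⟩
        · exact h2.2.2 ⟨t, r⟩
    set A := (Finset.univ : Finset (V × V)).filter fun p => H.Reachable q p.1 ∧ H.Adj p.1 p.2 ∧
        ¬ G.Adj p.1 p.2 with hA
    have hAs : A ⊆ diff G H := by
      rintro ⟨a, b⟩
      simp only [hA, Finset.mem_filter, Finset.mem_univ, true_and, mem_diff]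
      tauto
    have hsub : diff G H' ⊆ (diff G H \ A) ∪ (T ×ˢ R ∪ R ×ˢ T) := by
      rintro ⟨a, b⟩
      simp only [hA, Finset.mem_filter, Finset.mem_univ, true_and, mem_diff, Finset.mem_union,
        Finset.mem_sdiff, Finset.mem_product, HH]
      intro hab
      by_cases hHab : H.Adj a b
      · have : H.Reachable q a ↔ H.Reachable q b :=
          ⟨fun h => h.trans hHab.reachable, fun h => h.trans hHab.symm.reachable⟩
        tauto
      · tauto
    have e1 := h.2 _ hH'
    have e2 := (Finset.card_le_card hsub).trans (Finset.card_union_le _ _)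
    have e3 := Finset.card_union_le (T ×ˢ R) (R ×ˢ T)
    have e4 := Finset.card_sdiff_add_card_eq_card hAs
    rw [Finset.card_product, Finset.card_product, mul_comm R.card] at e3
    omega
  rcases R.eq_empty_or_nonempty with hR0 | hRn
  -- A triangle of `G` and `H` in the component would have a vertex in `R`, since `q` sees one end
  -- of each edge. So there is none, hence no edge of the component is added, and the triangle of
  -- `H` at `q` is a triangle of `G`.
  · have e1 := hcover ∅ (by
      intro a b c ha hab hab' hbc hbc' hac hac'
      exfalso
      have haL : a ∈ L := (hL a).2 ⟨ha, b, c, hab', hac', hbc'⟩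
      have hbL : b ∈ L := (hL b).2 ⟨ha.trans hab.reachable, a, c, hab'.symm, hbc', hac'⟩
      rcases hK a b q ha (SimpleGraph.Reachable.refl _) hab with h | h
      · exact Finset.notMem_empty a (hR0 ▸ (hR a).2 ⟨haL, h⟩)
      · exact Finset.notMem_empty b (hR0 ▸ (hR b).2 ⟨hbL, h⟩))
    simp only [Finset.card_empty, zero_mul, mul_zero, nonpos_iff_eq_zero, Finset.card_eq_zero] at e1
    have e2 : ∀ a b, H.Reachable q a → H.Adj a b → G.Adj a b := by
      intro a b ha hab
      by_contra hc
      exact Finset.notMem_empty (a, b) (e1 ▸ by simp [ha, hab, hc])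
    obtain ⟨y, z, hy, hz, hyz⟩ := hqH
    exact hq ⟨y, z, e2 _ _ (SimpleGraph.Reachable.refl _) hy,
      e2 _ _ (SimpleGraph.Reachable.refl _) hz, e2 _ _ hy.reachable hyz⟩
  · obtain ⟨u, hu, hmin⟩ := hRne hRn
    have huI := (hI u).1 hu
    have hur : H.Reachable q u := huI.2.reachable
    have huZ : ¬ InTriangle G u := fun h => hIL u hu ((hL u).2 ⟨hur, h⟩)
    -- Both `q` and `u` are adjacent in `H` to at least two vertices of the triangle. As `u` is in
    -- no triangle of `G`, it is adjacent in `G` to at most one, so some vertex is in `J u`, and one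
    -- of the other two is in `R`.
    have e1 := hcover (J u) (by
      intro a b c ha hab hab' hbc hbc' hac hac'
      have hb := ha.trans hab.reachable
      have hc := ha.trans hac.reachable
      have haL : a ∈ L := (hL a).2 ⟨ha, b, c, hab', hac', hbc'⟩
      have hbL : b ∈ L := (hL b).2 ⟨hb, a, c, hab'.symm, hbc', hac'⟩
      have hcL : c ∈ L := (hL c).2 ⟨hc, a, b, hac'.symm, hbc'.symm, hab'⟩
      have r1 := hK a b q ha (SimpleGraph.Reachable.refl _) hab
      have r2 := hK b c q hb (SimpleGraph.Reachable.refl _) hbc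
      have r3 := hK a c q ha (SimpleGraph.Reachable.refl _) hac
      have u1 := hK a b u ha hur hab
      have u2 := hK b c u hb hur hbc
      have u3 := hK a c u ha hur hac
      have z1 : ¬ (G.Adj u a ∧ G.Adj u b) := fun h => huZ ⟨a, b, h.1, h.2, hab'⟩
      have z2 : ¬ (G.Adj u b ∧ G.Adj u c) := fun h => huZ ⟨b, c, h.1, h.2, hbc'⟩
      have z3 : ¬ (G.Adj u a ∧ G.Adj u c) := fun h => huZ ⟨a, c, h.1, h.2, hac'⟩
      simp only [hJ, hR, haL, hbL, hcL, true_and]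
      clear hmin hcover hK hcon hqL hIL hL hR hI hJ hRne
      by_cases ga : G.Adj u a <;> by_cases gb : G.Adj u b <;> by_cases gc : G.Adj u c <;>
        simp only [ga, gb, gc, and_true, not_true_eq_false, not_false_eq_true, and_false,
          false_and, or_false, false_or] at * <;> tauto)
    set A := (Finset.univ : Finset (V × V)).filter fun p => H.Reachable q p.1 ∧ H.Adj p.1 p.2 ∧
        ¬ G.Adj p.1 p.2 with hA
    -- These pairs are directed into `L`, so they are disjoint from their reversals, and `A` has at
    -- least twice as many elements.
    let P : Finset (V × V) := A.filter fun p => p.1 ∉ L ∧ p.2 ∈ L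
    have hP : ∀ a b, (a, b) ∈ P ↔ (H.Reachable q a ∧ H.Adj a b ∧ ¬ G.Adj a b) ∧ a ∉ L ∧ b ∈ L :=
      fun a b => by simp [P, hA]
    have e2 : P.card + P.card ≤ A.card := by
      have hsw : (P.image Prod.swap).card = P.card :=
        Finset.card_image_of_injective _ Prod.swap_injective
      conv_lhs => rw [← hsw]
      conv_lhs => arg 2; rw [hsw]
      rw [← Finset.card_union_of_disjoint]
      · apply Finset.card_le_card
        rintro ⟨a, b⟩ hab
        rw [Finset.mem_union, Finset.mem_image] at hab
        rcases hab with ⟨⟨b', a'⟩, hab, he⟩ | hab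
        · obtain ⟨rfl, rfl⟩ := Prod.mk.inj he
          have := (hP _ _).1 hab
          simp only [hA, Finset.mem_filter, Finset.mem_univ, true_and]
          exact ⟨this.1.1.trans this.1.2.1.reachable, this.1.2.1.symm,
            fun h => this.1.2.2 h.symm⟩
        · exact (Finset.mem_filter.1 hab).1
      · rw [Finset.disjoint_left]
        rintro ⟨a, b⟩ h1 h2
        rw [Finset.mem_image] at h1
        obtain ⟨⟨b', a'⟩, hab, he⟩ := h1
        obtain ⟨rfl, rfl⟩ := Prod.mk.inj he
        exact ((hP _ _).1 hab).2.1 ((hP _ _).1 h2).2.2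
    -- Each vertex of `I` contributes at least |J u| pairs by the minimality of `u`; `q`, which is
    -- not in `I`, contributes `R`.
    have e3 : I.card * (J u).card + R.card ≤ P.card := by
      have hsub : (I.sigma J).image (fun s => (s.1, s.2)) ∪ R.image (fun y => (q, y)) ⊆ P := by
        rintro ⟨a, b⟩ hab
        simp only [Finset.mem_union, Finset.mem_image, Finset.mem_sigma, Sigma.exists,
          Prod.mk.injEq] at hab
        rw [hP]
        rcases hab with ⟨a, b, ⟨h1, h2⟩, rfl, rfl⟩ | ⟨b, h1, rfl, rfl⟩
        · have h3 := (hJ _ _).1 h2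
          exact ⟨⟨((hI _).1 h1).2.reachable, h3.2⟩, hIL _ h1, h3.1⟩
        · have h3 := (hR _).1 h1
          exact ⟨⟨SimpleGraph.Reachable.refl _, h3.2, hqL _ h3.1⟩,
            fun h => hq ((hL _).1 h).2, h3.1⟩
      refine le_trans ?_ (Finset.card_le_card hsub)
      rw [Finset.card_union_of_disjoint, Finset.card_image_of_injective,
        Finset.card_image_of_injective, Finset.card_sigma]
      · gcongr
        rw [← smul_eq_mul]
        exact Finset.card_nsmul_le_sum I _ _ hmin
      · intro a b hab; exact (Prod.mk.inj hab).2
      · rintro ⟨a, b⟩ ⟨a', b'⟩ hab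
        obtain ⟨rfl, rfl⟩ := Prod.mk.inj hab
        rfl
      · rw [Finset.disjoint_left]
        rintro ⟨a, b⟩ h1 h2
        simp only [Finset.mem_image, Finset.mem_sigma, Sigma.exists, Prod.mk.injEq] at h1 h2
        obtain ⟨a, b, ⟨h1, -⟩, rfl, rfl⟩ := h1
        obtain ⟨y, -, rfl, -⟩ := h2
        exact G.loopless.irrefl _ ((hI _).1 h1).1
    have e4 : (J u).card * R.card ≤ I.card * (J u).card := by
      rw [mul_comm]; exact Nat.mul_le_mul_right _ hRI
    have := Finset.card_pos.2 hRn
    omega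

open Classical in
/-- The neighbours of `x` other than `v` that are in no triangle. -/
noncomputable def triangleFreeNeighbors (G : SimpleGraph V) (v x : V) : Finset V :=
  Finset.univ.filter fun z => z ≠ v ∧ G.Adj z x ∧ ¬ InTriangle G z

/-- `v` is in no triangle, and its neighbours cannot be in triangles of an optimal solution. -/
def TriangleFreeRule (G : SimpleGraph V) (k : ℕ) (v : V) : Prop :=
  ¬ InTriangle G v ∧ ∀ x, G.Adj v x → 2 * k < (triangleFreeNeighbors G v x).card ∨
    ¬ InTriangle G x ∧
      ∀ y, G.Adj x y → InTriangle G y → 2 * k < (triangleFreeNeighbors G v y).card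

omit [Fintype V] in
theorem inTriangle_isolate {G : SimpleGraph V} {v : V} (hv : ¬ InTriangle G v) (x : V) :
    InTriangle (isolate G v) x ↔ InTriangle G x := by
  constructor
  · rintro ⟨y, z, h1, h2, h3⟩
    exact ⟨y, z, h1.1, h2.1, h3.1⟩
  · rintro ⟨y, z, h1, h2, h3⟩
    have hx : x ≠ v := by rintro rfl; exact hv ⟨y, z, h1, h2, h3⟩
    have hy : y ≠ v := by rintro rfl; exact hv ⟨x, z, h1.symm, h3, h2⟩
    have hz : z ≠ v := by rintro rfl; exact hv ⟨x, y, h2.symm, h3.symm, h1⟩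
    exact ⟨y, z, ⟨h1, hx, hy⟩, ⟨h2, hx, hz⟩, h3, hy, hz⟩

/-- In an optimal solution, a vertex with more than 2k triangle-free neighbours has an untouched
one, which is in no triangle of the solution, so the vertex is in none either. By
`IsOptimal.exists_adj_inTriangle` no neighbour of `v` is then in a triangle. Two neighbours of `v`
are not adjacent in the solution, as an added edge would lie in a component with triangles. Hence
restoring `v` creates no triangle, and `v` is attached to none. -/
theorem TriangleFreeRule.editable {G : SimpleGraph V} {k : ℕ} {v : V}
    (hv : TriangleFreeRule G k v) (h : Editable (isolate G v) k) : Editable G k := by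
  obtain ⟨hvZ, hsafe⟩ := hv
  obtain ⟨H', hH', hk⟩ := h.exists_isOptimal
  have many : ∀ x, x ≠ v → 2 * k < (triangleFreeNeighbors G v x).card → ¬ InTriangle H' x := by
    intro x hxv hx hxt
    obtain ⟨z, hz, hzt⟩ := exists_not_touched hk hx
    simp only [triangleFreeNeighbors, Finset.mem_filter, Finset.mem_univ, true_and] at hz
    refine hH'.not_inTriangle_of_not_touched (fun h => hz.2.2 ((inTriangle_isolate hvZ z).1 h)) hzt
      (hH'.1.inTriangle_of_adj hxt ?_)
    rw [adj_iff_of_not_touched' hzt]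
    exact ⟨hz.2.1.symm, hxv, hz.1⟩
  have nbr : ∀ x, G.Adj v x → ¬ InTriangle H' x := by
    intro x hvx hxt
    rcases hsafe x hvx with h1 | ⟨h1, h2⟩
    · exact many x hvx.ne.symm h1 hxt
    · obtain ⟨y, hy, hyt, hxy⟩ := hH'.exists_adj_inTriangle
        (fun h => h1 ((inTriangle_isolate hvZ x).1 h)) hxt
      exact many y hxy.2.2 (h2 y hxy.1 ((inTriangle_isolate hvZ y).1 hyt))
        (hH'.1.inTriangle_of_reachable hxt hy)
  refine ⟨restore G H' v, ?_, (Finset.card_le_card (diff_restore_subset G H' v)).trans hk⟩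
  have tri : ∀ x y, G.Adj v x → G.Adj v y → ¬ H'.Adj x y := by
    intro x y hx hy hxy
    by_cases hG : G.Adj x y
    · exact hvZ ⟨x, y, hx, hy, hG⟩
    · exact nbr x hx (hH'.inTriangle_of_added hxy fun h => hG h.1)
  intro a b c d hab hbc hac hcd
  have ha : a ≠ v := by
    rintro rfl
    rw [restore_adj_left] at hab hac
    rw [restore_adj hab.ne.symm hac.ne.symm] at hbc
    exact tri b c hab hac hbc
  have hb : b ≠ v := by
    rintro rfl
    rw [restore_adj_left] at hbc
    rw [restore_adj_right] at hab
    rw [restore_adj hab.ne hbc.ne.symm] at hac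
    exact tri a c hab.symm hbc hac
  have hc : c ≠ v := by
    rintro rfl
    rw [restore_adj_right] at hbc hac
    rw [restore_adj hac.ne hbc.ne] at hab
    exact tri a b hac.symm hbc.symm hab
  rw [restore_adj ha hb] at hab
  rw [restore_adj hb hc] at hbc
  rw [restore_adj ha hc] at hac
  by_cases hd : d = v
  · subst hd
    rw [restore_adj_right] at hcd
    exact absurd ⟨a, b, hac.symm, hbc.symm, hab⟩ (nbr c hcd.symm)
  · rw [restore_adj hc hd] at hcd
    rw [restore_adj hd ha, restore_adj hd hb]
    exact hH'.1 a b c d hab hbc hac hcd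

end TriangleFree

end PawEditing
namespace PawEditing

/-! ### Irreducible graphs are small -/

section Bound

variable {V : Type*}

/-- The subgraph of `G` induced by `m` and the vertices outside `M`. -/
def outside (G : SimpleGraph V) (M : Finset V) (m : V) : SimpleGraph V where
  Adj a b := G.Adj a b ∧ (a ∉ M ∨ a = m) ∧ (b ∉ M ∨ b = m)
  symm := ⟨fun _ _ h => ⟨h.1.symm, h.2.2, h.2.1⟩⟩
  loopless := ⟨fun _ h => h.1.ne rfl⟩

theorem outside_adj {G : SimpleGraph V} {M : Finset V} {m a b : V} :
    (outside G M m).Adj a b ↔ G.Adj a b ∧ (a ∉ M ∨ a = m) ∧ (b ∉ M ∨ b = m) := Iff.rfl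

/-- `MateRule` counts twin classes by their least members; this passes from a mate to the least
member of its class. -/
theorem Mate.congr {G : SimpleGraph V} {v u u' : V} (h : Mate G v u)
    (hu : ∀ x, G.Adj u' x ↔ G.Adj u x) : Mate G v u' := by
  refine ⟨((hu v).2 h.1.symm).symm, fun w hwv hwu x => ?_, fun w hwu hwv => ?_⟩
  · rw [h.2.1 w hwv (fun h' => hwu (((hu w).2 h'.symm).symm)) x, hu]
  · exact h.2.2 w ((hu w).1 hwu.symm).symm hwv

variable [Fintype V]

/-- One of the reduction rules deletes `v`. -/
def Deletable [LinearOrder V] (G : SimpleGraph V) (k : ℕ) (v : V) : Prop :=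
  PatternRule G k v ∨ MateRule G k v ∨ TriangleFreeRule G k v ∨ ComponentRule G v

theorem Deletable.editable_iff [LinearOrder V] {G : SimpleGraph V} {k : ℕ} {v : V}
    (h : Deletable G k v) : Editable (isolate G v) k ↔ Editable G k := by
  refine ⟨fun h' => ?_, fun h' => h'.isolate v⟩
  rcases h with h | h | h | h
  · exact h.editable h'
  · exact h.editable h'
  · exact h.editable h'
  · exact h.editable h'

/-- No reduction rule applies. -/
def Irreducible [LinearOrder V] (G : SimpleGraph V) (k : ℕ) : Prop :=
  ∀ v u, G.Adj v u → ¬ Deletable G k v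

/-- Vertices that differ only in their adjacency to `N`, and to which the pattern rule does not
apply, are few. -/
theorem card_le_of_homogeneous {G : SimpleGraph V} {k : ℕ} (X N : Finset V)
    (hX : ∀ x ∈ X, ¬ PatternRule G k x)
    (hN : ∀ q, q ∉ N → ∀ x ∈ X, ∀ x' ∈ X, x ≠ q → x' ≠ q → (G.Adj x q → G.Adj x' q)) :
    X.card ≤ (2 * k + 4) * (2 * N.card + 1) ^ 3 := by
  classical
  -- The triple `t x` witnesses that the pattern rule fails at `x`; its value off `X` is irrelevant.
  have hex : ∀ x : V, ∃ t : V × V × V, x ∈ X → t.1 ≠ x ∧ t.2.1 ≠ x ∧ t.2.2 ≠ x ∧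
      (Finset.univ.filter fun y => y ≠ x ∧ y ≠ t.1 ∧ y ≠ t.2.1 ∧ y ≠ t.2.2 ∧
        (G.Adj y t.1 ↔ G.Adj x t.1) ∧ (G.Adj y t.2.1 ↔ G.Adj x t.2.1) ∧
        (G.Adj y t.2.2 ↔ G.Adj x t.2.2)).card ≤ 2 * k := by
    intro x
    by_cases hx : x ∈ X
    · have := hX x hx
      simp only [PatternRule, not_forall, not_lt] at this
      obtain ⟨a, b, c, ha, hb, hc, h⟩ := this
      exact ⟨(a, b, c), fun _ => ⟨ha, hb, hc, h⟩⟩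
    · exact ⟨(x, x, x), fun h => absurd h hx⟩
  choose t ht using hex
  -- Outside `N` all vertices of `X` look alike, so `none` suffices there; inside `N` the witness
  -- and its adjacency are recorded. This gives 2|N| + 1 values per coordinate.
  let f : V → V → Option (N × Bool) := fun x a =>
    if h : a ∈ N then some (⟨a, h⟩, decide (G.Adj x a)) else none
  have hf : ∀ x a x' a', x ∈ X → x' ∈ X → x ≠ a → x' ≠ a → f x a = f x' a' →
      (G.Adj x' a ↔ G.Adj x a) := by
    intro x a x' a' hx hx' hxa hxa' h
    by_cases ha : a ∈ N
    · by_cases ha' : a' ∈ N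
      · simp only [f, ha, ha', dif_pos, Option.some.injEq, Prod.mk.injEq, Subtype.mk.injEq,
          decide_eq_decide] at h
        obtain ⟨rfl, h⟩ := h
        exact h.symm
      · simp [f, ha, ha'] at h
    · exact ⟨hN a ha x' hx' x hx hxa' hxa, hN a ha x hx x' hx' hxa hxa'⟩
  let F : V → Option (N × Bool) × Option (N × Bool) × Option (N × Bool) := fun x =>
    (f x (t x).1, f x (t x).2.1, f x (t x).2.2)
  -- A fibre contains `x`, possibly its three witnesses, and at most 2k further vertices with the
  -- pattern of `x`.
  have h1 := Finset.card_le_mul_card_image (f := F) X (2 * k + 4) (by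
    intro y hy
    obtain ⟨x, hx, rfl⟩ := Finset.mem_image.1 hy
    have hsub : X.filter (fun x' => F x' = F x) ⊆ {x, (t x).1, (t x).2.1, (t x).2.2} ∪
        (Finset.univ.filter fun y => y ≠ x ∧ y ≠ (t x).1 ∧ y ≠ (t x).2.1 ∧ y ≠ (t x).2.2 ∧
        (G.Adj y (t x).1 ↔ G.Adj x (t x).1) ∧ (G.Adj y (t x).2.1 ↔ G.Adj x (t x).2.1) ∧
        (G.Adj y (t x).2.2 ↔ G.Adj x (t x).2.2)) := by
      intro x' hx'
      obtain ⟨hx'X, hF⟩ := Finset.mem_filter.1 hx'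
      simp only [F, Prod.mk.injEq] at hF
      simp only [Finset.mem_union, Finset.mem_insert, Finset.mem_singleton, Finset.mem_filter,
        Finset.mem_univ, true_and]
      by_cases c1 : x' = x
      · tauto
      by_cases c2 : x' = (t x).1
      · tauto
      by_cases c3 : x' = (t x).2.1
      · tauto
      by_cases c4 : x' = (t x).2.2
      · tauto
      have htx := ht x hx
      exact Or.inr ⟨c1, c2, c3, c4, hf _ _ _ _ hx hx'X htx.1.symm c2 hF.1.symm,
        hf _ _ _ _ hx hx'X htx.2.1.symm c3 hF.2.1.symm,
        hf _ _ _ _ hx hx'X htx.2.2.1.symm c4 hF.2.2.symm⟩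
    have h2 := (Finset.card_le_card hsub).trans (Finset.card_union_le _ _)
    have h3 : ({x, (t x).1, (t x).2.1, (t x).2.2} : Finset V).card ≤ 4 := Finset.card_le_four
    have h4 := (ht x hx).2.2.2
    omega)
  refine h1.trans (Nat.mul_le_mul_left _ ?_)
  have h2 := Finset.card_le_univ (X.image F)
  simp only [Fintype.card_prod, Fintype.card_option, Fintype.card_coe, Fintype.card_bool] at h2
  refine h2.trans (le_of_eq ?_)
  ring

variable [LinearOrder V]

/-- The vertices outside `M` in a component with triangles of `outside G M m`. -/
theorem card_component_le {G : SimpleGraph V} {k : ℕ} (hirr : Irreducible G k) (M : Finset V)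
    (hM : ∀ m, LocallyPawFree (outside G M m)) (m : V) (hm : InTriangle (outside G M m) m)
    (K : Finset V) (hK : ∀ w, w ∈ K ↔ w ∉ M ∧ (outside G M m).Reachable m w) :
    K.card ≤ (M.card + 2 * k + 3) * ((2 * k + 4) * (2 * M.card + 1) ^ 3) := by
  classical
  have hP := hM m
  have hKM : ∀ w ∈ K, w ∉ M := fun w hw => ((hK w).1 hw).1
  have hKt : ∀ w ∈ K, InTriangle (outside G M m) w := fun w hw =>
    hP.inTriangle_of_reachable hm ((hK w).1 hw).2
  have hKadj : ∀ d ∈ K, ∀ f, f ∉ M → ∀ e ∈ K, G.Adj d f → G.Adj e d ∨ G.Adj e f := by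
    intro d hd f hf e he hdf
    have := hP.adj_or_adj (hKt d hd) (f := f) (e := e)
      ⟨hdf, Or.inl (hKM d hd), Or.inl hf⟩ (((hK d).1 hd).2.symm.trans ((hK e).1 he).2)
    exact this.imp (fun h => h.1) (fun h => h.1)
  have hKcl : ∀ w ∈ K, ∀ q, q ∉ M → G.Adj w q → q ∈ K := by
    intro w hw q hq hwq
    refine (hK q).2 ⟨hq, ((hK w).1 hw).2.trans (SimpleGraph.Adj.reachable ?_)⟩
    exact ⟨hwq, Or.inl (hKM w hw), Or.inl hq⟩
  have hnp : ∀ w ∈ K, ¬ Deletable G k w := by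
    intro w hw
    obtain ⟨y, -, hy, -⟩ := hKt w hw
    exact hirr w y hy.1
  -- the parts of `K` are small
  have hpart : ∀ w ∈ K, (K.filter fun x => ¬ G.Adj w x).card ≤
      (2 * k + 4) * (2 * M.card + 1) ^ 3 := by
    intro w hw
    apply card_le_of_homogeneous
    · intro x hx h
      exact hnp x (Finset.mem_filter.1 hx).1 (Or.inl h)
    · intro q hq x hx x' hx' hxq hxq' hadj
      obtain ⟨hx, hwx⟩ := Finset.mem_filter.1 hx
      obtain ⟨hx', hwx'⟩ := Finset.mem_filter.1 hx'
      rcases hKadj x hx q hq x' hx' hadj with h | h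
      · exact absurd (hKadj x' hx' x (hKM x hx) w hw h) (by tauto)
      · exact h
  -- a maximal clique meets all parts
  obtain ⟨R, hR, hmax⟩ := Finset.exists_max_image
    (K.powerset.filter fun R => ∀ x ∈ R, ∀ y ∈ R, x ≠ y → G.Adj x y) Finset.card
    ⟨∅, by simp⟩
  simp only [Finset.mem_filter, Finset.mem_powerset] at hR hmax
  obtain ⟨hRK, hRc⟩ := hR
  have hcover : K ⊆ R.biUnion fun w => K.filter fun x => ¬ G.Adj w x := by
    intro w hw
    rw [Finset.mem_biUnion]
    by_contra hcon
    push Not at hcon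
    have hadj : ∀ r ∈ R, G.Adj r w := by
      intro r hr
      have := hcon r hr
      by_contra h
      exact this (Finset.mem_filter.2 ⟨hw, h⟩)
    have hwR : w ∉ R := fun h => (hadj w h).ne rfl
    have := hmax (insert w R) ⟨Finset.insert_subset hw hRK, by
      intro x hx y hy hxy
      rw [Finset.mem_insert] at hx hy
      rcases hx with rfl | hx <;> rcases hy with rfl | hy
      · exact absurd rfl hxy
      · exact (hadj y hy).symm
      · exact hadj x hx
      · exact hRc x hx y hy hxy⟩
    rw [Finset.card_insert_of_notMem hwR] at this
    omega
  suffices hRcard : R.card ≤ M.card + 2 * k + 3 by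
    refine (Finset.card_le_card hcover).trans ((Finset.card_biUnion_le_card_mul _ _ _
      fun w hw => hpart w (hRK hw)).trans (Nat.mul_le_mul_right _ hRcard))
  by_contra hlarge
  push Not at hlarge
  -- A triangle outside `M` is present in every `outside G M m'`, so `K` together with any `m'` that
  -- has a neighbour in `K` is still complete multipartite.
  obtain ⟨r₁, h₁, r₂, h₂, r₃, h₃, h₁₂, h₁₃, h₂₃⟩ := Finset.two_lt_card.1 (show 2 < R.card by omega)
  have a₁₂ := hRc _ h₁ _ h₂ h₁₂
  have a₁₃ := hRc _ h₁ _ h₃ h₁₃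
  have a₂₃ := hRc _ h₂ _ h₃ h₂₃
  have o₁ := hKM _ (hRK h₁)
  have o₂ := hKM _ (hRK h₂)
  have o₃ := hKM _ (hRK h₃)
  have hreach : ∀ m', ∀ x ∈ K, (outside G M m').Reachable r₁ x := by
    intro m' x hx
    have e₁₂ : (outside G M m').Adj r₁ r₂ := ⟨a₁₂, Or.inl o₁, Or.inl o₂⟩
    rcases hKadj r₁ (hRK h₁) r₂ o₂ x hx a₁₂ with h | h
    · exact SimpleGraph.Adj.reachable ⟨h.symm, Or.inl o₁, Or.inl (hKM x hx)⟩
    · exact e₁₂.reachable.trans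
        (SimpleGraph.Adj.reachable ⟨h.symm, Or.inl o₂, Or.inl (hKM x hx)⟩)
  have htri : ∀ m', InTriangle (outside G M m') r₁ := fun m' =>
    ⟨r₂, r₃, ⟨a₁₂, Or.inl o₁, Or.inl o₂⟩, ⟨a₁₃, Or.inl o₁, Or.inl o₃⟩, a₂₃, Or.inl o₂, Or.inl o₃⟩
  have hMadj : ∀ m', ∀ y ∈ K, G.Adj y m' → ∀ x ∈ K, ∀ x' ∈ K, G.Adj x x' →
      G.Adj m' x ∨ G.Adj m' x' := by
    intro m' y hy hym x hx x' hx' hxx'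
    have := (hM m').adj_or_adj ((hM m').inTriangle_of_reachable (htri m') (hreach m' x hx))
      (f := x') (e := m') ⟨hxx', Or.inl (hKM x hx), Or.inl (hKM x' hx')⟩
      ((hreach m' x hx).symm.trans ((hreach m' y hy).trans
        (SimpleGraph.Adj.reachable ⟨hym, Or.inl (hKM y hy), Or.inr rfl⟩)))
    exact this.imp (fun h => h.1) (fun h => h.1)
  -- The parts of `K` are thus classes of false twins in all of `G`, also towards `M`; this is what
  -- the mate rule needs.
  have hsame : ∀ x ∈ K, ∀ x' ∈ K, ¬ G.Adj x x' → ∀ y, G.Adj x y → G.Adj x' y := by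
    intro x hx x' hx' hxx' y hxy
    by_cases hy : y ∈ M
    · have := (hM y).adj_or_adj ((hM y).inTriangle_of_reachable (htri y) (hreach y x hx))
        (f := y) (e := x') ⟨hxy, Or.inl (hKM x hx), Or.inr rfl⟩
        ((hreach y x hx).symm.trans (hreach y x' hx'))
      rcases this with h | h
      · exact absurd h.1.symm hxx'
      · exact h.1
    · rcases hKadj x hx y hy x' hx' hxy with h | h
      · exact absurd h.symm hxx'
      · exact h
  -- few parts are missed by a vertex of `M`
  let R' := R.filter fun r => ∀ m' ∈ M, (∃ y ∈ K, G.Adj y m') → G.Adj m' r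
  have hR' : M.card + R'.card ≥ R.card := by
    have hsub : R ⊆ (M.biUnion fun m' => R.filter fun r => (∃ y ∈ K, G.Adj y m') ∧ ¬ G.Adj m' r) ∪
        R' := by
      intro r hr
      by_cases h : r ∈ R'
      · exact Finset.mem_union_right _ h
      · apply Finset.mem_union_left
        simp only [R', Finset.mem_filter, hr, true_and, not_forall] at h
        obtain ⟨m', hm', hy, h⟩ := h
        exact Finset.mem_biUnion.2 ⟨m', hm', Finset.mem_filter.2 ⟨hr, hy, h⟩⟩
    have h1 := (Finset.card_le_card hsub).trans (Finset.card_union_le _ _)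
    have h2 := Finset.card_biUnion_le_card_mul M
      (fun m' => R.filter fun r => (∃ y ∈ K, G.Adj y m') ∧ ¬ G.Adj m' r) 1 (by
        intro m' _
        rw [Finset.card_le_one]
        intro r hr r' hr'
        obtain ⟨hr, ⟨y, hy, hym⟩, hmr⟩ := Finset.mem_filter.1 hr
        obtain ⟨hr', -, hmr'⟩ := Finset.mem_filter.1 hr'
        by_contra hne
        have := hMadj m' y hy hym r (hRK hr) r' (hRK hr') (hRc r hr r' hr' hne)
        tauto)
    omega
  have hRR : ∀ r ∈ R', r ∈ R := fun r hr => (Finset.mem_filter.1 hr).1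
  -- A vertex that distinguishes two members of `R'` is not in `M` by the choice of `R'`. So it is
  -- in `K` and is a false twin of the member it misses.
  have hmate : ∀ v ∈ R', ∀ u ∈ R', v ≠ u → Mate G v u := by
    have half : ∀ v ∈ R', ∀ u ∈ R', ∀ w, G.Adj w v → ¬ G.Adj w u → ∀ x, G.Adj w x ↔ G.Adj u x := by
      intro v hv u hu w hwv hwu x
      have hwM : w ∉ M := fun hwM =>
        hwu ((Finset.mem_filter.1 hu).2 w hwM ⟨v, hRK (hRR v hv), hwv.symm⟩)
      have hwK := hKcl v (hRK (hRR v hv)) w hwM hwv.symm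
      exact ⟨hsame w hwK u (hRK (hRR u hu)) hwu x,
        hsame u (hRK (hRR u hu)) w hwK (fun h => hwu h.symm) x⟩
    intro v hv u hu hvu
    exact ⟨hRc v (hRR v hv) u (hRR u hu) hvu, half v hv u hu, half u hu v hv⟩
  obtain ⟨v, hv⟩ : R'.Nonempty := Finset.card_pos.1 (by omega)
  have hmin : ∀ u : V, ∃ u', (∀ x, G.Adj u' x ↔ G.Adj u x) ∧
      ∀ u'', u'' < u' → ¬ ∀ x, G.Adj u'' x ↔ G.Adj u' x := by
    intro u
    obtain ⟨u', h1, h2⟩ := Finset.exists_min_image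
      (Finset.univ.filter fun u' => ∀ x, G.Adj u' x ↔ G.Adj u x) id ⟨u, by simp⟩
    have h1 := (Finset.mem_filter.1 h1).2
    refine ⟨u', h1, fun u'' hlt h => ?_⟩
    have := h2 u'' (Finset.mem_filter.2 ⟨Finset.mem_univ _, fun x => (h x).trans (h1 x)⟩)
    exact absurd hlt (not_lt.2 this)
  choose g hg1 hg2 using hmin
  refine hnp v (hRK (hRR v hv)) (Or.inr (Or.inl ?_))
  -- Adjacent vertices are not false twins, so the members of the clique have different least twins.
  have hle : (R'.erase v).card ≤ (Finset.univ.filter fun u => Mate G v u ∧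
      ∀ u', u' < u → ¬ ∀ x, G.Adj u' x ↔ G.Adj u x).card := by
    refine Finset.card_le_card_of_injOn g ?_ ?_
    · intro u hu
      have hu := Finset.mem_erase.1 hu
      exact Finset.mem_filter.2 ⟨Finset.mem_univ _,
        (hmate v hv u hu.2 hu.1.symm).congr (hg1 u), hg2 u⟩
    · intro u hu u' hu' hgu
      have hu := Finset.mem_erase.1 hu
      have hu' := Finset.mem_erase.1 hu'
      by_contra hne
      have h1 := hRc u (hRR u hu.2) u' (hRR u' hu'.2) hne
      rw [← hg1, hgu, hg1] at h1
      exact h1.ne rfl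
  have := Finset.card_erase_of_mem hv
  unfold MateRule
  convert lt_of_lt_of_le (by omega : 2 * k + 2 < (R'.erase v).card) hle

end Bound

end PawEditing
namespace PawEditing

/-! ### Counting the vertices of an irreducible graph -/

section Bound

variable {V : Type*} [Fintype V]

open Classical in
/-- The vertices that are not isolated. -/
noncomputable def support (G : SimpleGraph V) : Finset V :=
  Finset.univ.filter fun v => ∃ u, G.Adj v u

theorem mem_support {G : SimpleGraph V} {v : V} : v ∈ support G ↔ ∃ u, G.Adj v u := by
  simp [support]

variable [LinearOrder V]

/-- As the rule fails at `v`, some neighbour `x` has few triangle-free neighbours, and `x` is in `W`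
or adjacent to such a vertex of `W`. So `v` is reached from `W` in at most two steps, each with at
most 2k + 1 choices, where the extra one is `v` itself. -/
theorem card_triangleFree_le {G : SimpleGraph V} {k : ℕ} (hirr : Irreducible G k) (W : Finset V)
    (hW : ∀ v, v ∉ W → ¬ InTriangle G v → ∀ x, G.Adj v x → InTriangle G x → x ∈ W)
    (S : Finset V) (hS : ∀ v ∈ S, v ∈ support G ∧ ¬ InTriangle G v) :
    S.card ≤ W.card * (1 + (2 * k + 1) + (2 * k + 1) ^ 2) := by
  classical
  let N : V → Finset V := fun x => Finset.univ.filter fun z => G.Adj z x ∧ ¬ InTriangle G z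
  have hN : ∀ x z, z ∈ N x ↔ G.Adj z x ∧ ¬ InTriangle G z := fun x z => by simp [N]
  let W' := W.filter fun x => (N x).card ≤ 2 * k + 1
  let N' : V → Finset V := fun y =>
    ((N y).filter fun x => (N x).card ≤ 2 * k + 1).biUnion N
  have hNt : ∀ v x, (triangleFreeNeighbors G v x).card ≤ 2 * k → (N x).card ≤ 2 * k + 1 := by
    intro v x h
    have : N x ⊆ insert v (triangleFreeNeighbors G v x) := by
      intro z hz
      rw [hN] at hz
      by_cases hzv : z = v
      · simp [hzv]
      · simp [triangleFreeNeighbors, hz.1, hz.2, hzv]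
    have := (Finset.card_le_card this).trans (Finset.card_insert_le _ _)
    omega
  have hsub : S ⊆ (W ∪ W'.biUnion N) ∪ W'.biUnion N' := by
    intro v hv
    obtain ⟨hvs, hvZ⟩ := hS v hv
    by_cases hvW : v ∈ W
    · exact Finset.mem_union_left _ (Finset.mem_union_left _ hvW)
    obtain ⟨u, hu⟩ := mem_support.1 hvs
    have hnot : ¬ TriangleFreeRule G k v := fun h => hirr v u hu (Or.inr (Or.inr (Or.inl h)))
    simp only [TriangleFreeRule, hvZ, not_false_eq_true, true_and, not_forall, not_or, not_lt,
      not_and] at hnot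
    obtain ⟨x, hvx, hx, h⟩ := hnot
    have hxc := hNt v x hx
    by_cases hxW : x ∈ W
    · exact Finset.mem_union_left _ (Finset.mem_union_right _ (Finset.mem_biUnion.2
        ⟨x, Finset.mem_filter.2 ⟨hxW, hxc⟩, (hN _ _).2 ⟨hvx, hvZ⟩⟩))
    have hxZ : ¬ InTriangle G x := fun hxt => hxW (hW v hvW hvZ x hvx hxt)
    obtain ⟨y, hxy, hyt, hy⟩ := h hxZ
    have hyW := hW x hxW hxZ y hxy hyt
    exact Finset.mem_union_right _ (Finset.mem_biUnion.2
        ⟨y, Finset.mem_filter.2 ⟨hyW, hNt v y hy⟩, Finset.mem_biUnion.2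
          ⟨x, Finset.mem_filter.2 ⟨(hN _ _).2 ⟨hxy, hxZ⟩, hxc⟩, (hN _ _).2 ⟨hvx, hvZ⟩⟩⟩)
  have e1 := (Finset.card_le_card hsub).trans (Finset.card_union_le _ _)
  have e2 := Finset.card_union_le W (W'.biUnion N)
  have e3 : W'.card ≤ W.card := Finset.card_filter_le _ _
  have e4 := Finset.card_biUnion_le_card_mul W' N (2 * k + 1) fun x hx =>
    (Finset.mem_filter.1 hx).2
  have e5 := Finset.card_biUnion_le_card_mul W' N' ((2 * k + 1) ^ 2) fun y hy => by
    have e6 := Finset.card_biUnion_le_card_mul ((N y).filter fun x => (N x).card ≤ 2 * k + 1) N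
      (2 * k + 1) fun x hx => (Finset.mem_filter.1 hx).2
    have e7 : ((N y).filter fun x => (N x).card ≤ 2 * k + 1).card ≤ 2 * k + 1 :=
      (Finset.card_filter_le _ _).trans (Finset.mem_filter.1 hy).2
    calc _ ≤ _ := e6
      _ ≤ (2 * k + 1) * (2 * k + 1) := Nat.mul_le_mul_right _ e7
      _ = _ := by ring
  have e8 := Nat.mul_le_mul_right (2 * k + 1) e3
  have e9 := Nat.mul_le_mul_right ((2 * k + 1) ^ 2) e3
  rw [mul_add, mul_add, mul_one]
  omega

/-- The number of vertices of an irreducible graph in which every paw has two vertices in a small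
set `M`, and whose paws that meet `M` in a fixed edge of a triangle are covered by few vertices. -/
theorem card_support_le {G : SimpleGraph V} {k K : ℕ} (hk : k ≤ K) (hirr : Irreducible G k)
    (M : Finset V) (hMK : M.card ≤ 2 * K) (hM : ∀ m, LocallyPawFree (outside G M m))
    (hcov : ∀ m ∈ M, ∀ m' ∈ M, G.Adj m m' → ∃ U : Finset V, U.card ≤ 2 * K ∧
      ∀ t s, t ∉ M → s ∉ M → G.Adj m t → G.Adj m' t → G.Adj t s → ¬ G.Adj s m → ¬ G.Adj s m' →
        t ∈ U ∨ s ∈ U) :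
    (support G).card ≤ 10400 * (K + 1) ^ 6 := by
  classical
  have hcov' : ∀ p : V × V, ∃ U : Finset V, U.card ≤ 2 * K ∧ (p ∈ M ×ˢ M → G.Adj p.1 p.2 →
      ∀ t s, t ∉ M → s ∉ M → G.Adj p.1 t → G.Adj p.2 t → G.Adj t s → ¬ G.Adj s p.1 →
        ¬ G.Adj s p.2 → t ∈ U ∨ s ∈ U) := by
    rintro ⟨m, m'⟩
    by_cases h : (m, m') ∈ M ×ˢ M ∧ G.Adj m m'
    · obtain ⟨U, h1, h2⟩ := hcov m (Finset.mem_product.1 h.1).1 m' (Finset.mem_product.1 h.1).2 h.2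
      exact ⟨U, h1, fun _ _ => h2⟩
    · exact ⟨∅, by simp, fun h1 h2 => absurd ⟨h1, h2⟩ h⟩
  choose U hUc hU using hcov'
  -- Outside `W`, the sets `X p` are for vertices whose triangles all have their other two vertices
  -- in `M`, and the sets `C m` for those in a triangle with a further vertex outside `M`.
  let W := M ∪ (M ×ˢ M).biUnion U
  let S := (support G).filter fun v => ¬ InTriangle G v
  let X : V × V → Finset V := fun p => Finset.univ.filter fun v =>
    G.Adj p.1 v ∧ ∀ s, G.Adj v s → s ∈ M ∪ U p
  let C : V → Finset V := fun m => if InTriangle (outside G M m) m then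
    Finset.univ.filter fun v => v ∉ M ∧ (outside G M m).Reachable m v else ∅
  have hMW : ∀ v, v ∉ W → v ∉ M := fun v hv h => hv (Finset.mem_union_left _ h)
  have hUW : ∀ p ∈ M ×ˢ M, ∀ v ∈ U p, v ∈ W := fun p hp v hv =>
    Finset.mem_union_right _ (Finset.mem_biUnion.2 ⟨p, hp, hv⟩)
  have hW : ∀ v, v ∉ W → ¬ InTriangle G v → ∀ x, G.Adj v x → InTriangle G x → x ∈ W := by
    rintro v hvW hvZ x hvx ⟨p, r, hp, hr, hpr⟩
    by_contra hxW
    have hvp : ¬ G.Adj v p := fun h => hvZ ⟨x, p, hvx, h, hp⟩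
    have hvr : ¬ G.Adj v r := fun h => hvZ ⟨x, r, hvx, h, hr⟩
    have hxM := hMW x hxW
    have hvM := hMW v hvW
    by_cases hpM : p ∈ M
    · by_cases hrM : r ∈ M
      · have hm : (p, r) ∈ M ×ˢ M := Finset.mem_product.2 ⟨hpM, hrM⟩
        rcases hU (p, r) hm hpr x v hxM hvM hp.symm hr.symm hvx.symm hvp hvr with h | h
        · exact hxW (hUW _ hm _ h)
        · exact hvW (hUW _ hm _ h)
      · have := hM p p r x v ⟨hpr, Or.inr rfl, Or.inl hrM⟩ ⟨hr.symm, Or.inl hrM, Or.inl hxM⟩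
          ⟨hp.symm, Or.inr rfl, Or.inl hxM⟩ ⟨hvx.symm, Or.inl hxM, Or.inl hvM⟩
        exact this.elim (fun h => hvp h.1) (fun h => hvr h.1)
    · have := hM r p r x v ⟨hpr, Or.inl hpM, Or.inr rfl⟩ ⟨hr.symm, Or.inr rfl, Or.inl hxM⟩
          ⟨hp.symm, Or.inl hpM, Or.inl hxM⟩ ⟨hvx.symm, Or.inl hxM, Or.inl hvM⟩
      exact this.elim (fun h => hvp h.1) (fun h => hvr h.1)
  have hsub : support G ⊆ ((W ∪ S) ∪ (M ×ˢ M).biUnion X) ∪ M.biUnion C := by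
    intro v hv
    simp only [Finset.mem_union]
    by_cases hvW : v ∈ W
    · tauto
    by_cases hvZ : ¬ InTriangle G v
    · exact Or.inl (Or.inl (Or.inr (Finset.mem_filter.2 ⟨hv, hvZ⟩)))
    rw [not_not] at hvZ
    have hvM := hMW v hvW
    by_cases hc : ∀ t p, G.Adj v t → G.Adj v p → G.Adj t p → t ∈ M
    · obtain ⟨m, m', h1, h2, h3⟩ := hvZ
      have hm := hc m m' h1 h2 h3
      have hm' := hc m' m h2 h1 h3.symm
      have hp : (m, m') ∈ M ×ˢ M := Finset.mem_product.2 ⟨hm, hm'⟩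
      refine Or.inl (Or.inr (Finset.mem_biUnion.2 ⟨(m, m'), hp, Finset.mem_filter.2
        ⟨Finset.mem_univ _, h1.symm, fun s hs => ?_⟩⟩))
      by_contra hsM
      rw [Finset.mem_union, not_or] at hsM
      -- If `s` were adjacent to `m` or `m'`, it would be in a triangle with `v` and hence in `M`.
      -- So `v` and `s` complete `m`, `m'` to a paw, which `U` has to meet.
      rcases hU (m, m') hp h3 v s hvM hsM.1 h1.symm h2.symm hs
        (fun h => hsM.1 (hc s m hs h1 h)) (fun h => hsM.1 (hc s m' hs h2 h)) with h | h
      · exact hvW (hUW _ hp _ h)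
      · exact hsM.2 h
    · right
      push Not at hc
      obtain ⟨t, p, hvt, hvp, htp, htM⟩ := hc
      suffices h : ∃ m ∈ M, InTriangle (outside G M m) m ∧ (outside G M m).Reachable m v by
        obtain ⟨m, hm, h1, h2⟩ := h
        refine Finset.mem_biUnion.2 ⟨m, hm, ?_⟩
        simp only [C, if_pos h1]
        exact Finset.mem_filter.2 ⟨Finset.mem_univ _, hvM, h2⟩
      by_cases hpM : p ∈ M
      · have e1 : (outside G M p).Adj p v := ⟨hvp.symm, Or.inr rfl, Or.inl hvM⟩
        exact ⟨p, hpM, ⟨v, t, e1, ⟨htp.symm, Or.inr rfl, Or.inl htM⟩, hvt, Or.inl hvM,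
          Or.inl htM⟩, e1.reachable⟩
      -- As `v` is not in `M`, `outside G M v` is `G` without `M`.
      have h0 := hM v
      have htri : ∀ m, InTriangle (outside G M m) v := fun m =>
        ⟨t, p, ⟨hvt, Or.inl hvM, Or.inl htM⟩, ⟨hvp, Or.inl hvM, Or.inl hpM⟩, htp, Or.inl htM,
          Or.inl hpM⟩
      have h0M : ∀ w, (outside G M v).Reachable v w → w ∉ M := by
        intro w hw
        obtain ⟨y, -, hy, -⟩ := h0.inTriangle_of_reachable (htri v) hw
        rcases hy.2.1 with h | h
        · exact h
        · rwa [h]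
      -- If no vertex of `M` is attached to the component of `v` in G − M, this is a component of
      -- `G`, and the component rule would apply.
      by_cases hm : ∃ m ∈ M, ∃ w, (outside G M v).Reachable v w ∧ G.Adj m w
      · obtain ⟨m, hmM, w, hw, hmw⟩ := hm
        have hle : outside G M v ≤ outside G M m := by
          intro a b hab
          refine ⟨hab.1, ?_, ?_⟩
          · rcases hab.2.1 with h | h
            · exact Or.inl h
            · rw [h]; exact Or.inl hvM
          · rcases hab.2.2 with h | h
            · exact Or.inl h
            · rw [h]; exact Or.inl hvM
        have e1 : (outside G M m).Reachable v m := (hw.mono hle).trans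
          (SimpleGraph.Adj.reachable ⟨hmw.symm, Or.inl (h0M w hw), Or.inr rfl⟩)
        exact ⟨m, hmM, (hM m).inTriangle_of_reachable (htri m) e1, e1.symm⟩
      · exfalso
        push Not at hm
        have hadj : ∀ d e, (outside G M v).Reachable v d → G.Adj d e →
            (outside G M v).Adj d e := by
          intro d e hd hde
          exact ⟨hde, Or.inl (h0M d hd), Or.inl fun he => hm e he d hd hde.symm⟩
        have hvt' : (outside G M v).Adj v t := ⟨hvt, Or.inl hvM, Or.inl htM⟩
        have hD : ∀ d, (G.Adj d v ∨ G.Adj d t) ↔ (outside G M v).Reachable v d := by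
          intro d
          constructor
          · rintro (h | h)
            · exact (hadj v d (SimpleGraph.Reachable.refl _) h.symm).reachable
            · exact hvt'.reachable.trans (hadj t d hvt'.reachable h.symm).reachable
          · intro h
            exact (h0.adj_or_adj (htri v) hvt' h).imp (fun h => h.1) (fun h => h.1)
        refine hirr v t hvt (Or.inr (Or.inr (Or.inr ⟨t, hvt, ?_, ?_⟩)))
        · intro d e hd hde
          rw [hD] at hd ⊢
          exact hd.trans (hadj d e hd hde).reachable
        · intro d f e hd hf he hdf
          rw [hD] at hd he
          exact (h0.adj_or_adj (h0.inTriangle_of_reachable (htri v) hd) (hadj d f hd hdf)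
            (hd.symm.trans he)).imp (fun h => h.1) (fun h => h.1)
  -- summing up
  have hWc : W.card ≤ 10 * (K + 1) ^ 3 := by
    have e1 := Finset.card_union_le M ((M ×ˢ M).biUnion U)
    have e2 := Finset.card_biUnion_le_card_mul (M ×ˢ M) U (2 * K) fun p _ => hUc p
    rw [Finset.card_product] at e2
    have e3 : M.card * M.card * (2 * K) ≤ (2 * K) * (2 * K) * (2 * K) := by gcongr
    have e4 : W.card ≤ 2 * K + (2 * K) * (2 * K) * (2 * K) := by
      change (M ∪ (M ×ˢ M).biUnion U).card ≤ _
      omega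
    refine e4.trans ?_
    ring_nf
    nlinarith
  have hSc : S.card ≤ 70 * (K + 1) ^ 5 := by
    refine (card_triangleFree_le hirr W hW S fun v hv => Finset.mem_filter.1 hv).trans ?_
    calc W.card * (1 + (2 * k + 1) + (2 * k + 1) ^ 2)
        ≤ (10 * (K + 1) ^ 3) * (1 * (K + 1) ^ 2 + 2 * (K + 1) ^ 2 + (2 * (K + 1)) ^ 2) := by
          gcongr
          · nlinarith [Nat.zero_le K]
          · nlinarith [Nat.zero_le K]
          · omega
      _ = _ := by ring
  have hXc : ∀ p ∈ M ×ˢ M, (X p).card ≤ 2048 * (K + 1) ^ 4 := by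
    intro p hp
    have e1 := card_le_of_homogeneous (G := G) (k := k) (X p) (M ∪ U p) (by
        intro x hx h
        exact hirr x p.1 (Finset.mem_filter.1 hx).2.1.symm (Or.inl h)) (by
        intro q hq x hx x' _ _ _ hxq
        exact absurd ((Finset.mem_filter.1 hx).2.2 q hxq) hq)
    have e2 := Finset.card_union_le M (U p)
    have e3 := hUc p
    refine e1.trans ?_
    calc (2 * k + 4) * (2 * (M ∪ U p).card + 1) ^ 3
        ≤ (4 * (K + 1)) * (8 * (K + 1)) ^ 3 := by
          gcongr
          · omega
          · omega
      _ = _ := by ring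
  have hCc : ∀ m ∈ M, (C m).card ≤ 1024 * (K + 1) ^ 5 := by
    intro m _
    by_cases hm : InTriangle (outside G M m) m
    · refine (card_component_le hirr M hM m hm (C m) fun w => by simp [C, hm]).trans ?_
      calc (M.card + 2 * k + 3) * ((2 * k + 4) * (2 * M.card + 1) ^ 3)
          ≤ (4 * (K + 1)) * ((4 * (K + 1)) * (4 * (K + 1)) ^ 3) := by
            gcongr
            · omega
            · omega
            · omega
        _ = _ := by ring
    · simp [C, hm]
  have e1 := (Finset.card_le_card hsub).trans (Finset.card_union_le _ _)
  have e2 := Finset.card_union_le (W ∪ S) ((M ×ˢ M).biUnion X)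
  have e3 := Finset.card_union_le W S
  have e4 := Finset.card_biUnion_le_card_mul _ X _ hXc
  have e5 := Finset.card_biUnion_le_card_mul _ C _ hCc
  rw [Finset.card_product] at e4
  have f1 : M.card * M.card * (2048 * (K + 1) ^ 4) ≤ 8192 * (K + 1) ^ 6 := by
    calc _ ≤ (2 * (K + 1)) * (2 * (K + 1)) * (2048 * (K + 1) ^ 4) := by gcongr <;> omega
      _ = _ := by ring
  have f2 : M.card * (1024 * (K + 1) ^ 5) ≤ 2048 * (K + 1) ^ 6 := by
    calc _ ≤ (2 * (K + 1)) * (1024 * (K + 1) ^ 5) := by gcongr; omega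
      _ = _ := by ring
  -- The four contributions add up to 10 + 70 + 8192 + 2048 = 10320 ≤ 10400 times (K + 1)^6.
  have f3 : (K + 1) ^ 3 ≤ (K + 1) ^ 6 := Nat.pow_le_pow_right (by omega) (by norm_num)
  have f4 : (K + 1) ^ 5 ≤ (K + 1) ^ 6 := Nat.pow_le_pow_right (by omega) (by norm_num)
  omega

end Bound

end PawEditing
namespace PawEditing

/-! ### Forced deletions and sequences of reductions -/

section Reduction

variable {V : Type*}

/-- The vertices `a, b, t` form a triangle, to which `s` is attached at `t` (provided that
`a` and `b` are adjacent). -/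
def Pendant (G : SimpleGraph V) (a b t s : V) : Prop :=
  G.Adj a t ∧ G.Adj b t ∧ G.Adj t s ∧ ¬ G.Adj s a ∧ ¬ G.Adj s b

/-- The pairs in `P` are disjoint and complete `a, b` to paws. -/
def IsPetalSet (G : SimpleGraph V) (a b : V) (P : Finset (V × V)) : Prop :=
  (∀ p ∈ P, Pendant G a b p.1 p.2) ∧ ∀ p ∈ P, ∀ q ∈ P, p ≠ q →
    p.1 ≠ q.1 ∧ p.1 ≠ q.2 ∧ p.2 ≠ q.1 ∧ p.2 ≠ q.2

/-- `G'` arises from `G` by deleting edges that have to be deleted. -/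
structure IsForcedDeletion (G G' : SimpleGraph V) (k : ℕ) : Prop where
  le : ∀ a b, G'.Adj a b → G.Adj a b
  forced : ∀ a b, G.Adj a b → ¬ G'.Adj a b → ∃ P, IsPetalSet G a b P ∧ k < P.card
  cover : ∀ a b, G'.Adj a b → ∃ U : Finset V, U.card ≤ 2 * k ∧
    ∀ t s, Pendant G a b t s → t ∈ U ∨ s ∈ U

variable [Fintype V]

/-- If ab survives, each petal (t, s) has an edit among ta, tb, sa, sb, st. As the petals are
disjoint and avoid `a` and `b`, these edits are distinct, and there are more than k of them. -/
theorem IsPetalSet.not_adj {G H : SimpleGraph V} {a b : V} {P : Finset (V × V)} {k : ℕ}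
    (hP : IsPetalSet G a b P) (hk : k < P.card) (hab : G.Adj a b) (hH : LocallyPawFree H)
    (hd : (diff G H).card ≤ 2 * k) : ¬ H.Adj a b := by
  classical
  intro hHab
  rw [card_diff_eq, Set.ncard_eq_toFinset_card'] at hd
  have hex : ∀ p : V × V, ∃ q : V × V, p ∈ P → (q.1 = p.1 ∨ q.1 = p.2) ∧
      (q.2 = a ∨ q.2 = b ∨ q.2 = p.1) ∧ ¬ (G.Adj q.1 q.2 ↔ H.Adj q.1 q.2) := by
    rintro ⟨t, s⟩
    by_cases hp : (t, s) ∈ P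
    · obtain ⟨h1, h2, h3, h4, h5⟩ := hP.1 _ hp
      by_contra hc
      push Not at hc
      have c1 := (hc (t, a)).2 (Or.inl rfl) (Or.inl rfl)
      have c2 := (hc (t, b)).2 (Or.inl rfl) (Or.inr (Or.inl rfl))
      have c3 := (hc (s, a)).2 (Or.inr rfl) (Or.inl rfl)
      have c4 := (hc (s, b)).2 (Or.inr rfl) (Or.inr (Or.inl rfl))
      have c5 := (hc (s, t)).2 (Or.inr rfl) (Or.inr (Or.inr rfl))
      dsimp only at *
      have := hH a b t s hHab (c2.1 h2.symm).symm (c1.1 h1.symm).symm (c5.1 h3.symm).symm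
      tauto
    · exact ⟨(t, s), fun h => absurd h hp⟩
  choose f hf using hex
  have hne : ∀ p ∈ P, p.1 ≠ a ∧ p.1 ≠ b ∧ p.2 ≠ a ∧ p.2 ≠ b := by
    intro p hp
    obtain ⟨h1, h2, h3, h4, h5⟩ := hP.1 p hp
    refine ⟨h1.ne.symm, h2.ne.symm, ?_, ?_⟩
    · intro h; rw [h] at h5; exact h5 hab
    · intro h; rw [h] at h4; exact h4 hab.symm
  have : P.card ≤ (symmDiff G.edgeSet H.edgeSet).toFinset.card := by
    refine Finset.card_le_card_of_injOn (fun p => s((f p).1, (f p).2)) ?_ ?_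
    · intro p hp
      have := (hf p hp).2.2
      simp only [Set.coe_toFinset, Set.mem_symmDiff, SimpleGraph.mem_edgeSet]
      tauto
    · intro p hp q hq hpq
      by_contra hne'
      obtain ⟨d1, d2, d3, d4⟩ := hP.2 p hp q hq hne'
      obtain ⟨n1, n2, n3, n4⟩ := hne p hp
      obtain ⟨f1, f2, -⟩ := hf p hp
      obtain ⟨g1, g2, -⟩ := hf q hq
      rw [Sym2.eq_iff] at hpq
      rcases hpq with ⟨e, -⟩ | ⟨e, -⟩ <;> rw [e] at f1
      · rcases f1 with f1 | f1 <;> rcases g1 with g1 | g1 <;> rw [f1] at g1 <;> tauto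
      · rcases f1 with f1 | f1 <;> rcases g2 with g2 | g2 | g2 <;> rw [f1] at g2 <;> tauto
  omega

/-- Every solution within the budget lacks the forced edges, so its edits split into the forced
deletions and the edits of `G'`. -/
theorem IsForcedDeletion.editable_iff {G G' : SimpleGraph V} {k r : ℕ}
    (h : IsForcedDeletion G G' k) (hr : (diff G G').card = 2 * r) :
    Editable G k ↔ r ≤ k ∧ Editable G' (k - r) := by
  classical
  constructor
  · rintro ⟨H, hH, hk⟩
    have hnot : ∀ a b, G.Adj a b → ¬ G'.Adj a b → ¬ H.Adj a b := by
      intro a b hab hab'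
      obtain ⟨P, hP, hPk⟩ := h.forced a b hab hab'
      exact hP.not_adj hPk hab hH hk
    have hsub : diff G G' ∪ diff G' H ⊆ diff G H := by
      rintro ⟨a, b⟩
      have := hnot a b
      have := h.le a b
      simp only [Finset.mem_union, mem_diff]
      tauto
    have hdis : Disjoint (diff G G') (diff G' H) := by
      rw [Finset.disjoint_left]
      rintro ⟨a, b⟩
      have := hnot a b
      have := h.le a b
      simp only [mem_diff]
      tauto
    have := Finset.card_le_card hsub
    rw [Finset.card_union_of_disjoint hdis] at this
    exact ⟨by omega, H, hH, by omega⟩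
  · rintro ⟨hrk, H, hH, hk⟩
    refine ⟨H, hH, ?_⟩
    have hsub : diff G H ⊆ diff G G' ∪ diff G' H := by
      rintro ⟨a, b⟩
      simp only [Finset.mem_union, mem_diff]
      tauto
    have := (Finset.card_le_card hsub).trans (Finset.card_union_le _ _)
    omega

variable [LinearOrder V]

/-- `G'` arises from `G` by reductions. -/
inductive Reduces (k : ℕ) (G : SimpleGraph V) : SimpleGraph V → Prop
  | refl : Reduces k G G
  | step {G' : SimpleGraph V} {v : V} : Reduces k G G' → Deletable G' k v →
      Reduces k G (isolate G' v)

theorem Reduces.editable_iff {k : ℕ} {G G' : SimpleGraph V} (h : Reduces k G G') :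
    Editable G' k ↔ Editable G k := by
  induction h with
  | refl => rfl
  | step _ hd ih => rw [hd.editable_iff, ih]

theorem Reduces.exists_set {k : ℕ} {G G' : SimpleGraph V} (h : Reduces k G G') :
    ∃ S : Set V, ∀ a b, G'.Adj a b ↔ G.Adj a b ∧ a ∈ S ∧ b ∈ S := by
  induction h with
  | refl => exact ⟨Set.univ, by simp⟩
  | @step G' v _ _ ih =>
    obtain ⟨S, hS⟩ := ih
    refine ⟨S \ {v}, fun a b => ?_⟩
    rw [isolate_adj, hS]
    simp only [Set.mem_sdiff, Set.mem_singleton_iff]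
    tauto

/-- An irreducible graph that is obtained from a yes-instance is small. -/
theorem Reduces.card_support_le {G G₁ G₂ : SimpleGraph V} {K k : ℕ} (hK : Editable G K)
    (h₁ : IsForcedDeletion G G₁ K) (hk : k ≤ K) (h₂ : Reduces k G₁ G₂) (hirr : Irreducible G₂ k) :
    (support G₂).card ≤ 10400 * (K + 1) ^ 6 := by
  classical
  obtain ⟨H, hH, hd⟩ := hK
  obtain ⟨S, hS⟩ := h₂.exists_set
  -- Forced edges are missing in `H`, so both their ends are touched.
  have hrem : ∀ a b, G.Adj a b → ¬ Touched G H a → G₁.Adj a b := by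
    intro a b hab ha
    by_contra h
    obtain ⟨P, hP, hPk⟩ := h₁.forced a b hab h
    exact hP.not_adj hPk hab hH hd ((adj_iff_of_not_touched ha b).2 hab)
  have hiff : ∀ a b, ¬ Touched G H a → (G₁.Adj a b ↔ H.Adj a b) := by
    intro a b ha
    rw [adj_iff_of_not_touched ha]
    exact ⟨h₁.le a b, fun h => hrem a b h ha⟩
  let M := (Finset.univ : Finset V).filter (Touched G H)
  have hM : ∀ x, x ∉ M ↔ ¬ Touched G H x := fun x => by simp [M]
  refine PawEditing.card_support_le hk hirr M ((card_touched_le G H).trans hd) ?_ ?_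
  -- Two different vertices of this graph are never both in `M`; so one is untouched, and `G`, `G₁`
  -- and `H` agree on the pair. Thus all edges are those of an induced subgraph of `H`.
  · intro m
    refine hH.mono_set (S := {x | x ∈ S ∧ (x ∉ M ∨ x = m)}) fun a b => ?_
    simp only [outside_adj, hS, Set.mem_ofPred_eq]
    by_cases hab : a = b
    · subst hab; simp
    by_cases ha : Touched G H a
    · by_cases hb : Touched G H b
      · have ha' : ¬ a ∉ M := by rw [hM]; tauto
        have hb' : ¬ b ∉ M := by rw [hM]; tauto
        constructor
        · rintro ⟨-, h1 | h1, h2 | h2⟩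
          · tauto
          · tauto
          · tauto
          · exact absurd (h1.trans h2.symm) hab
        · rintro ⟨-, ⟨-, h1 | h1⟩, -, h2 | h2⟩
          · tauto
          · tauto
          · tauto
          · exact absurd (h1.trans h2.symm) hab
      · rw [G₁.adj_comm, hiff b a hb, H.adj_comm]; tauto
    · rw [hiff a b ha]; tauto
  · intro m _ m' _ hmm
    rw [hS] at hmm
    obtain ⟨U, hU, hcov⟩ := h₁.cover m m' hmm.1
    refine ⟨U, hU, fun t s ht hs hmt hmt' hts hsm hsm' => hcov t s ?_⟩
    rw [hS] at hmt hmt' hts hsm hsm'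
    rw [hM] at ht hs
    -- The cover refers to paws of `G`. The missing adjacencies were not lost to forced deletions,
    -- because `s` is untouched.
    refine ⟨h₁.le _ _ hmt.1, h₁.le _ _ hmt'.1, h₁.le _ _ hts.1, fun h => hsm ?_, fun h => hsm' ?_⟩
    · exact ⟨hrem _ _ h hs, hts.2.2, hmm.2.1⟩
    · exact ⟨hrem _ _ h hs, hts.2.2, hmm.2.2⟩

end Reduction

end PawEditing
namespace PawEditing

/-! ### A programming language with bounded loops -/

section Machine

/-- The memory without the scratch cells of the compiler. -/
structure State where
  reg : Fin 10 → ℕ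
  arr : Fin 9 → ℕ → ℕ → ℕ

/-- Terms with bounded sums; `var i` is the variable bound at depth `i`. -/
inductive Term : Type
  | const (c : ℕ) : Term
  | glob (x : Fin 10) : Term
  | var (i : ℕ) : Term
  | cell (a : Fin 9) (i j : Term) : Term
  | add (s t : Term) : Term
  | sub (s t : Term) : Term
  | lt (s t : Term) : Term
  | eq (s t : Term) : Term
  | ite (t u v : Term) : Term
  | sum (t : Term) : Term

/-- The value of a term at depth `l`; the range of the sums is `n`. -/
def Term.eval (n : ℕ) (s : State) : Term → ℕ → (ℕ → ℕ) → ℕ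
  | const c, _, _ => c
  | glob x, _, _ => s.reg x
  | var i, l, e => if i < l then e i else 0
  | cell a i j, l, e => s.arr a (i.eval n s l e) (j.eval n s l e)
  | add t u, l, e => t.eval n s l e + u.eval n s l e
  | sub t u, l, e => t.eval n s l e - u.eval n s l e
  | lt t u, l, e => if t.eval n s l e < u.eval n s l e then 1 else 0
  | eq t u, l, e => if t.eval n s l e = u.eval n s l e then 1 else 0
  | ite t u v, l, e => if t.eval n s l e ≠ 0 then u.eval n s l e else v.eval n s l e
  | sum t, l, e => ∑ i ∈ Finset.range n, t.eval n s (l + 1) (Function.update e l i)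

/-- Commands; `forEach` binds the variable of the current depth. -/
inductive Cmd : Type
  | skip : Cmd
  | assign (x : Fin 10) (t : Term) : Cmd
  | store (a : Fin 9) (i j t : Term) : Cmd
  | seq (c d : Cmd) : Cmd
  | ite (t : Term) (c d : Cmd) : Cmd
  | forEach (c : Cmd) : Cmd

/-- The states that a loop runs through. -/
def iterate (f : ℕ → State → State) (s : State) : ℕ → State
  | 0 => s
  | n + 1 => f n (iterate f s n)

/-- The effect of a command. -/
def Cmd.exec (n : ℕ) : Cmd → ℕ → (ℕ → ℕ) → State → State
  | skip, _, _, s => s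
  | assign x t, l, e, s => ⟨Function.update s.reg x (t.eval n s l e), s.arr⟩
  | store a i j t, l, e, s => ⟨s.reg, fun b r c =>
      if b = a ∧ r = i.eval n s l e ∧ c = j.eval n s l e then t.eval n s l e else s.arr b r c⟩
  | seq c d, l, e, s => d.exec n l e (c.exec n l e s)
  | ite t c d, l, e, s => if t.eval n s l e ≠ 0 then c.exec n l e s else d.exec n l e s
  | forEach c, l, e, s => iterate (fun i s => c.exec n (l + 1) (Function.update e l i) s) s n

/-- The scratch cell `d`. -/
def scratch (d : ℕ) : Expr := Expr.cell 9 (Expr.const d) (Expr.const 0)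

/-- Write the value of `e` to the scratch cell `d`. -/
def setScratch (d : ℕ) (e : Expr) : Prog := Prog.store 9 (Expr.const d) (Expr.const 0) e

/-- A program that writes the value of a term to the scratch cell `d`. -/
def Term.compile : Term → ℕ → ℕ → Prog
  | const c, _, d => setScratch d (Expr.const c)
  | glob x, _, d => setScratch d (Expr.reg x)
  | var i, l, d => setScratch d (if i < l then Expr.reg (11 + i) else Expr.const 0)
  | cell a i j, l, d => (i.compile l d).seq ((j.compile l (d + 1)).seq
      (setScratch d (Expr.cell a (scratch d) (scratch (d + 1)))))
  | add t u, l, d => (t.compile l d).seq ((u.compile l (d + 1)).seq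
      (setScratch d (Expr.add (scratch d) (scratch (d + 1)))))
  | sub t u, l, d => (t.compile l d).seq ((u.compile l (d + 1)).seq
      (setScratch d (Expr.sub (scratch d) (scratch (d + 1)))))
  | lt t u, l, d => (t.compile l d).seq ((u.compile l (d + 1)).seq
      (setScratch d (Expr.lt (scratch d) (scratch (d + 1)))))
  | eq t u, l, d => (t.compile l d).seq ((u.compile l (d + 1)).seq
      (setScratch d (Expr.eq (scratch d) (scratch (d + 1)))))
  | ite t u v, l, d => (t.compile l d).seq
      (Prog.ite (scratch d) (u.compile l d) (v.compile l d))
  | sum t, l, d => (setScratch d (Expr.const 0)).seq ((setScratch (d + 1) (Expr.const 0)).seq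
      (Prog.loop (Expr.lt (scratch (d + 1)) (Expr.reg 10))
        ((Prog.assign (11 + l) (scratch (d + 1))).seq ((t.compile (l + 1) (d + 2)).seq
          ((setScratch d (Expr.add (scratch d) (scratch (d + 2)))).seq
            (setScratch (d + 1) (Expr.add (scratch (d + 1)) (Expr.const 1))))))))

/-- The program of a command, which leaves the scratch cells below `d` unchanged. -/
def Cmd.compile : Cmd → ℕ → ℕ → Prog
  | skip, _, _ => Prog.skip
  | assign x t, l, d => (t.compile l d).seq (Prog.assign x (scratch d))
  | store a i j t, l, d => (i.compile l d).seq ((j.compile l (d + 1)).seq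
      ((t.compile l (d + 2)).seq
        (Prog.store a (scratch d) (scratch (d + 1)) (scratch (d + 2)))))
  | seq c c', l, d => (c.compile l d).seq (c'.compile l d)
  | ite t c c', l, d => (t.compile l d).seq
      (Prog.ite (scratch d) (c.compile l d) (c'.compile l d))
  | forEach c, l, d => (setScratch d (Expr.const 0)).seq
      (Prog.loop (Expr.lt (scratch d) (Expr.reg 10))
        ((Prog.assign (11 + l) (scratch d)).seq ((c.compile (l + 1) (d + 1)).seq
            (setScratch d (Expr.add (scratch d) (Expr.const 1))))))

/-- The memory `m` represents the state `s`, the range `n` and the variables `e`. -/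
structure Represents (n : ℕ) (s : State) (l : ℕ) (e : ℕ → ℕ) (m : Memory) : Prop where
  range : m.reg 10 = n
  reg : ∀ x : Fin 10, m.reg x = s.reg x
  arr : ∀ a : Fin 9, m.arr a = s.arr a
  var : ∀ i, i < l → m.reg (11 + i) = e i

/-- A `State` has registers 0 to 9 and arrays 0 to 8; array 9 serves as evaluation stack, register
10 as loop bound, and registers from 11 on as loop variables. -/
theorem Represents.setCell {n : ℕ} {s : State} {l : ℕ} {e : ℕ → ℕ} {m : Memory}
    (h : Represents n s l e m) (i j v : ℕ) : Represents n s l e (m.setCell 9 i j v) where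
  range := h.range
  reg := h.reg
  arr a := by
    rw [← h.arr]
    funext r c
    have := a.isLt
    simp [Memory.setCell, show (a : ℕ) ≠ 9 by omega]
  var := h.var

theorem Represents.setVar {n : ℕ} {s : State} {l : ℕ} {e : ℕ → ℕ} {m : Memory}
    (h : Represents n s l e m) (v : ℕ) :
    Represents n s (l + 1) (Function.update e l v) (m.setReg (11 + l) v) where
  range := by simp [Memory.setReg, h.range, show 10 ≠ 11 + l by omega]
  reg x := by
    have := x.isLt
    simp [Memory.setReg, h.reg, show (x : ℕ) ≠ 11 + l by omega]
  arr := h.arr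
  var i hi := by
    by_cases hil : i = l
    · subst hil; simp [Memory.setReg]
    · simp [Memory.setReg, hil, h.var i (by omega)]

/-- The variable of depth `l` is not visible at depth `l`, so what a loop leaves in its register is
harmless. -/
theorem Represents.weaken {n : ℕ} {s : State} {l : ℕ} {e : ℕ → ℕ} {v : ℕ} {m : Memory}
    (h : Represents n s (l + 1) (Function.update e l v) m) : Represents n s l e m where
  range := h.range
  reg := h.reg
  arr := h.arr
  var i hi := by rw [h.var i (by omega), Function.update_of_ne (by omega)]

theorem setCell_scratch (m : Memory) (i v j : ℕ) :
    (m.setCell 9 i 0 v).arr 9 j 0 = if j = i then v else m.arr 9 j 0 := by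
  simp [Memory.setCell]

theorem runs_setScratch (d : ℕ) (e : Expr) (m : Memory) :
    Runs (setScratch d e) m 1 (m.setCell 9 d 0 (e.eval m)) :=
  Runs.store 9 _ _ e m

/-- A loop that is controlled by the scratch cell `c`. -/
theorem runs_loop {B : Prog} {c n q : ℕ} (I : ℕ → Memory → Prop)
    (h1 : ∀ i m, I i m → m.arr 9 c 0 = i ∧ m.reg 10 = n)
    (h2 : ∀ i m, i < n → I i m → ∃ t m', Runs B m t m' ∧ t ≤ q ∧ I (i + 1) m')
    {m : Memory} (hm : I 0 m) :
    ∃ t m', Runs (Prog.loop (Expr.lt (scratch c) (Expr.reg 10)) B) m t m' ∧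
      t ≤ n * (q + 1) + 1 ∧ I n m' := by
  suffices h : ∀ j i m, i + j = n → I i m →
      ∃ t m', Runs (Prog.loop (Expr.lt (scratch c) (Expr.reg 10)) B) m t m' ∧
        t ≤ j * (q + 1) + 1 ∧ I n m' from h n 0 m (by omega) hm
  intro j
  induction j with
  | zero =>
    intro i m hi hI
    obtain ⟨e1, e2⟩ := h1 i m hI
    obtain rfl : i = n := by omega
    exact ⟨1, m, Runs.loopFalse (by simp [Expr.eval, scratch, e1, e2]), by omega, hI⟩
  | succ j ih =>
    intro i m hi hI
    obtain ⟨e1, e2⟩ := h1 i m hI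
    obtain ⟨t, m', r1, ht, hI'⟩ := h2 i m (by omega) hI
    obtain ⟨u, m'', r2, hu, hI''⟩ := ih (i + 1) m' (by omega) hI'
    refine ⟨t + u + 1, m'', Runs.loopTrue ?_ r1 r2, ?_, hI''⟩
    · simp [Expr.eval, scratch, e1, e2, show i < n by omega]
    · rw [add_mul, one_mul]; omega

/-- The program `P` writes the value of `t` to the scratch cell `d`, in polynomial time. -/
def Term.Correct (t : Term) : Prop :=
  ∀ l d, ∃ p : Polynomial ℕ, ∀ n s e m, Represents n s l e m →
    ∃ τ m', Runs (t.compile l d) m τ m' ∧ τ ≤ p.eval n ∧ Represents n s l e m' ∧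
      m'.arr 9 d 0 = t.eval n s l e ∧ ∀ j, j < d → m'.arr 9 j 0 = m.arr 9 j 0

theorem Term.correct_binary {t u v : Term} (ht : t.Correct) (hu : u.Correct) (E : ℕ → Expr)
    (hc : ∀ l d, v.compile l d = (t.compile l d).seq ((u.compile l (d + 1)).seq
      (setScratch d (E d))))
    (hE : ∀ n s l e d m, Represents n s l e m → m.arr 9 d 0 = t.eval n s l e →
      m.arr 9 (d + 1) 0 = u.eval n s l e → (E d).eval m = v.eval n s l e) : v.Correct := by
  intro l d
  obtain ⟨p, hp⟩ := ht l d
  obtain ⟨q, hq⟩ := hu l (d + 1)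
  refine ⟨p + q + 1, fun n s e m hm => ?_⟩
  obtain ⟨τ₁, m₁, r₁, b₁, R₁, v₁, k₁⟩ := hp n s e m hm
  obtain ⟨τ₂, m₂, r₂, b₂, R₂, v₂, k₂⟩ := hq n s e m₁ R₁
  have hv := hE n s l e d m₂ R₂ (by rw [k₂ d (by omega), v₁]) v₂
  rw [hc]
  refine ⟨_, _, Runs.seq r₁ (Runs.seq r₂ (runs_setScratch d _ m₂)), ?_, R₂.setCell _ _ _, ?_, ?_⟩
  · simp only [Polynomial.eval_add, Polynomial.eval_one]; omega
  · rw [setCell_scratch, if_pos rfl, hv]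
  · intro j hj
    rw [setCell_scratch, if_neg (by omega), k₂ j (by omega), k₁ j hj]

theorem Term.correct_nullary {v : Term} (E : ℕ → Expr)
    (hc : ∀ l d, v.compile l d = setScratch d (E l))
    (hE : ∀ n s l e m, Represents n s l e m → (E l).eval m = v.eval n s l e) : v.Correct := by
  intro l d
  refine ⟨1, fun n s e m hm => ?_⟩
  rw [hc]
  refine ⟨_, _, runs_setScratch d _ m, by simp, hm.setCell _ _ _, ?_, ?_⟩
  · rw [setCell_scratch, if_pos rfl, hE n s l e m hm]
  · intro j hj
    rw [setCell_scratch, if_neg (by omega)]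

/-- The time bound depends on `n` alone and not on the contents of the memory, so a sum just
multiplies the bound of its body by `n`. -/
theorem Term.correct (t : Term) : t.Correct := by
  induction t with
  | const c =>
    exact Term.correct_nullary (fun _ => Expr.const c) (fun _ _ => rfl)
      (by simp [Expr.eval, Term.eval])
  | glob x =>
    refine Term.correct_nullary (fun _ => Expr.reg x) (fun _ _ => rfl) ?_
    intro n s l e m hm
    simp [Expr.eval, Term.eval, hm.reg]
  | var i =>
    refine Term.correct_nullary (fun l => if i < l then Expr.reg (11 + i) else Expr.const 0)
      (fun _ _ => rfl) ?_
    intro n s l e m hm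
    by_cases h : i < l
    · simp [Expr.eval, Term.eval, h, hm.var i h]
    · simp [Expr.eval, Term.eval, h]
  | cell a i j hi hj =>
    refine Term.correct_binary hi hj (fun d => Expr.cell a (scratch d) (scratch (d + 1)))
      (fun _ _ => rfl) ?_
    intro n s l e d m hm h1 h2
    simp [Expr.eval, Term.eval, scratch, h1, h2, hm.arr]
  | add t u ht hu =>
    refine Term.correct_binary ht hu (fun d => Expr.add (scratch d) (scratch (d + 1)))
      (fun _ _ => rfl) ?_
    intro n s l e d m hm h1 h2
    simp [Expr.eval, Term.eval, scratch, h1, h2]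
  | sub t u ht hu =>
    refine Term.correct_binary ht hu (fun d => Expr.sub (scratch d) (scratch (d + 1)))
      (fun _ _ => rfl) ?_
    intro n s l e d m hm h1 h2
    simp [Expr.eval, Term.eval, scratch, h1, h2]
  | lt t u ht hu =>
    refine Term.correct_binary ht hu (fun d => Expr.lt (scratch d) (scratch (d + 1)))
      (fun _ _ => rfl) ?_
    intro n s l e d m hm h1 h2
    simp [Expr.eval, Term.eval, scratch, h1, h2]
  | eq t u ht hu =>
    refine Term.correct_binary ht hu (fun d => Expr.eq (scratch d) (scratch (d + 1)))
      (fun _ _ => rfl) ?_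
    intro n s l e d m hm h1 h2
    simp [Expr.eval, Term.eval, scratch, h1, h2]
  | ite t u v ht hu hv =>
    intro l d
    obtain ⟨p, hp⟩ := ht l d
    obtain ⟨q, hq⟩ := hu l d
    obtain ⟨q', hq'⟩ := hv l d
    refine ⟨p + q + q' + 1, fun n s e m hm => ?_⟩
    obtain ⟨τ, m₁, r₁, b₁, R₁, v₁, k₁⟩ := hp n s e m hm
    have ev : (scratch d).eval m₁ = t.eval n s l e := v₁
    by_cases h : t.eval n s l e ≠ 0
    · obtain ⟨τ₂, m₂, r₂, b₂, R₂, v₂, k₂⟩ := hq n _ e m₁ R₁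
      refine ⟨_, _, Runs.seq r₁ (Runs.iteTrue (by rwa [ev]) r₂), ?_, R₂, ?_,
        fun j hj => (k₂ j hj).trans (k₁ j hj)⟩
      · simp only [Polynomial.eval_add, Polynomial.eval_one]; omega
      · simp only [Term.eval, if_pos h, v₂]
    · obtain ⟨τ₂, m₂, r₂, b₂, R₂, v₂, k₂⟩ := hq' n _ e m₁ R₁
      refine ⟨_, _, Runs.seq r₁ (Runs.iteFalse (by rw [ev]; tauto) r₂), ?_, R₂, ?_,
        fun j hj => (k₂ j hj).trans (k₁ j hj)⟩
      · simp only [Polynomial.eval_add, Polynomial.eval_one]; omega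
      · simp only [Term.eval, if_neg h, v₂]
  | sum t ht =>
    intro l d
    obtain ⟨p, hp⟩ := ht (l + 1) (d + 2)
    -- An iteration takes at most p + 3 steps and its test; two initializations and the failing test
    -- add 3.
    refine ⟨Polynomial.X * (p + 4) + 3, fun n s e m hm => ?_⟩
    let m₀ := (m.setCell 9 d 0 0).setCell 9 (d + 1) 0 0
    obtain ⟨τ, m', r, b, R, v, c, k⟩ := runs_loop (n := n) (q := p.eval n + 3) (c := d + 1)
      (B := (Prog.assign (11 + l) (scratch (d + 1))).seq ((t.compile (l + 1) (d + 2)).seq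
          ((setScratch d (Expr.add (scratch d) (scratch (d + 2)))).seq
            (setScratch (d + 1) (Expr.add (scratch (d + 1)) (Expr.const 1))))))
      (fun i m' => Represents n s l e m' ∧
        m'.arr 9 d 0 = ∑ i ∈ Finset.range i, t.eval n s (l + 1) (Function.update e l i) ∧
        m'.arr 9 (d + 1) 0 = i ∧ ∀ j, j < d → m'.arr 9 j 0 = m.arr 9 j 0)
      (fun i m' h => ⟨h.2.2.1, h.1.range⟩)
      (by
        rintro i m₁ hi ⟨R₁, v₁, c₁, k₁⟩
        have ra := Runs.assign (11 + l) (scratch (d + 1)) m₁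
        have ev : (scratch (d + 1)).eval m₁ = i := c₁
        rw [ev] at ra
        obtain ⟨τ₂, m₂, r₂, b₂, R₂, v₂, k₂⟩ := hp n s _ _ (R₁.setVar i)
        refine ⟨_, _, Runs.seq ra (Runs.seq r₂ (Runs.seq (runs_setScratch _ _ _)
          (runs_setScratch _ _ _))), by omega, (R₂.weaken.setCell _ _ _).setCell _ _ _, ?_, ?_, ?_⟩
        · rw [setCell_scratch, if_neg (by omega), setCell_scratch, if_pos rfl,
            Finset.sum_range_succ, ← v₁, ← v₂]
          change m₂.arr 9 d 0 + m₂.arr 9 (d + 2) 0 = _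
          rw [k₂ d (by omega)]
          rfl
        · rw [setCell_scratch, if_pos rfl]
          change (m₂.setCell 9 d 0 _).arr 9 (d + 1) 0 + 1 = _
          rw [setCell_scratch, if_neg (by omega), k₂ (d + 1) (by omega)]
          exact congrArg (· + 1) c₁
        · intro j hj
          rw [setCell_scratch, if_neg (by omega), setCell_scratch, if_neg (by omega),
            k₂ j (by omega)]
          exact k₁ j hj)
      (m := m₀) (by
        refine ⟨(hm.setCell _ _ _).setCell _ _ _, ?_, ?_, ?_⟩
        · simp [m₀, setCell_scratch]
        · simp only [m₀, setCell_scratch, if_pos]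
        · intro j hj
          simp only [m₀, setCell_scratch]
          rw [if_neg (by omega), if_neg (by omega)])
    refine ⟨_, m', Runs.seq (runs_setScratch d _ m) (Runs.seq (runs_setScratch (d + 1) _ _) r),
      ?_, R, v, k⟩
    simp only [Polynomial.eval_add, Polynomial.eval_mul, Polynomial.eval_X,
      Polynomial.eval_ofNat]
    have : n * (p.eval n + 3 + 1) = n * (p.eval n + 4) := by ring
    omega

/-- This settles the running time once and for all: the nesting depth is fixed by the text, and each
level contributes a factor `n`. -/
theorem Cmd.correct (c : Cmd) : ∀ l d, ∃ p : Polynomial ℕ, ∀ n s e m, Represents n s l e m →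
    ∃ τ m', Runs (c.compile l d) m τ m' ∧ τ ≤ p.eval n ∧ Represents n (c.exec n l e s) l e m' ∧
      ∀ j, j < d → m'.arr 9 j 0 = m.arr 9 j 0 := by
  induction c with
  | skip => exact fun l d => ⟨1, fun n s e m hm => ⟨1, m, Runs.skip m, by simp, hm, fun _ _ => rfl⟩⟩
  | assign x t =>
    intro l d
    obtain ⟨p, hp⟩ := t.correct l d
    refine ⟨p + 1, fun n s e m hm => ?_⟩
    obtain ⟨τ, m₁, r₁, b₁, R₁, v₁, k₁⟩ := hp n s e m hm
    have ra := Runs.assign x (scratch d) m₁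
    have ev : (scratch d).eval m₁ = t.eval n s l e := v₁
    rw [ev] at ra
    refine ⟨_, _, Runs.seq r₁ ra, by simp [b₁], ⟨?_, ?_, R₁.arr, ?_⟩, k₁⟩
    · have := x.isLt
      simp [Memory.setReg, R₁.range, show 10 ≠ (x : ℕ) by omega]
    · intro y
      by_cases hyx : y = x
      · subst hyx; simp [Memory.setReg, Cmd.exec]
      · simp [Memory.setReg, Cmd.exec, hyx, R₁.reg, Fin.val_inj]
    · intro i hi
      have := x.isLt
      simp [Memory.setReg, R₁.var i hi, show 11 + i ≠ (x : ℕ) by omega]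
  | store a i j t =>
    intro l d
    obtain ⟨p₁, hp₁⟩ := i.correct l d
    obtain ⟨p₂, hp₂⟩ := j.correct l (d + 1)
    obtain ⟨p₃, hp₃⟩ := t.correct l (d + 2)
    refine ⟨p₁ + p₂ + p₃ + 1, fun n s e m hm => ?_⟩
    obtain ⟨τ₁, m₁, r₁, b₁, R₁, v₁, k₁⟩ := hp₁ n s e m hm
    obtain ⟨τ₂, m₂, r₂, b₂, R₂, v₂, k₂⟩ := hp₂ n s e m₁ R₁
    obtain ⟨τ₃, m₃, r₃, b₃, R₃, v₃, k₃⟩ := hp₃ n s e m₂ R₂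
    have rs := Runs.store a (scratch d) (scratch (d + 1)) (scratch (d + 2)) m₃
    have e1 : (scratch d).eval m₃ = i.eval n s l e := by
      change m₃.arr 9 d 0 = _
      rw [k₃ d (by omega), k₂ d (by omega), v₁]
    have e2 : (scratch (d + 1)).eval m₃ = j.eval n s l e := by
      change m₃.arr 9 (d + 1) 0 = _
      rw [k₃ (d + 1) (by omega), v₂]
    have e3 : (scratch (d + 2)).eval m₃ = t.eval n s l e := v₃
    rw [e1, e2, e3] at rs
    have ha := a.isLt
    refine ⟨_, _, Runs.seq r₁ (Runs.seq r₂ (Runs.seq r₃ rs)), ?_,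
      ⟨R₃.range, R₃.reg, ?_, R₃.var⟩, ?_⟩
    · simp only [Polynomial.eval_add, Polynomial.eval_one]; omega
    · intro b
      funext r c
      simp [Memory.setCell, Cmd.exec, R₃.arr, Fin.val_inj]
    · intro q hq
      rw [← k₁ q hq, ← k₂ q (by omega), ← k₃ q (by omega)]
      simp [Memory.setCell, show 9 ≠ (a : ℕ) by omega]
  | seq c c' hc hc' =>
    intro l d
    obtain ⟨p, hp⟩ := hc l d
    obtain ⟨q, hq⟩ := hc' l d
    refine ⟨p + q, fun n s e m hm => ?_⟩
    obtain ⟨τ₁, m₁, r₁, b₁, R₁, k₁⟩ := hp n s e m hm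
    obtain ⟨τ₂, m₂, r₂, b₂, R₂, k₂⟩ := hq n _ e m₁ R₁
    refine ⟨_, _, Runs.seq r₁ r₂, ?_, R₂, fun j hj => (k₂ j hj).trans (k₁ j hj)⟩
    simp only [Polynomial.eval_add]; omega
  | ite t c c' hc hc' =>
    intro l d
    obtain ⟨p, hp⟩ := t.correct l d
    obtain ⟨q, hq⟩ := hc l d
    obtain ⟨q', hq'⟩ := hc' l d
    refine ⟨p + q + q' + 1, fun n s e m hm => ?_⟩
    obtain ⟨τ, m₁, r₁, b₁, R₁, v₁, k₁⟩ := hp n s e m hm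
    have ev : (scratch d).eval m₁ = t.eval n s l e := v₁
    by_cases h : t.eval n s l e ≠ 0
    · obtain ⟨τ₂, m₂, r₂, b₂, R₂, k₂⟩ := hq n _ e m₁ R₁
      refine ⟨_, _, Runs.seq r₁ (Runs.iteTrue (by rwa [ev]) r₂), ?_, ?_,
        fun j hj => (k₂ j hj).trans (k₁ j hj)⟩
      · simp only [Polynomial.eval_add, Polynomial.eval_one]; omega
      · simpa [Cmd.exec, h] using R₂
    · obtain ⟨τ₂, m₂, r₂, b₂, R₂, k₂⟩ := hq' n _ e m₁ R₁
      refine ⟨_, _, Runs.seq r₁ (Runs.iteFalse (by rw [ev]; tauto) r₂), ?_, ?_,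
        fun j hj => (k₂ j hj).trans (k₁ j hj)⟩
      · simp only [Polynomial.eval_add, Polynomial.eval_one]; omega
      · simp only [Cmd.exec, if_neg h]; exact R₂
  | forEach c hc =>
    intro l d
    obtain ⟨p, hp⟩ := hc (l + 1) (d + 1)
    refine ⟨Polynomial.X * (p + 3) + 2, fun n s e m hm => ?_⟩
    obtain ⟨τ, m', r, b, R, c', k⟩ := runs_loop (n := n) (q := p.eval n + 2) (c := d)
      (B := (Prog.assign (11 + l) (scratch d)).seq ((c.compile (l + 1) (d + 1)).seq
            (setScratch d (Expr.add (scratch d) (Expr.const 1)))))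
      (fun i m' => Represents n
          (iterate (fun i s => c.exec n (l + 1) (Function.update e l i) s) s i) l e m' ∧
        m'.arr 9 d 0 = i ∧ ∀ j, j < d → m'.arr 9 j 0 = m.arr 9 j 0)
      (fun i m' h => ⟨h.2.1, h.1.range⟩)
      (by
        rintro i m₁ hi ⟨R₁, c₁, k₁⟩
        have ra := Runs.assign (11 + l) (scratch d) m₁
        have ev : (scratch d).eval m₁ = i := c₁
        rw [ev] at ra
        obtain ⟨τ₂, m₂, r₂, b₂, R₂, k₂⟩ := hp n _ _ _ (R₁.setVar i)
        refine ⟨_, _, Runs.seq ra (Runs.seq r₂ (runs_setScratch _ _ _)), by omega,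
          R₂.weaken.setCell _ _ _, ?_, ?_⟩
        · rw [setCell_scratch, if_pos rfl]
          change m₂.arr 9 d 0 + 1 = _
          rw [k₂ d (by omega)]
          exact congrArg (· + 1) c₁
        · intro j hj
          rw [setCell_scratch, if_neg (by omega), k₂ j (by omega)]
          exact k₁ j hj)
      (m := m.setCell 9 d 0 0) (by
        refine ⟨hm.setCell _ _ _, ?_, ?_⟩
        · rw [setCell_scratch, if_pos rfl]
        · intro j hj
          rw [setCell_scratch, if_neg (by omega)])
    refine ⟨_, m', Runs.seq (runs_setScratch d _ m) r, ?_, R, k⟩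
    simp only [Polynomial.eval_add, Polynomial.eval_mul, Polynomial.eval_X,
      Polynomial.eval_ofNat]
    have : n * (p.eval n + 2 + 1) = n * (p.eval n + 3) := by ring
    omega

/-- Loop invariants. -/
theorem iterate_induction {f : ℕ → State → State} {s : State} {n : ℕ} (I : ℕ → State → Prop)
    (h0 : I 0 s) (hs : ∀ i, i < n → ∀ s, I i s → I (i + 1) (f i s)) : I n (iterate f s n) := by
  suffices h : ∀ j, j ≤ n → I j (iterate f s j) from h n le_rfl
  intro j
  induction j with
  | zero => exact fun _ => h0
  | succ j ih => exact fun hj => hs j (by omega) _ (ih (by omega))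

end Machine

end PawEditing
namespace PawEditing

/-! ### Conditions of the reduction rules as terms -/

section Conditions

namespace Term

/-- The value of the term is not `0`. -/
def Holds (n : ℕ) (s : State) (t : Term) (l : ℕ) (e : ℕ → ℕ) : Prop := t.eval n s l e ≠ 0

/-- Negation. -/
def neg (t : Term) : Term := eq t (const 0)

/-- Conjunction. -/
def conj (t u : Term) : Term := ite t u (const 0)

/-- Disjunction. -/
def disj (t u : Term) : Term := add t u

/-- Implication. -/
def impl (t u : Term) : Term := disj (neg t) u

/-- Equivalence. -/
def equiv (t u : Term) : Term := eq (neg t) (neg u)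

/-- Existential quantification. -/
def ex (t : Term) : Term := sum t

/-- Universal quantification. -/
def all (t : Term) : Term := neg (sum (neg t))

/-- The number of values of a variable for which `t` holds. -/
def count (t : Term) : Term := sum (neg (neg t))

/-- The entry of array `a` at two variables. -/
def adj (a : Fin 9) (i j : ℕ) : Term := cell a (var i) (var j)

variable {n : ℕ} {s : State} {l : ℕ} {e : ℕ → ℕ} {t u : Term}

theorem eval_neg : (neg t).eval n s l e = if t.eval n s l e = 0 then 1 else 0 := rfl

@[simp] theorem holds_neg : (neg t).Holds n s l e ↔ ¬ t.Holds n s l e := by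
  simp [Holds, eval_neg]

@[simp] theorem holds_conj : (conj t u).Holds n s l e ↔ t.Holds n s l e ∧ u.Holds n s l e := by
  simp [Holds, conj, eval]

@[simp] theorem holds_disj : (disj t u).Holds n s l e ↔ t.Holds n s l e ∨ u.Holds n s l e := by
  simp only [Holds, disj, eval]
  omega

@[simp] theorem holds_impl : (impl t u).Holds n s l e ↔ (t.Holds n s l e → u.Holds n s l e) := by
  rw [impl, holds_disj, holds_neg, imp_iff_not_or]

@[simp] theorem holds_equiv : (equiv t u).Holds n s l e ↔ (t.Holds n s l e ↔ u.Holds n s l e) := by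
  simp only [Holds, equiv, eval, eval_neg]
  by_cases h1 : t.eval n s l e = 0 <;> by_cases h2 : u.eval n s l e = 0 <;> simp [h1, h2]

@[simp] theorem holds_ex :
    (ex t).Holds n s l e ↔ ∃ i : Fin n, t.Holds n s (l + 1) (Function.update e l i) := by
  simp only [Holds, ex, eval, Finset.sum_range]
  simp [Finset.sum_eq_zero_iff]

@[simp] theorem holds_all :
    (all t).Holds n s l e ↔ ∀ i : Fin n, t.Holds n s (l + 1) (Function.update e l i) := by
  change (neg (ex (neg t))).Holds n s l e ↔ _
  simp

open Classical in
@[simp] theorem eval_count : (count t).eval n s l e =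
    (Finset.univ.filter fun i : Fin n => t.Holds n s (l + 1) (Function.update e l i)).card := by
  rw [Finset.card_filter]
  simp only [count, eval, Finset.sum_range, eval_neg, Holds]
  refine Finset.sum_congr rfl fun i _ => ?_
  by_cases h : t.eval n s (l + 1) (Function.update e l i) = 0 <;> simp [h]

@[simp] theorem holds_lt : (lt t u).Holds n s l e ↔ t.eval n s l e < u.eval n s l e := by
  simp [Holds, eval]

@[simp] theorem holds_eq : (eq t u).Holds n s l e ↔ t.eval n s l e = u.eval n s l e := by
  simp [Holds, eval]

@[simp] theorem holds_adj {a : Fin 9} {i j : ℕ} : (adj a i j).Holds n s l e ↔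
    s.arr a (if i < l then e i else 0) (if j < l then e j else 0) ≠ 0 := Iff.rfl

@[simp] theorem eval_var {i : ℕ} : (var i).eval n s l e = if i < l then e i else 0 := rfl

@[simp] theorem eval_glob {x : Fin 10} : (glob x).eval n s l e = s.reg x := rfl

@[simp] theorem eval_const {c : ℕ} : (const c).eval n s l e = c := rfl

@[simp] theorem eval_add : (add t u).eval n s l e = t.eval n s l e + u.eval n s l e := rfl

@[simp] theorem eval_sub : (sub t u).eval n s l e = t.eval n s l e - u.eval n s l e := rfl

end Term

open Term

/-- Array `a` is the adjacency matrix of `G`. -/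
def HasMatrix {n : ℕ} (s : State) (a : Fin 9) (G : SimpleGraph (Fin n)) : Prop :=
  ∀ i j : Fin n, s.arr a i j ≤ 1 ∧ (s.arr a i j ≠ 0 ↔ G.Adj i j)

theorem HasMatrix.eq_zero_iff {n : ℕ} {s : State} {a : Fin 9} {G : SimpleGraph (Fin n)}
    (h : HasMatrix s a G) (i j : Fin n) : s.arr a i j = 0 ↔ ¬ G.Adj i j := by
  rw [← (h i j).2, not_not]

variable {n : ℕ} {s : State} {G : SimpleGraph (Fin n)} {e : ℕ → ℕ} {v : Fin n}

/-- The condition of `PatternRule` for the variable `1`. -/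
def patternTerm : Term :=
  all (all (all (impl (conj (neg (eq (var 2) (var 1)))
    (conj (neg (eq (var 3) (var 1))) (neg (eq (var 4) (var 1)))))
    (lt (add (glob 5) (glob 5)) (count (conj (neg (eq (var 5) (var 1)))
      (conj (neg (eq (var 5) (var 2))) (conj (neg (eq (var 5) (var 3)))
        (conj (neg (eq (var 5) (var 4))) (conj (equiv (adj 1 5 2) (adj 1 1 2))
          (conj (equiv (adj 1 5 3) (adj 1 1 3)) (equiv (adj 1 5 4) (adj 1 1 4)))))))))))))

theorem holds_patternTerm (h : HasMatrix s 1 G) (hv : e 1 = v) :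
    patternTerm.Holds n s 2 e ↔ PatternRule G (s.reg 5) v := by
  classical
  simp only [patternTerm, holds_all, holds_impl, holds_conj, holds_neg, holds_eq, holds_lt,
    eval_count, holds_equiv, holds_adj, eval_var, eval_add, eval_glob, Function.update_apply]
  simp only [Nat.reduceLT, Nat.reduceAdd, Nat.reduceEqDiff, if_true, if_false, hv,
    Fin.val_inj, ne_eq, h.eq_zero_iff, not_not, PatternRule, two_mul, and_imp]

/-- The condition of `MateRule` for the variable `1`. -/
def mateTerm : Term :=
  lt (add (add (glob 5) (glob 5)) (const 2)) (count (conj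
    (conj (adj 1 1 2) (conj
      (all (impl (adj 1 3 1) (impl (neg (adj 1 3 2)) (all (equiv (adj 1 3 4) (adj 1 2 4))))))
      (all (impl (adj 1 3 2) (impl (neg (adj 1 3 1)) (all (equiv (adj 1 3 4) (adj 1 1 4))))))))
    (all (impl (lt (var 3) (var 2)) (neg (all (equiv (adj 1 3 4) (adj 1 2 4))))))))

theorem holds_mateTerm (h : HasMatrix s 1 G) (hv : e 1 = v) :
    mateTerm.Holds n s 2 e ↔ MateRule G (s.reg 5) v := by
  classical
  simp only [mateTerm, holds_all, holds_impl, holds_conj, holds_neg, holds_lt, eval_const,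
    eval_count, holds_equiv, holds_adj, eval_var, eval_add, eval_glob, Function.update_apply]
  simp only [Nat.reduceLT, Nat.reduceAdd, Nat.reduceEqDiff, if_true, if_false, hv,
    Fin.val_fin_lt, ne_eq, h.eq_zero_iff, not_not, MateRule, two_mul]
  -- The two filters differ only in their decidability instances.
  have key : ∀ (p q : Fin n → Prop) (dp : DecidablePred p) (dq : DecidablePred q),
      (∀ u, p u ↔ q u) → (Finset.univ.filter p).card = (Finset.univ.filter q).card :=
    fun p q _ _ hpq => congrArg Finset.card (Finset.filter_congr fun u _ => hpq u)
  exact iff_of_eq (congrArg _ (key _ _ _ _ fun u => Iff.rfl))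

/-- The variable `x` lies in a triangle; `l` is the depth of the term. -/
def triangleTerm (l x : ℕ) : Term :=
  ex (ex (conj (adj 1 x l) (conj (adj 1 x (l + 1)) (adj 1 l (l + 1)))))

theorem holds_triangleTerm (h : HasMatrix s 1 G) {l x : ℕ} (hx : x < l) {w : Fin n}
    (hw : e x = w) : (triangleTerm l x).Holds n s l e ↔ InTriangle G w := by
  simp only [triangleTerm, holds_ex, holds_conj, holds_adj, Function.update_apply]
  simp [hx.ne, show x < l + 1 + 1 by omega,
    show l < l + 1 + 1 by omega, show ¬ x = l + 1 by omega, hw, h.eq_zero_iff, InTriangle]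

/-- The number of `triangleFreeNeighbors` of the variable `x`. -/
def neighborsTerm (l x : ℕ) : Term :=
  count (conj (neg (eq (var l) (var 1))) (conj (adj 1 l x) (neg (triangleTerm (l + 1) l))))

theorem eval_neighborsTerm (h : HasMatrix s 1 G) (hv : e 1 = v) {l x : ℕ} (hl : 1 < l)
    (hx : x < l) {w : Fin n} (hw : e x = w) :
    (neighborsTerm l x).eval n s l e = (triangleFreeNeighbors G v w).card := by
  classical
  have key : ∀ i : Fin n,
      (triangleTerm (l + 1) l).Holds n s (l + 1) (Function.update e l i) ↔ InTriangle G i :=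
    fun i => holds_triangleTerm h (by omega) (by simp)
  simp only [neighborsTerm, eval_count, holds_conj, holds_neg, holds_eq, holds_adj, eval_var, key,
    Function.update_apply, triangleFreeNeighbors]
  simp [hx.ne, show x < l + 1 by omega, show 1 < l + 1 by omega, show ¬ 1 = l by omega, hv, hw,
    h.eq_zero_iff, Fin.val_inj]

/-- The condition of `TriangleFreeRule` for the variable `1`. -/
def triangleFreeTerm : Term :=
  conj (neg (triangleTerm 2 1)) (all (impl (adj 1 1 2)
    (disj (lt (add (glob 5) (glob 5)) (neighborsTerm 3 2)) (conj (neg (triangleTerm 3 2))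
      (all (impl (adj 1 2 3) (impl (triangleTerm 4 3)
        (lt (add (glob 5) (glob 5)) (neighborsTerm 4 3)))))))))

theorem holds_triangleFreeTerm (h : HasMatrix s 1 G) (hv : e 1 = v) :
    triangleFreeTerm.Holds n s 2 e ↔ TriangleFreeRule G (s.reg 5) v := by
  have k1 : (triangleTerm 2 1).Holds n s 2 e ↔ InTriangle G v :=
    holds_triangleTerm h (by omega) hv
  have k2 : ∀ i : Fin n,
      (triangleTerm 3 2).Holds n s (2 + 1) (Function.update e 2 i) ↔ InTriangle G i :=
    fun i => holds_triangleTerm h (by omega) (by simp)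
  have k3 : ∀ i : Fin n, (neighborsTerm 3 2).eval n s (2 + 1) (Function.update e 2 i) =
      (triangleFreeNeighbors G v i).card :=
    fun i => eval_neighborsTerm h (by simp [hv]) (by omega) (by omega) (by simp)
  have k4 : ∀ i j : Fin n, (triangleTerm 4 3).Holds n s (2 + 1 + 1)
      (Function.update (Function.update e 2 i) (2 + 1) j) ↔ InTriangle G j :=
    fun i j => holds_triangleTerm h (by omega) (by simp)
  have k5 : ∀ i j : Fin n, (neighborsTerm 4 3).eval n s (2 + 1 + 1)
      (Function.update (Function.update e 2 i) (2 + 1) j) = (triangleFreeNeighbors G v j).card :=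
    fun i j => eval_neighborsTerm h (by simp [hv]) (by omega) (by omega) (by simp)
  simp only [triangleFreeTerm, holds_all, holds_impl, holds_conj, holds_neg, holds_lt, holds_disj,
    holds_adj, eval_add, eval_glob, k1, k2, k3, k4, k5, Function.update_apply]
  simp only [Nat.reduceLT, Nat.reduceAdd, Nat.reduceEqDiff, if_true, if_false, hv,
    ne_eq, h.eq_zero_iff, not_not, TriangleFreeRule, two_mul]

/-- The condition of `ComponentRule` for the variable `1`. -/
def componentTerm : Term :=
  ex (conj (adj 1 1 2) (conj
    (all (all (impl (disj (adj 1 3 1) (adj 1 3 2)) (impl (adj 1 3 4)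
      (disj (adj 1 4 1) (adj 1 4 2))))))
    (all (all (all (impl (disj (adj 1 3 1) (adj 1 3 2)) (impl (disj (adj 1 4 1) (adj 1 4 2))
      (impl (disj (adj 1 5 1) (adj 1 5 2)) (impl (adj 1 3 4)
        (disj (adj 1 5 3) (adj 1 5 4)))))))))))

theorem holds_componentTerm (h : HasMatrix s 1 G) (hv : e 1 = v) :
    componentTerm.Holds n s 2 e ↔ ComponentRule G v := by
  simp only [componentTerm, holds_all, holds_impl, holds_conj, holds_disj, holds_ex, holds_adj,
    Function.update_apply]
  simp only [Nat.reduceLT, Nat.reduceAdd, Nat.reduceEqDiff, if_true, if_false, hv,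
    ne_eq, h.eq_zero_iff, not_not, ComponentRule]

/-- The variable `1` is not isolated, and one of the reduction rules applies to it. -/
def deletableTerm : Term :=
  conj (ex (adj 1 1 2))
    (disj patternTerm (disj mateTerm (disj triangleFreeTerm componentTerm)))

theorem holds_deletableTerm (h : HasMatrix s 1 G) (hv : e 1 = v) :
    deletableTerm.Holds n s 2 e ↔ (∃ u, G.Adj v u) ∧ Deletable G (s.reg 5) v := by
  have k : (ex (adj 1 1 2)).Holds n s 2 e ↔ ∃ u, G.Adj v u := by
    simp only [holds_ex, holds_adj, Function.update_apply]
    simp only [Nat.reduceLT, Nat.reduceAdd, Nat.reduceEqDiff, if_true, if_false, hv,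
      ne_eq, h.eq_zero_iff, not_not]
  simp only [deletableTerm, holds_conj, holds_disj, holds_patternTerm h hv, holds_mateTerm h hv,
    holds_triangleFreeTerm h hv, holds_componentTerm h hv, k, Deletable]

/-- The variable `x` is not isolated; `l` is the depth of the term. -/
def supportTerm (l x : ℕ) : Term := ex (adj 1 x l)

theorem holds_supportTerm (h : HasMatrix s 1 G) {l x : ℕ} (hx : x < l) {w : Fin n}
    (hw : e x = w) : (supportTerm l x).Holds n s l e ↔ w ∈ support G := by
  simp only [supportTerm, holds_ex, holds_adj, Function.update_apply, mem_support]
  simp [hx.ne, show x < l + 1 by omega, hw, h.eq_zero_iff]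

/-- The multiple `c • t`. -/
def multiple (t : Term) : ℕ → Term
  | 0 => const 0
  | c + 1 => add (multiple t c) t

theorem eval_multiple (t : Term) (c l : ℕ) :
    (multiple t c).eval n s l e = c * t.eval n s l e := by
  induction c with
  | zero => simp [multiple]
  | succ c ih => simp [multiple, ih, add_mul]

/-- The power `k ^ i` of the parameter. -/
def power : ℕ → ℕ → Term
  | _, 0 => const 1
  | l, i + 1 => sum (ite (lt (var l) (glob 1)) (power (l + 1) i) (const 0))

/-- Multiplication by the parameter is summation over the indices below it, which all lie in the
range only if the parameter is at most `n`. -/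
theorem eval_power (hk : s.reg 1 ≤ n) (i l : ℕ) (e : ℕ → ℕ) :
    (power l i).eval n s l e = s.reg 1 ^ i := by
  induction i generalizing l e with
  | zero => simp [power]
  | succ i ih =>
    have h : ∀ j, (ite (lt (var l) (glob 1)) (power (l + 1) i) (const 0)).eval n s (l + 1)
        (Function.update e l j) = if j < s.reg 1 then s.reg 1 ^ i else 0 := by
      intro j
      rw [Term.eval, ih]
      simp [Term.eval]
    simp only [power, Term.eval]
    simp only [Term.eval] at h
    simp only [h]
    rw [← Finset.sum_filter, Finset.sum_const, smul_eq_mul, pow_succ']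
    congr 1
    have : (Finset.range n).filter (fun j => j < s.reg 1) = Finset.range (s.reg 1) := by
      ext j
      simp only [Finset.mem_filter, Finset.mem_range]
      omega
    rw [this, Finset.card_range]

/-- The state after the assignment of `v` to register `x`. -/
def State.assign (s : State) (x : Fin 10) (v : ℕ) : State where
  reg := Function.update s.reg x v
  arr := s.arr

/-- The state after the assignment of `v` to the entry `(i, j)` of array `a`. -/
def State.store (s : State) (a : Fin 9) (i j v : ℕ) : State where
  reg := s.reg
  arr b r c := if b = a ∧ r = i ∧ c = j then v else s.arr b r c

theorem Cmd.exec_assign (x : Fin 10) (t : Term) (l : ℕ) (e : ℕ → ℕ) :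
    (Cmd.assign x t).exec n l e s = s.assign x (t.eval n s l e) := rfl

theorem Cmd.exec_store (a : Fin 9) (i j t : Term) (l : ℕ) (e : ℕ → ℕ) :
    (Cmd.store a i j t).exec n l e s =
      s.store a (i.eval n s l e) (j.eval n s l e) (t.eval n s l e) := rfl

theorem Cmd.exec_seq (c d : Cmd) (l : ℕ) (e : ℕ → ℕ) :
    (Cmd.seq c d).exec n l e s = d.exec n l e (c.exec n l e s) := rfl

theorem Cmd.exec_skip (l : ℕ) (e : ℕ → ℕ) : Cmd.skip.exec n l e s = s := rfl

theorem Cmd.exec_ite_pos {t : Term} {l : ℕ} (h : t.Holds n s l e) (c d : Cmd) :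
    (Cmd.ite t c d).exec n l e s = c.exec n l e s := if_pos h

theorem Cmd.exec_ite_neg {t : Term} {l : ℕ} (h : ¬ t.Holds n s l e) (c d : Cmd) :
    (Cmd.ite t c d).exec n l e s = d.exec n l e s := if_neg h

end Conditions

end PawEditing
namespace PawEditing

/-! ### The kernelization program -/

section Program

open Term

variable {n : ℕ}

/-- The vertices `t` (variable `2`) and `s` (variable `3`) complete the variables `0` and `1` to
a paw. -/
def pendantTerm : Term :=
  conj (adj 0 0 2) (conj (adj 0 1 2) (conj (adj 0 2 3) (conj (neg (adj 0 3 0)) (neg (adj 0 3 1)))))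

theorem holds_pendantTerm {s : State} {G : SimpleGraph (Fin n)} {e : ℕ → ℕ} {a b t u : Fin n}
    (h : HasMatrix s 0 G) (ha : e 0 = a) (hb : e 1 = b) (ht : e 2 = t) (hu : e 3 = u) :
    pendantTerm.Holds n s 4 e ↔ Pendant G a b t u := by
  simp only [pendantTerm, holds_conj, holds_neg, holds_adj]
  simp only [Nat.reduceLT, if_true, ha, hb, ht, hu, ne_eq, h.eq_zero_iff, not_not, Pendant]

/-- One step of the greedy algorithm. -/
def petalStep : Cmd :=
  Cmd.ite (conj pendantTerm (conj (neg (cell 2 (var 2) (const 0))) (neg (cell 2 (var 3) (const 0)))))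
    (Cmd.seq (Cmd.store 2 (var 2) (const 0) (const 1)) (Cmd.seq
      (Cmd.store 2 (var 3) (const 0) (const 1)) (Cmd.assign 3 (add (glob 3) (const 1))))) Cmd.skip

/-- Find a maximal petal set for the variables `0` and `1`, and write its size to register `3`. -/
def petalCmd : Cmd :=
  Cmd.seq (Cmd.forEach (Cmd.store 2 (var 2) (const 0) (const 0)))
    (Cmd.seq (Cmd.assign 3 (const 0)) (Cmd.forEach (Cmd.forEach petalStep)))

/-- Array `2` holds the vertices of a petal set that meets the pairs in `Q`, and nothing else than
array `2` and register `3` has changed. -/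
structure PetalInv (s₀ : State) (G : SimpleGraph (Fin n)) (a b : Fin n)
    (Q : Fin n → Fin n → Prop) (s : State) : Prop where
  arr : ∀ i, i ≠ 2 → s.arr i = s₀.arr i
  reg : ∀ x, x ≠ 3 → s.reg x = s₀.reg x
  petals : ∃ P, IsPetalSet G a b P ∧ P.card = s.reg 3 ∧
    ∀ x : Fin n, s.arr 2 x 0 ≠ 0 ↔ ∃ p ∈ P, x = p.1 ∨ x = p.2
  covered : ∀ t u, Q t u → Pendant G a b t u → s.arr 2 t 0 ≠ 0 ∨ s.arr 2 u 0 ≠ 0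

/-- A pair is accepted only if both its vertices are unmarked, so petals remain disjoint; a pendant
pair that is turned down meets a marked vertex. -/
theorem PetalInv.step {s₀ s : State} {G : SimpleGraph (Fin n)} {a b : Fin n}
    {Q : Fin n → Fin n → Prop} (h0 : HasMatrix s₀ 0 G) (h : PetalInv s₀ G a b Q s) {e : ℕ → ℕ}
    {t u : Fin n} (ha : e 0 = a) (hb : e 1 = b) (ht : e 2 = t) (hu : e 3 = u) :
    PetalInv s₀ G a b (fun t' u' => Q t' u' ∨ (t' = t ∧ u' = u)) (petalStep.exec n 4 e s) := by
  classical
  have hG : HasMatrix s 0 G := fun i j => by rw [h.arr 0 (by decide)]; exact h0 i j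
  obtain ⟨P, hP, hPc, hPu⟩ := h.petals
  have hcond : (conj pendantTerm (conj (neg (cell 2 (var 2) (const 0)))
      (neg (cell 2 (var 3) (const 0))))).Holds n s 4 e ↔
      Pendant G a b t u ∧ s.arr 2 t 0 = 0 ∧ s.arr 2 u 0 = 0 := by
    rw [holds_conj, holds_pendantTerm hG ha hb ht hu, holds_conj, holds_neg, holds_neg]
    simp [Holds, Term.eval, ht, hu]
  by_cases hc : Pendant G a b t u ∧ s.arr 2 t 0 = 0 ∧ s.arr 2 u 0 = 0
  · have hex : petalStep.exec n 4 e s = ⟨Function.update s.reg 3 (s.reg 3 + 1), fun i r c =>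
        if i = 2 ∧ r = u ∧ c = 0 then 1 else if i = 2 ∧ r = t ∧ c = 0 then 1 else s.arr i r c⟩ := by
      rw [petalStep, Cmd.exec_ite_pos (hcond.2 hc)]
      simp [Cmd.exec_seq, Cmd.exec_store, Cmd.exec_assign, State.store, State.assign, ht, hu]
    have htP : ∀ p ∈ P, t ≠ p.1 ∧ t ≠ p.2 := by
      intro p hp
      have := (hPu t).not.1 (by simp [hc.2.1])
      push Not at this
      exact this p hp
    have huP : ∀ p ∈ P, u ≠ p.1 ∧ u ≠ p.2 := by
      intro p hp
      have := (hPu u).not.1 (by simp [hc.2.2])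
      push Not at this
      exact this p hp
    rw [hex]
    refine ⟨?_, ?_, ⟨insert (t, u) P, ⟨?_, ?_⟩, ?_, ?_⟩, ?_⟩
    · intro i hi
      funext r c
      simp [hi, h.arr i hi]
    · intro x hx
      simp [hx, h.reg x hx]
    · intro p hp
      rcases Finset.mem_insert.1 hp with rfl | hp
      · exact hc.1
      · exact hP.1 p hp
    · intro p hp q hq hpq
      rcases Finset.mem_insert.1 hp with rfl | hp <;> rcases Finset.mem_insert.1 hq with rfl | hq
      · exact absurd rfl hpq
      · exact ⟨(htP q hq).1, (htP q hq).2, (huP q hq).1, (huP q hq).2⟩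
      · exact ⟨(htP p hp).1.symm, (huP p hp).1.symm, (htP p hp).2.symm, (huP p hp).2.symm⟩
      · exact hP.2 p hp q hq hpq
    · rw [Finset.card_insert_of_notMem, hPc]
      · simp
      · exact fun h => (htP _ h).1 rfl
    · intro x
      have := hPu x
      by_cases hxu : x = u
      · subst hxu
        simp only [Finset.mem_insert, true_and, if_true]
        exact ⟨fun _ => ⟨(t, x), Or.inl rfl, Or.inr rfl⟩, fun _ => by simp⟩
      by_cases hxt : x = t
      · subst hxt
        simp only [Finset.mem_insert, true_and, and_true, if_true]
        exact ⟨fun _ => ⟨(x, u), Or.inl rfl, Or.inl rfl⟩, fun _ => by split_ifs <;> simp⟩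
      · simp only [Finset.exists_mem_insert, hxu, hxt, or_self, false_or, ← this]
        simp [Fin.val_inj, hxu, hxt]
    · rintro t' u' (hQ | ⟨rfl, rfl⟩) hp
      · rcases h.covered t' u' hQ hp with h' | h'
        · left; dsimp only; split_ifs <;> first | exact one_ne_zero | exact h'
        · right; dsimp only; split_ifs <;> first | exact one_ne_zero | exact h'
      · right; simp
  · have hex : petalStep.exec n 4 e s = s := by
      rw [petalStep, Cmd.exec_ite_neg (fun h => hc (hcond.1 h)), Cmd.exec_skip]
    rw [hex]
    refine ⟨h.arr, h.reg, h.petals, ?_⟩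
    rintro t' u' (hQ | ⟨rfl, rfl⟩) hp
    · exact h.covered t' u' hQ hp
    · simp only [hp, true_and, not_and_or] at hc
      exact hc

theorem PetalInv.congr {s₀ s : State} {G : SimpleGraph (Fin n)} {a b : Fin n}
    {Q Q' : Fin n → Fin n → Prop} (h : PetalInv s₀ G a b Q s) (hQ : ∀ t u, Q' t u → Q t u) :
    PetalInv s₀ G a b Q' s :=
  ⟨h.arr, h.reg, h.petals, fun t u htu => h.covered t u (hQ t u htu)⟩

theorem petalInv_exec {s₀ : State} {G : SimpleGraph (Fin n)} {a b : Fin n}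
    (h0 : HasMatrix s₀ 0 G) {e : ℕ → ℕ} (ha : e 0 = a) (hb : e 1 = b) :
    PetalInv s₀ G a b (fun _ _ => True) (petalCmd.exec n 2 e s₀) := by
  -- The array may still hold the marks of the previous call.
  set s₁ := (Cmd.forEach (Cmd.store 2 (var 2) (const 0) (const 0))).exec n 2 e s₀ with hs₁
  have h1 : (∀ i, i ≠ 2 → s₁.arr i = s₀.arr i) ∧ s₁.reg = s₀.reg ∧
      ∀ r, r < n → s₁.arr 2 r 0 = 0 := by
    refine iterate_induction (fun j s => (∀ i, i ≠ 2 → s.arr i = s₀.arr i) ∧ s.reg = s₀.reg ∧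
      ∀ r, r < j → s.arr 2 r 0 = 0) ⟨fun _ _ => rfl, rfl, fun r hr => absurd hr (by omega)⟩ ?_
    rintro i hi s ⟨h1, h2, h3⟩
    refine ⟨?_, ?_, ?_⟩
    · intro j hj
      funext r c
      simp [Cmd.exec, hj, h1 j hj]
    · exact h2
    · intro r hr
      simp only [Cmd.exec, Term.eval]
      by_cases hri : r = i
      · simp [hri]
      · simp [hri, h3 r (by omega)]
  set s₂ := (Cmd.assign 3 (const 0)).exec n 2 e s₁ with hs₂
  have h2 : PetalInv s₀ G a b (fun _ _ => False) s₂ := by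
    refine ⟨h1.1, ?_, ⟨∅, ⟨by simp, by simp⟩, ?_, ?_⟩, by simp⟩
    · intro x hx
      simp [hs₂, Cmd.exec, hx, h1.2.1]
    · simp [hs₂, Cmd.exec]
    · intro x
      simp [hs₂, Cmd.exec, h1.2.2 x x.isLt]
  have h3 := iterate_induction (n := n)
    (f := fun i s => (Cmd.forEach petalStep).exec n 3 (Function.update e 2 i) s) (s := s₂)
    (fun i s => PetalInv s₀ G a b (fun t _ => (t : ℕ) < i) s) (h2.congr (by simp)) (by
      intro i hi s hs
      have h4 := iterate_induction (n := n)
        (f := fun j s => petalStep.exec n 4 (Function.update (Function.update e 2 i) 3 j) s)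
        (s := s)
        (fun j s => PetalInv s₀ G a b (fun t u => (t : ℕ) < i ∨ (t : ℕ) = i ∧ (u : ℕ) < j) s)
        (hs.congr (by simp)) (by
          intro j hj s hs
          refine (hs.step h0 (t := ⟨i, hi⟩) (u := ⟨j, hj⟩)
            (e := Function.update (Function.update e 2 i) 3 j) ?_ ?_ ?_ ?_).congr ?_
          · simp [ha]
          · simp [hb]
          · simp
          · simp
          · intro t u
            simp only [Fin.ext_iff]
            omega)
      refine h4.congr fun t u h => ?_
      have := u.isLt
      omega)
  exact h3.congr fun t u _ => t.isLt

/-- The result of the greedy algorithm. -/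
theorem petalCmd_spec {s₀ : State} {G : SimpleGraph (Fin n)} {a b : Fin n}
    (h0 : HasMatrix s₀ 0 G) {e : ℕ → ℕ} (ha : e 0 = a) (hb : e 1 = b) :
    ∃ s c, petalCmd.exec n 2 e s₀ = s ∧ (∀ i, i ≠ 2 → s.arr i = s₀.arr i) ∧
      (∀ x, x ≠ 3 → s.reg x = s₀.reg x) ∧ s.reg 3 = c ∧
      (∃ P, IsPetalSet G a b P ∧ P.card = c) ∧
      ∃ U : Finset (Fin n), U.card ≤ 2 * c ∧ ∀ t u, Pendant G a b t u → t ∈ U ∨ u ∈ U := by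
  classical
  obtain ⟨h1, h2, ⟨P, hP, hPc, hPu⟩, h4⟩ := petalInv_exec h0 ha hb
  refine ⟨_, _, rfl, h1, h2, rfl, ⟨P, hP, hPc⟩, P.image Prod.fst ∪ P.image Prod.snd, ?_, ?_⟩
  · have := Finset.card_union_le (P.image Prod.fst) (P.image Prod.snd)
    have := Finset.card_image_le (s := P) (f := Prod.fst)
    have := Finset.card_image_le (s := P) (f := Prod.snd)
    omega
  · have hU : ∀ x, (∃ p ∈ P, x = p.1 ∨ x = p.2) → x ∈ P.image Prod.fst ∪ P.image Prod.snd := by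
      rintro x ⟨p, hp, rfl | rfl⟩
      · exact Finset.mem_union_left _ (Finset.mem_image_of_mem _ hp)
      · exact Finset.mem_union_right _ (Finset.mem_image_of_mem _ hp)
    intro t u htu
    rcases h4 t u trivial htu with h | h
    · exact Or.inl (hU t ((hPu t).1 h))
    · exact Or.inr (hU u ((hPu u).1 h))

/-- Treat the pair of the variables `0` and `1`. -/
def forcedStep : Cmd :=
  Cmd.ite (conj (lt (var 0) (var 1)) (adj 0 0 1))
    (Cmd.seq petalCmd (Cmd.ite (lt (glob 1) (glob 3)) (Cmd.assign 4 (add (glob 4) (const 1)))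
      (Cmd.seq (Cmd.store 1 (var 0) (var 1) (const 1)) (Cmd.store 1 (var 1) (var 0) (const 1)))))
    Cmd.skip

/-- Write the graph without the edges that have to be deleted to array `1`, and their number to
register `4`. -/
def forcedCmd : Cmd := Cmd.forEach (Cmd.forEach forcedStep)

open Classical in
/-- The invariant of `forcedCmd`, where `Q` holds for the pairs that have been treated. -/
structure ForcedInv (s₀ : State) (G : SimpleGraph (Fin n)) (k : ℕ)
    (Q : Fin n → Fin n → Prop) (s : State) : Prop where
  arr : s.arr 0 = s₀.arr 0
  reg : s.reg 0 = s₀.reg 0 ∧ s.reg 1 = k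
  result : ∃ G' : SimpleGraph (Fin n), HasMatrix s 1 G' ∧ (∀ a b, G'.Adj a b → G.Adj a b) ∧
    (∀ a b, a < b → G'.Adj a b → Q a b ∧ ∃ U : Finset (Fin n), U.card ≤ 2 * k ∧
      ∀ t u, Pendant G a b t u → t ∈ U ∨ u ∈ U) ∧
    (∀ a b, a < b → Q a b → G.Adj a b → ¬ G'.Adj a b → ∃ P, IsPetalSet G a b P ∧ k < P.card) ∧
    s.reg 4 = (Finset.univ.filter fun p : Fin n × Fin n => p.1 < p.2 ∧ Q p.1 p.2 ∧
      G.Adj p.1 p.2 ∧ ¬ G'.Adj p.1 p.2).card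

theorem ForcedInv.congr {s₀ s : State} {G : SimpleGraph (Fin n)} {k : ℕ}
    {Q Q' : Fin n → Fin n → Prop} (h : ForcedInv s₀ G k Q s) (hQ : ∀ t u, Q' t u ↔ Q t u) :
    ForcedInv s₀ G k Q' s := by
  have : Q' = Q := by funext t u; exact propext (hQ t u)
  rwa [this]

/-- `G` with the additional edge `ab`. -/
def addEdge {V : Type*} (G : SimpleGraph V) {a b : V} (hab : a ≠ b) : SimpleGraph V where
  Adj x y := G.Adj x y ∨ (x = a ∧ y = b) ∨ (x = b ∧ y = a)
  symm := ⟨fun x y h => by rw [G.adj_comm]; tauto⟩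
  loopless := ⟨fun x h => by
    rcases h with h | ⟨rfl, h⟩ | ⟨rfl, h⟩
    · exact h.ne rfl
    · exact hab h
    · exact hab h.symm⟩

/-- Petals are sought in the input graph in array `0`, so deletions do not influence each other.
Array `1` collects the edges that stay, and `hQ` ensures that no deletion is counted twice. -/
theorem ForcedInv.step {s₀ s : State} {G : SimpleGraph (Fin n)} {k : ℕ}
    {Q : Fin n → Fin n → Prop} (h0 : HasMatrix s₀ 0 G) (h : ForcedInv s₀ G k Q s) {e : ℕ → ℕ}
    {a b : Fin n} (hQ : ¬ Q a b) (ha : e 0 = a) (hb : e 1 = b) :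
    ForcedInv s₀ G k (fun x y => Q x y ∨ (x = a ∧ y = b)) (forcedStep.exec n 2 e s) := by
  classical
  have hG : HasMatrix s 0 G := fun i j => by rw [h.arr]; exact h0 i j
  obtain ⟨G', hG', hle, hcov, hfor, hcnt⟩ := h.result
  have hcond : (conj (lt (var 0) (var 1)) (adj 0 0 1)).Holds n s 2 e ↔ a < b ∧ G.Adj a b := by
    rw [holds_conj, holds_lt, holds_adj]
    simp [ha, hb, hG.eq_zero_iff]
  by_cases hc : a < b ∧ G.Adj a b
  · obtain ⟨s', c, hs', h1, h2, h3, ⟨P, hP, hPc⟩, U, hU, hcU⟩ := petalCmd_spec hG ha hb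
    have hex : forcedStep.exec n 2 e s = if k < c then
        ⟨Function.update s'.reg 4 (s'.reg 4 + 1), s'.arr⟩ else
        ⟨s'.reg, fun i x y => if i = 1 ∧ x = b ∧ y = a then 1 else
          if i = 1 ∧ x = a ∧ y = b then 1 else s'.arr i x y⟩ := by
      rw [forcedStep, Cmd.exec_ite_pos (hcond.2 hc), Cmd.exec_seq, hs']
      have hlt : (lt (glob 1) (glob 3)).Holds n s' 2 e ↔ k < c := by
        rw [holds_lt, eval_glob, eval_glob, h3, h2 1 (by decide), h.reg.2]
      by_cases hkc : k < c
      · rw [Cmd.exec_ite_pos (hlt.2 hkc), if_pos hkc]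
        rfl
      · rw [Cmd.exec_ite_neg (fun h => hkc (hlt.1 h)), if_neg hkc]
        simp [Cmd.exec_seq, Cmd.exec_store, State.store, ha, hb]
    rw [hex]
    by_cases hkc : k < c
    · rw [if_pos hkc]
      refine ⟨?_, ⟨?_, ?_⟩, G', ?_, hle, ?_, ?_, ?_⟩
      · exact (h1 0 (by decide)).trans h.arr
      · simpa [h2 0 (by decide)] using h.reg.1
      · simpa [h2 1 (by decide)] using h.reg.2
      · intro i j
        dsimp only
        rw [h1 1 (by decide)]
        exact hG' i j
      · exact fun x y hxy hxy' => ⟨Or.inl (hcov x y hxy hxy').1, (hcov x y hxy hxy').2⟩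
      · rintro x y hxy (hq | ⟨rfl, rfl⟩) h5 h6
        · exact hfor x y hxy hq h5 h6
        · exact ⟨P, hP, by omega⟩
      · have : (Finset.univ.filter fun p : Fin n × Fin n => p.1 < p.2 ∧
            (Q p.1 p.2 ∨ p.1 = a ∧ p.2 = b) ∧ G.Adj p.1 p.2 ∧ ¬ G'.Adj p.1 p.2) =
            insert (a, b) (Finset.univ.filter fun p : Fin n × Fin n => p.1 < p.2 ∧ Q p.1 p.2 ∧
              G.Adj p.1 p.2 ∧ ¬ G'.Adj p.1 p.2) := by
          ext ⟨x, y⟩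
          have hnab : ¬ G'.Adj a b := fun h => hQ (hcov a b hc.1 h).1
          simp only [Finset.mem_filter, Finset.mem_univ, true_and, Finset.mem_insert, Prod.mk.injEq]
          constructor
          · tauto
          · rintro (⟨rfl, rfl⟩ | h)
            · tauto
            · tauto
        have hcard := congrArg Finset.card this
        rw [Finset.card_insert_of_notMem (by simp [hQ]), ← hcnt] at hcard
        dsimp only
        rw [Function.update_self, h2 4 (by decide), ← hcard]
        congr!
    · rw [if_neg hkc]
      have hadd : ∀ x y, (addEdge G' hc.1.ne).Adj x y ↔
        G'.Adj x y ∨ (x = a ∧ y = b) ∨ (x = b ∧ y = a) := fun _ _ => Iff.rfl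
      refine ⟨?_, ⟨?_, ?_⟩, addEdge G' hc.1.ne, ?_, ?_, ?_, ?_, ?_⟩
      · funext x y
        simp [h1 0 (by decide), h.arr]
      · simpa [h2 0 (by decide)] using h.reg.1
      · simpa [h2 1 (by decide)] using h.reg.2
      · intro i j
        have := hG' i j
        rw [← h1 1 (by decide)] at this
        rw [hadd, ← this.2]
        simp only [true_and, Fin.val_inj]
        by_cases c1 : i = b ∧ j = a
        · simp [c1]
        by_cases c2 : i = a ∧ j = b
        · simp [c2]
        · simp [c1, c2, this.1]
      · rintro x y (h5 | ⟨rfl, rfl⟩ | ⟨rfl, rfl⟩)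
        · exact hle x y h5
        · exact hc.2
        · exact hc.2.symm
      · rintro x y hxy (h5 | ⟨rfl, rfl⟩ | ⟨rfl, rfl⟩)
        · exact ⟨Or.inl (hcov x y hxy h5).1, (hcov x y hxy h5).2⟩
        · exact ⟨Or.inr ⟨rfl, rfl⟩, U, by omega, hcU⟩
        · exact absurd hc.1 (not_lt.2 hxy.le)
      · rintro x y hxy (hq | ⟨rfl, rfl⟩) h5 h6
        · exact hfor x y hxy hq h5 fun h => h6 (Or.inl h)
        · exact absurd (Or.inr (Or.inl ⟨rfl, rfl⟩)) h6
      · dsimp only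
        rw [h2 4 (by decide), hcnt]
        congr 1
        ext ⟨x, y⟩
        simp only [Finset.mem_filter, Finset.mem_univ, true_and, hadd]
        constructor
        · rintro ⟨h5, h6, h7, h8⟩
          refine ⟨h5, Or.inl h6, h7, ?_⟩
          rintro (h9 | ⟨rfl, rfl⟩ | ⟨rfl, rfl⟩)
          · exact h8 h9
          · exact hQ h6
          · exact absurd hc.1 (not_lt.2 h5.le)
        · tauto
  · have hex : forcedStep.exec n 2 e s = s := by
      rw [forcedStep, Cmd.exec_ite_neg (fun h => hc (hcond.1 h)), Cmd.exec_skip]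
    rw [hex]
    refine ⟨h.arr, h.reg, G', hG', hle, ?_, ?_, ?_⟩
    · exact fun x y hxy hxy' => ⟨Or.inl (hcov x y hxy hxy').1, (hcov x y hxy hxy').2⟩
    · rintro x y hxy (hq | ⟨rfl, rfl⟩) h5 h6
      · exact hfor x y hxy hq h5 h6
      · exact absurd ⟨hxy, h5⟩ hc
    · rw [hcnt]
      congr 1
      ext ⟨x, y⟩
      simp only [Finset.mem_filter, Finset.mem_univ, true_and]
      constructor
      · tauto
      · rintro ⟨h5, h6 | ⟨rfl, rfl⟩, h7, h8⟩
        · tauto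
        · tauto

theorem card_diff_eq_two_mul {V : Type*} [Fintype V] [LinearOrder V] (G H : SimpleGraph V) :
    (diff G H).card = 2 * ((diff G H).filter fun p => p.1 < p.2).card := by
  have h1 : ((diff G H).filter fun p => ¬ p.1 < p.2).card =
      ((diff G H).filter fun p => p.1 < p.2).card := by
    refine Finset.card_bij (fun p _ => p.swap) ?_ ?_ ?_
    · rintro ⟨a, b⟩ hp
      simp only [Finset.mem_filter, mem_diff, not_lt, Prod.swap_prod_mk] at hp ⊢
      rw [G.adj_comm, H.adj_comm]
      refine ⟨hp.1, lt_of_le_of_ne hp.2 ?_⟩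
      rintro rfl
      simp at hp
    · intro p _ q _ h
      exact Prod.swap_injective h
    · rintro ⟨a, b⟩ hp
      refine ⟨(b, a), ?_, rfl⟩
      simp only [Finset.mem_filter, mem_diff, not_lt] at hp ⊢
      rw [G.adj_comm, H.adj_comm]
      exact ⟨hp.1, hp.2.le⟩
  have h2 := Finset.card_filter_add_card_filter_not (s := diff G H) (fun p => p.1 < p.2)
  omega

theorem forcedCmd_spec {s₀ : State} {G : SimpleGraph (Fin n)} {e : ℕ → ℕ}
    (h0 : HasMatrix s₀ 0 G) (h1 : s₀.arr 1 = fun _ _ => 0) (h4 : s₀.reg 4 = 0) :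
    ∃ s G', forcedCmd.exec n 0 e s₀ = s ∧ s.reg 1 = s₀.reg 1 ∧
      HasMatrix s 1 G' ∧ IsForcedDeletion G G' (s₀.reg 1) ∧ (diff G G').card = 2 * s.reg 4 := by
  classical
  have hI : ForcedInv s₀ G (s₀.reg 1) (fun _ _ => False) s₀ := by
    refine ⟨rfl, ⟨rfl, rfl⟩, ⊥, ?_, by simp, by simp, by simp, by simp [h4]⟩
    intro i j
    simp [h1]
  have h3 := iterate_induction (n := n)
    (f := fun i s => (Cmd.forEach forcedStep).exec n 1 (Function.update e 0 i) s) (s := s₀)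
    (fun i s => ForcedInv s₀ G (s₀.reg 1) (fun t _ => (t : ℕ) < i) s) (hI.congr (by simp)) (by
      intro i hi s hs
      have h4 := iterate_induction (n := n)
        (f := fun j s => forcedStep.exec n 2 (Function.update (Function.update e 0 i) 1 j) s)
        (s := s)
        (fun j s => ForcedInv s₀ G (s₀.reg 1)
          (fun t u => (t : ℕ) < i ∨ (t : ℕ) = i ∧ (u : ℕ) < j) s)
        (hs.congr (by simp)) (by
          intro j hj s hs
          refine (hs.step h0 (a := ⟨i, hi⟩) (b := ⟨j, hj⟩)
            (e := Function.update (Function.update e 0 i) 1 j) ?_ ?_ ?_).congr ?_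
          · simp
          · simp
          · simp
          · intro t u
            simp only [Fin.ext_iff]
            omega)
      refine h4.congr fun t u => ?_
      have := u.isLt
      omega)
  obtain ⟨-, ⟨-, e2⟩, G', e3, e4, e5, e6, e7⟩ := h3
  refine ⟨_, G', rfl, e2, e3, ⟨e4, ?_, ?_⟩, ?_⟩
  -- The loops treat only pairs with `a < b`; petals are symmetric in `a` and `b`.
  · intro a b hab hab'
    rcases lt_or_gt_of_ne hab.ne with h | h
    · exact e6 a b h a.isLt hab hab'
    · obtain ⟨P, hP, hPc⟩ := e6 b a h b.isLt hab.symm (fun h => hab' h.symm)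
      refine ⟨P, ⟨fun p hp => ?_, hP.2⟩, hPc⟩
      obtain ⟨f1, f2, f3, f4, f5⟩ := hP.1 p hp
      exact ⟨f2, f1, f3, f5, f4⟩
  · intro a b hab
    rcases lt_or_gt_of_ne hab.ne with h | h
    · exact (e5 a b h hab).2
    · obtain ⟨U, hU, hc⟩ := (e5 b a h hab.symm).2
      refine ⟨U, hU, fun t u htu => hc t u ?_⟩
      obtain ⟨f1, f2, f3, f4, f5⟩ := htu
      exact ⟨f2, f1, f3, f5, f4⟩
  · rw [card_diff_eq_two_mul]
    change _ = 2 * (State.reg (iterate _ s₀ n) 4)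
    rw [e7]
    congr 2
    ext ⟨a, b⟩
    have := e4 a b
    simp only [Finset.mem_filter, Finset.mem_univ, true_and, mem_diff, a.isLt]
    tauto

end Program

end PawEditing
namespace PawEditing

/-! ### The reductions -/

section Reduction

open Term

variable {n : ℕ}

/-- Delete the edges at the variable `1`. -/
def isolateCmd : Cmd :=
  Cmd.forEach (Cmd.seq (Cmd.store 1 (var 1) (var 2) (const 0))
    (Cmd.store 1 (var 2) (var 1) (const 0)))

theorem isolateCmd_spec {s : State} {G : SimpleGraph (Fin n)} {e : ℕ → ℕ} {v : Fin n}
    (h : HasMatrix s 1 G) (hv : e 1 = v) :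
    HasMatrix (isolateCmd.exec n 2 e s) 1 (isolate G v) ∧
      (isolateCmd.exec n 2 e s).reg = s.reg := by
  have key := iterate_induction (n := n) (s := s)
    (f := fun i s => (Cmd.seq (Cmd.store 1 (var 1) (var 2) (const 0))
      (Cmd.store 1 (var 2) (var 1) (const 0))).exec n 3 (Function.update e 2 i) s)
    (fun j s' => s'.reg = s.reg ∧ ∀ x y, s'.arr 1 x y =
      if (x = v ∧ y < j) ∨ (y = v ∧ x < j) then 0 else s.arr 1 x y) (by simp) (by
      rintro i hi s' ⟨h1, h2⟩
      refine ⟨h1, fun x y => ?_⟩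
      simp only [Cmd.exec_seq, Cmd.exec_store, State.store, eval_var, eval_const, h2]
      simp only [Nat.reduceLT, if_true, Function.update_self, hv, true_and,
        Function.update_of_ne (show (1 : ℕ) ≠ 2 by decide)]
      split_ifs <;> first | rfl | omega)
  refine ⟨fun i j => ?_, key.1⟩
  have e1 : (isolateCmd.exec n 2 e s).arr 1 i j = _ := key.2 i j
  rw [e1, isolate_adj, ← (h i j).2]
  have := i.isLt
  have := j.isLt
  have := (h i j).1
  simp only [Fin.val_inj, i.isLt, j.isLt, and_true]
  split_ifs with hc
  · simp only [zero_le, ne_eq, not_true, false_iff, true_and]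
    tauto
  · tauto

/-- Delete the edges at the variable `1` if a reduction rule applies. -/
def reduceStep : Cmd := Cmd.ite deletableTerm isolateCmd Cmd.skip

theorem reduceStep_spec {s : State} {G : SimpleGraph (Fin n)} {e : ℕ → ℕ} {v : Fin n}
    (h : HasMatrix s 1 G) (hv : e 1 = v) :
    (reduceStep.exec n 2 e s).reg = s.reg ∧
      (v ∈ support G ∧ Deletable G (s.reg 5) v ∧
          HasMatrix (reduceStep.exec n 2 e s) 1 (isolate G v) ∨
        (∀ u, G.Adj v u → ¬ Deletable G (s.reg 5) v) ∧ HasMatrix (reduceStep.exec n 2 e s) 1 G) := by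
  have hd := holds_deletableTerm h hv
  by_cases hc : (∃ u, G.Adj v u) ∧ Deletable G (s.reg 5) v
  · rw [reduceStep, Cmd.exec_ite_pos (hd.2 hc)]
    obtain ⟨h1, h2⟩ := isolateCmd_spec h hv
    exact ⟨h2, Or.inl ⟨mem_support.2 hc.1, hc.2, h1⟩⟩
  · rw [reduceStep, Cmd.exec_ite_neg (fun h => hc (hd.1 h)), Cmd.exec_skip]
    exact ⟨rfl, Or.inr ⟨fun u hu hd => hc ⟨⟨u, hu⟩, hd⟩, h⟩⟩

/-- Apply the reduction rules as long as possible. -/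
def reduceCmd : Cmd := Cmd.forEach (Cmd.forEach reduceStep)

theorem card_support_isolate_lt {G : SimpleGraph (Fin n)} {v : Fin n} (hv : v ∈ support G) :
    (support (isolate G v)).card < (support G).card := by
  refine Finset.card_lt_card ⟨fun x hx => ?_, fun h => ?_⟩
  · obtain ⟨u, hu⟩ := mem_support.1 hx
    exact mem_support.2 ⟨u, hu.1⟩
  · obtain ⟨u, hu⟩ := mem_support.1 (h hv)
    exact hu.2.1 rfl

/-- A round that deletes nothing has checked every vertex in the same graph, so that graph is
irreducible; any other round shrinks the support. Hence `n` rounds suffice. -/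
theorem reduceCmd_spec {s₀ : State} {G : SimpleGraph (Fin n)} {e : ℕ → ℕ}
    (h : HasMatrix s₀ 1 G) :
    (reduceCmd.exec n 0 e s₀).reg = s₀.reg ∧ ∃ G', HasMatrix (reduceCmd.exec n 0 e s₀) 1 G' ∧
      Reduces (s₀.reg 5) G G' ∧ Irreducible G' (s₀.reg 5) := by
  have key := iterate_induction (n := n)
    (f := fun i s => (Cmd.forEach reduceStep).exec n 1 (Function.update e 0 i) s) (s := s₀)
    (fun i s => s.reg = s₀.reg ∧ ∃ G', HasMatrix s 1 G' ∧ Reduces (s₀.reg 5) G G' ∧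
      (Irreducible G' (s₀.reg 5) ∨ (support G').card ≤ n - i))
    ⟨rfl, G, h, Reduces.refl, Or.inr ((Finset.card_le_univ _).trans (by simp))⟩ (by
      rintro i hi s ⟨h1, G₁, h2, h3, h4⟩
      have inner := iterate_induction (n := n) (s := s)
        (f := fun j s => reduceStep.exec n 2 (Function.update (Function.update e 0 i) 1 j) s)
        (fun j s => s.reg = s₀.reg ∧ ∃ G', HasMatrix s 1 G' ∧ Reduces (s₀.reg 5) G G' ∧
          (G' = G₁ ∧ (∀ v u : Fin n, (v : ℕ) < j → G₁.Adj v u → ¬ Deletable G₁ (s₀.reg 5) v) ∨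
            ¬ Irreducible G₁ (s₀.reg 5) ∧ (support G').card < (support G₁).card))
        ⟨h1, G₁, h2, h3, Or.inl ⟨rfl, by simp⟩⟩ (by
          rintro j hj s ⟨h5, G₂, h6, h7, h8⟩
          obtain ⟨h9, h10⟩ := reduceStep_spec (v := ⟨j, hj⟩)
            (e := Function.update (Function.update e 0 i) 1 j) h6 (by simp)
          refine ⟨h9.trans h5, ?_⟩
          rw [h5] at h10
          rcases h10 with ⟨h11, h12, h13⟩ | ⟨h11, h12⟩
          · refine ⟨_, h13, h7.step h12, Or.inr ?_⟩
            have hlt := card_support_isolate_lt h11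
            rcases h8 with ⟨rfl, -⟩ | ⟨h14, h15⟩
            · obtain ⟨u, hu⟩ := mem_support.1 h11
              exact ⟨fun hi => hi _ u hu h12, hlt⟩
            · exact ⟨h14, hlt.trans h15⟩
          · refine ⟨_, h12, h7, ?_⟩
            rcases h8 with ⟨rfl, h14⟩ | h14
            · refine Or.inl ⟨rfl, fun v u hv hu => ?_⟩
              rcases Nat.lt_succ_iff_lt_or_eq.1 hv with hv | rfl
              · exact h14 v u hv hu
              · exact h11 u hu
            · exact Or.inr h14)
      obtain ⟨h5, G₂, h6, h7, h8⟩ := inner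
      refine ⟨h5, G₂, h6, h7, ?_⟩
      rcases h8 with ⟨rfl, h8⟩ | ⟨h8, h9⟩
      · exact Or.inl fun v u hu => h8 v u v.isLt hu
      · right
        have := h4.resolve_left h8
        omega)
  obtain ⟨h1, G', h2, h3, h4⟩ := key
  refine ⟨h1, G', h2, h3, ?_⟩
  rcases h4 with h4 | h4
  · exact h4
  · intro v u hu
    have : v ∈ support G' := mem_support.2 ⟨u, hu⟩
    have := Finset.card_pos.2 ⟨v, this⟩
    omega

end Reduction

end PawEditing
namespace PawEditing

/-! ### The output -/

section Output

open Term

/-- Isolated vertices can be added or removed. -/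
theorem editable_comap_iff {V W : Type*} [Fintype V] [Fintype W] {G : SimpleGraph V} (f : W ↪ V)
    (hf : ∀ v ∈ support G, v ∈ Set.range f) (k : ℕ) :
    Editable (G.comap f) k ↔ Editable G k := by
  classical
  constructor
  · rintro ⟨H, hH, hk⟩
    -- The vertices outside the image are isolated in `G` and stay so.
    refine ⟨H.map f, ?_, le_trans ?_ hk⟩
    · rintro a b c d ⟨-, a, b, hab, rfl, rfl⟩ hbc hac hcd
      obtain ⟨-, c, d, hcd', rfl, rfl⟩ := hcd
      rw [SimpleGraph.map_adj_apply] at hbc hac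
      rw [SimpleGraph.map_adj_apply, SimpleGraph.map_adj_apply]
      exact hH a b c d hab hbc hac hcd'
    · rw [← Finset.card_map (f.prodMap f)]
      refine Finset.card_le_card ?_
      rintro ⟨a, b⟩ hab
      rw [mem_diff] at hab
      have key : a ∈ Set.range f ∧ b ∈ Set.range f := by
        by_cases h : G.Adj a b
        · exact ⟨hf a (mem_support.2 ⟨b, h⟩), hf b (mem_support.2 ⟨a, h.symm⟩)⟩
        · have h' : (H.map f).Adj a b := by tauto
          obtain ⟨-, a, b, -, rfl, rfl⟩ := h'
          exact ⟨⟨a, rfl⟩, ⟨b, rfl⟩⟩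
      obtain ⟨⟨a, rfl⟩, ⟨b, rfl⟩⟩ := key
      rw [SimpleGraph.map_adj_apply] at hab
      exact Finset.mem_map.2 ⟨(a, b), mem_diff.2 hab, rfl⟩
  · rintro ⟨H, hH, hk⟩
    refine ⟨H.comap f, fun a b c d => hH (f a) (f b) (f c) (f d), le_trans ?_ hk⟩
    rw [← Finset.card_map (f.prodMap f)]
    refine Finset.card_le_card fun p hp => ?_
    obtain ⟨⟨a, b⟩, hab, rfl⟩ := Finset.mem_map.1 hp
    have hab' := mem_diff.1 hab
    exact mem_diff.2 hab'

theorem not_editable_paw : ¬ Editable paw 0 := by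
  rintro ⟨H, hH, hk⟩
  have h0 : diff paw H = ∅ := Finset.card_eq_zero.1 (by omega)
  have h1 : ∀ a b, paw.Adj a b ↔ H.Adj a b := by
    intro a b
    by_contra h
    have : (a, b) ∈ diff paw H := mem_diff.2 h
    simp [h0] at this
  have := hH 0 1 2 3
  simp only [← h1] at this
  simp [paw] at this

/-- The state `s` holds the output `J`. -/
structure HasOutput (s : State) (J : GraphInstance) : Prop where
  order : s.reg 0 = J.order
  param : s.reg 1 = J.param
  matrix : HasMatrix s 0 J.graph

variable {n : ℕ}

/-- Write the values of `g` to the cells of array `0` in a list. -/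
def storeAll (g : ℕ → ℕ → ℕ) : List (ℕ × ℕ) → Cmd
  | [] => Cmd.skip
  | p :: L => Cmd.seq (storeAll g L) (Cmd.store 0 (const p.1) (const p.2) (const (g p.1 p.2)))

theorem storeAll_arr (g : ℕ → ℕ → ℕ) (L : List (ℕ × ℕ)) (l : ℕ) (e : ℕ → ℕ) (s : State) (i j : ℕ)
    (h : (i, j) ∈ L) : ((storeAll g L).exec n l e s).arr 0 i j = g i j := by
  induction L with
  | nil => simp at h
  | cons p L ih =>
    simp only [storeAll, Cmd.exec_seq, Cmd.exec_store, State.store, eval_const, true_and]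
    split_ifs with hp
    · rw [hp.1, hp.2]
    · refine ih ((List.mem_cons.1 h).resolve_left ?_)
      rintro rfl
      exact hp ⟨rfl, rfl⟩

/-- The adjacency matrix of the paw. -/
def pawMatrix (i j : ℕ) : ℕ :=
  if i ≠ j ∧ (i < 3 ∧ j < 3 ∨ i + j = 5) then 1 else 0

/-- Output the paw with parameter `0`, which is a no-instance. -/
def rejectCmd : Cmd :=
  Cmd.seq (storeAll pawMatrix (List.range 4 ×ˢ List.range 4))
    (Cmd.seq (Cmd.assign 0 (const 4)) (Cmd.assign 1 (const 0)))

theorem rejectCmd_spec (e : ℕ → ℕ) (s : State) :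
    HasOutput (rejectCmd.exec n 0 e s) ⟨4, paw, 0⟩ := by
  refine ⟨by simp [rejectCmd, Cmd.exec_seq, Cmd.exec_assign, State.assign],
    by simp [rejectCmd, Cmd.exec_seq, Cmd.exec_assign, State.assign], fun i j => ?_⟩
  have : (rejectCmd.exec n 0 e s).arr 0 i j = pawMatrix i j :=
    storeAll_arr pawMatrix _ 0 e s i j
      (List.mem_product.2 ⟨List.mem_range.2 i.isLt, List.mem_range.2 j.isLt⟩)
  rw [this]
  fin_cases i <;> fin_cases j <;> simp [pawMatrix, paw]

/-- The number of vertices before the variable `x` that are not isolated. -/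
def rankTerm (l x : ℕ) : Term := count (conj (lt (var l) (var x)) (supportTerm (l + 1) l))

/-- The number of smaller non-isolated vertices is the inverse of the increasing enumeration
`orderEmbOfFin`, which relabels the output. -/
theorem eval_rankTerm {s : State} {G : SimpleGraph (Fin n)} (h : HasMatrix s 1 G) {l x : ℕ}
    (hx : x < l) {e : ℕ → ℕ} (i : Fin (support G).card)
    (he : e x = (support G).orderEmbOfFin rfl i) : (rankTerm l x).eval n s l e = i := by
  classical
  have key : ∀ w : Fin n,
      (supportTerm (l + 1) l).Holds n s (l + 1) (Function.update e l w) ↔ w ∈ support G :=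
    fun w => holds_supportTerm h (by omega) (by simp)
  rw [rankTerm, eval_count]
  simp only [holds_conj, key, holds_lt, eval_var, Nat.lt_succ_self, if_true, Function.update_self,
    show x < l + 1 by omega, Function.update_of_ne hx.ne, he]
  have : (Finset.univ.filter fun w : Fin n =>
      (w : ℕ) < ((support G).orderEmbOfFin rfl i : Fin n) ∧ w ∈ support G) =
      (Finset.Iio i).map ((support G).orderEmbOfFin rfl).toEmbedding := by
    ext w
    simp only [Finset.mem_filter, Finset.mem_univ, true_and, Finset.mem_map, Finset.mem_Iio,
      RelEmbedding.coe_toEmbedding, Fin.val_fin_lt]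
    constructor
    · rintro ⟨h1, h2⟩
      have : w ∈ Set.range ((support G).orderEmbOfFin rfl) := by
        rw [Finset.range_orderEmbOfFin]; exact h2
      obtain ⟨j, rfl⟩ := this
      exact ⟨j, (OrderEmbedding.lt_iff_lt _).1 h1, rfl⟩
    · rintro ⟨j, hj, rfl⟩
      exact ⟨(OrderEmbedding.lt_iff_lt _).2 hj, Finset.orderEmbOfFin_mem _ _ _⟩
  rw [this, Finset.card_map, Fin.card_Iio]

/-- Treat the pair of the variables `0` and `1`. -/
def outputStep : Cmd :=
  Cmd.ite (conj (supportTerm 2 0) (supportTerm 2 1))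
    (Cmd.store 0 (rankTerm 2 0) (rankTerm 2 1) (cell 1 (var 0) (var 1))) Cmd.skip

/-- Write the graph in array `1` without its isolated vertices to array `0`. -/
def outputCmd : Cmd := Cmd.forEach (Cmd.forEach outputStep)

/-- The invariant of `outputCmd`, where `Q` holds for the pairs that have been treated. -/
structure OutputInv (s₀ : State) (G : SimpleGraph (Fin n)) (Q : Fin n → Fin n → Prop)
    (s : State) : Prop where
  reg : s.reg = s₀.reg
  arr : s.arr 1 = s₀.arr 1
  entry : ∀ i j : Fin (support G).card,
    Q ((support G).orderEmbOfFin rfl i) ((support G).orderEmbOfFin rfl j) →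
      s.arr 0 i j =
        s₀.arr 1 ((support G).orderEmbOfFin rfl i) ((support G).orderEmbOfFin rfl j)

theorem OutputInv.congr {s₀ s : State} {G : SimpleGraph (Fin n)} {Q Q' : Fin n → Fin n → Prop}
    (h : OutputInv s₀ G Q s) (hQ : ∀ u v, Q' u v → Q u v) : OutputInv s₀ G Q' s :=
  ⟨h.reg, h.arr, fun i j hij => h.entry i j (hQ _ _ hij)⟩

theorem OutputInv.step {s₀ s : State} {G : SimpleGraph (Fin n)} {Q : Fin n → Fin n → Prop}
    (h1 : HasMatrix s₀ 1 G) (h : OutputInv s₀ G Q s) {e : ℕ → ℕ} {u v : Fin n}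
    (hu : e 0 = u) (hv : e 1 = v) :
    OutputInv s₀ G (fun u' v' => Q u' v' ∨ (u' = u ∧ v' = v)) (outputStep.exec n 2 e s) := by
  have hG : HasMatrix s 1 G := fun i j => by rw [h.arr]; exact h1 i j
  have hcond : (conj (supportTerm 2 0) (supportTerm 2 1)).Holds n s 2 e ↔
      u ∈ support G ∧ v ∈ support G := by
    rw [holds_conj, holds_supportTerm hG (by omega) hu, holds_supportTerm hG (by omega) hv]
  by_cases hc : u ∈ support G ∧ v ∈ support G
  · rw [outputStep, Cmd.exec_ite_pos (hcond.2 hc), Cmd.exec_store]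
    have hr : ∀ w ∈ support G, ∃ i, (support G).orderEmbOfFin rfl i = w := by
      intro w hw
      rw [← Finset.mem_coe, ← Finset.range_orderEmbOfFin _ rfl] at hw
      exact hw
    obtain ⟨i, rfl⟩ := hr u hc.1
    obtain ⟨j, rfl⟩ := hr v hc.2
    rw [eval_rankTerm hG (by omega) i hu, eval_rankTerm hG (by omega) j hv]
    refine ⟨h.reg, h.arr, fun i' j' hij => ?_⟩
    by_cases hc' : i' = i ∧ j' = j
    · obtain ⟨rfl, rfl⟩ := hc'
      simp [State.store, Term.eval, hu, hv, h.arr]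
    · have hne : ¬ ((i' : ℕ) = i ∧ (j' : ℕ) = j) := by simpa [Fin.val_inj] using hc'
      simp only [State.store, true_and, if_neg hne]
      refine h.entry i' j' (hij.resolve_right ?_)
      simpa using hc'
  · rw [outputStep, Cmd.exec_ite_neg (fun h => hc (hcond.1 h)), Cmd.exec_skip]
    refine ⟨h.reg, h.arr, fun i j hij => h.entry i j (hij.resolve_right ?_)⟩
    rintro ⟨rfl, rfl⟩
    exact hc ⟨Finset.orderEmbOfFin_mem _ _ _, Finset.orderEmbOfFin_mem _ _ _⟩

theorem outputCmd_spec {s : State} {G : SimpleGraph (Fin n)} {e : ℕ → ℕ} (h : HasMatrix s 1 G) :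
    (outputCmd.exec n 0 e s).reg = s.reg ∧
      HasMatrix (outputCmd.exec n 0 e s) 0 (G.comap ((support G).orderEmbOfFin rfl)) := by
  have hI : OutputInv s G (fun _ _ => False) s := ⟨rfl, rfl, fun _ _ h => h.elim⟩
  have key := iterate_induction (n := n)
    (f := fun i s => (Cmd.forEach outputStep).exec n 1 (Function.update e 0 i) s) (s := s)
    (fun i s' => OutputInv s G (fun t _ => (t : ℕ) < i) s') (hI.congr (by simp)) (by
      intro i hi s' hs'
      have h4 := iterate_induction (n := n)
        (f := fun j s => outputStep.exec n 2 (Function.update (Function.update e 0 i) 1 j) s)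
        (s := s')
        (fun j s' => OutputInv s G (fun t u => (t : ℕ) < i ∨ (t : ℕ) = i ∧ (u : ℕ) < j) s')
        (hs'.congr (by simp)) (by
          intro j hj s' hs'
          refine (hs'.step h (u := ⟨i, hi⟩) (v := ⟨j, hj⟩)
            (e := Function.update (Function.update e 0 i) 1 j) ?_ ?_).congr ?_
          · simp
          · simp
          · intro t u
            simp only [Fin.ext_iff]
            omega)
      refine h4.congr fun t u => ?_
      have := u.isLt
      omega)
  refine ⟨key.reg, fun i j => ?_⟩
  have := key.entry i j (Fin.isLt _)
  change (State.arr (iterate _ s n) 0 i j) ≤ 1 ∧ (State.arr (iterate _ s n) 0 i j ≠ 0 ↔ _)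
  rw [this]
  exact h _ _

theorem holds_lt_glob {s : State} {l : ℕ} {e : ℕ → ℕ} {x y : Fin 10} :
    (lt (glob x) (glob y)).Holds n s l e ↔ s.reg x < s.reg y := holds_lt

/-- The kernelization; `C` is the constant of the size bound. -/
def kernelCmd (C : ℕ) : Cmd :=
  Cmd.ite (lt (glob 1) (glob 0))
    (Cmd.seq forcedCmd (Cmd.ite (lt (glob 1) (glob 4)) rejectCmd
      (Cmd.seq (Cmd.assign 5 (sub (glob 1) (glob 4))) (Cmd.seq reduceCmd
        (Cmd.seq (Cmd.assign 6 (count (supportTerm 1 0)))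
          (Cmd.ite (lt (multiple (add (power 0 6) (const 1)) C) (glob 6)) rejectCmd
            (Cmd.seq outputCmd (Cmd.seq (Cmd.assign 0 (glob 6)) (Cmd.assign 1 (glob 5))))))))))
    Cmd.skip

/-- The answer is no if more than k deletions are forced, or if the irreducible graph exceeds the
bound that `Reduces.card_support_le` gives for yes-instances. The terms with 4 make room for the paw
that is then output. -/
theorem kernelCmd_spec {C k : ℕ} (hC : 10400 * (k + 1) ^ 6 ≤ C * (k ^ 6 + 1)) (hC4 : 4 ≤ C)
    {s : State} {G : SimpleGraph (Fin n)} {e : ℕ → ℕ} (hn : s.reg 0 = n) (hk : s.reg 1 = k)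
    (h4 : s.reg 4 = 0) (h0 : HasMatrix s 0 G) (h1 : s.arr 1 = fun _ _ => 0) :
    ∃ J : GraphInstance, HasOutput ((kernelCmd C).exec n 0 e s) J ∧
      (Editable J.graph J.param ↔ Editable G k) ∧ J.order ≤ C * (k ^ 6 + 1) ∧ J.param ≤ k ∧
        J.order ≤ n + 4 := by
  classical
  have hbound : 4 ≤ C * (k ^ 6 + 1) := hC4.trans (Nat.le_mul_of_pos_right _ (by omega))
  have hreject : ∀ s', ¬ Editable G k → ∃ J : GraphInstance, HasOutput (rejectCmd.exec n 0 e s') J ∧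
      (Editable J.graph J.param ↔ Editable G k) ∧ J.order ≤ C * (k ^ 6 + 1) ∧ J.param ≤ k ∧
        J.order ≤ n + 4 :=
    fun s' h => ⟨_, rejectCmd_spec e s', iff_of_false not_editable_paw h, hbound, Nat.zero_le _,
      Nat.le_add_left _ _⟩
  -- If `n ≤ k`, the instance is its own kernel; otherwise `power` evaluates correctly.
  by_cases hkn : k < n
  · rw [kernelCmd, Cmd.exec_ite_pos (by rw [holds_lt_glob, hn, hk]; exact hkn),
      Cmd.exec_seq]
    obtain ⟨s₁, G₁, hs₁, r1, hG₁, hF, hd⟩ := forcedCmd_spec (e := e) h0 h1 h4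
    rw [hs₁]
    rw [hk] at r1 hF
    have hE := hF.editable_iff hd
    by_cases hr : k < s₁.reg 4
    · rw [Cmd.exec_ite_pos (by rw [holds_lt_glob, r1]; exact hr)]
      exact hreject s₁ fun h => absurd (hE.1 h).1 (by omega)
    · rw [Cmd.exec_ite_neg (by rw [holds_lt_glob, r1]; exact hr), Cmd.exec_seq,
        Cmd.exec_assign, eval_sub, eval_glob, eval_glob, r1, Cmd.exec_seq]
      set s₂ := s₁.assign 5 (k - s₁.reg 4) with hs₂
      have hG₁' : HasMatrix s₂ 1 G₁ := hG₁
      have r2 : s₂.reg 1 = k := r1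
      have r3 : s₂.reg 5 = k - s₁.reg 4 := by simp [hs₂, State.assign]
      obtain ⟨r4, G₂, hG₂, hR, hirr⟩ := reduceCmd_spec (e := e) hG₁'
      set s₃ := reduceCmd.exec n 0 e s₂ with hs₃
      rw [r3] at hR hirr
      have hE' : Editable G₂ (k - s₁.reg 4) ↔ Editable G k := by
        rw [hR.editable_iff, hE]
        exact ⟨fun h => ⟨by omega, h⟩, fun h => h.2⟩
      have hcount : (count (supportTerm 1 0)).eval n s₃ 0 e = (support G₂).card := by
        rw [eval_count]
        congr 1
        ext w
        simp only [Finset.mem_filter, Finset.mem_univ, true_and]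
        exact holds_supportTerm hG₂ (by omega) (by simp)
      rw [Cmd.exec_seq, Cmd.exec_assign, hcount]
      set s₄ := s₃.assign 6 (support G₂).card with hs₄
      have hG₂' : HasMatrix s₄ 1 G₂ := hG₂
      have r5 : s₄.reg 1 = k := (congrFun r4 1).trans r2
      have r6 : s₄.reg 5 = k - s₁.reg 4 := (congrFun r4 5).trans r3
      have r7 : s₄.reg 6 = (support G₂).card := by simp [hs₄, State.assign]
      have hlt : (lt (multiple (add (power 0 6) (const 1)) C) (glob 6)).Holds n s₄ 0 e ↔
          C * (k ^ 6 + 1) < (support G₂).card := by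
        rw [holds_lt, eval_multiple, eval_add, eval_power (by omega), eval_const, eval_glob, r5, r7]
      by_cases hbig : C * (k ^ 6 + 1) < (support G₂).card
      · rw [Cmd.exec_ite_pos (hlt.2 hbig)]
        refine hreject s₄ fun h => ?_
        have := hR.card_support_le h hF (Nat.sub_le _ _) hirr
        omega
      · rw [Cmd.exec_ite_neg (fun h => hbig (hlt.1 h))]
        obtain ⟨r8, hG₃⟩ := outputCmd_spec (e := e) hG₂'
        refine ⟨⟨(support G₂).card, G₂.comap ((support G₂).orderEmbOfFin rfl), k - s₁.reg 4⟩,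
          ⟨?_, ?_, hG₃⟩, ?_, not_lt.1 hbig, Nat.sub_le _ _, ?_⟩
        · simp [Cmd.exec_seq, Cmd.exec_assign, State.assign, r8, r7]
        · simp [Cmd.exec_seq, Cmd.exec_assign, State.assign, r8, r6]
        · rw [← hE']
          refine editable_comap_iff ((support G₂).orderEmbOfFin rfl).toEmbedding ?_ _
          intro v hv
          rw [← Finset.mem_coe, ← Finset.range_orderEmbOfFin _ rfl] at hv
          exact hv
        · have := Finset.card_le_univ (support G₂)
          simp only [Fintype.card_fin] at this
          exact this.trans (Nat.le_add_right _ _)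
  · rw [kernelCmd, Cmd.exec_ite_neg (by rw [holds_lt_glob, hn, hk]; exact hkn),
      Cmd.exec_skip]
    refine ⟨⟨n, G, k⟩, ⟨hn, hk, h0⟩, Iff.rfl, ?_, le_rfl, Nat.le_add_right _ _⟩
    calc n ≤ k := not_lt.1 hkn
      _ ≤ k ^ 6 := Nat.le_self_pow (by omega) _
      _ ≤ 1 * (k ^ 6 + 1) := by omega
      _ ≤ C * (k ^ 6 + 1) := Nat.mul_le_mul_right _ (by omega)

end Output

end PawEditing
namespace PawEditing

/-! ### The kernelization -/

section Kernelization

theorem monotone_eval_nat (p : Polynomial ℕ) : Monotone fun x => p.eval x := by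
  intro x y hxy
  simp only [Polynomial.eval_eq_sum_range]
  gcongr

/-- The state that is represented by a memory. -/
def Memory.state (m : Memory) : State where
  reg x := m.reg x
  arr a := m.arr a

theorem represents_state (m : Memory) (n : ℕ) (e : ℕ → ℕ) :
    Represents n m.state 0 e (m.setReg 10 n) where
  range := by simp [Memory.setReg]
  reg x := by
    have := x.isLt
    simp [Memory.setReg, Memory.state, show (x : ℕ) ≠ 10 by omega]
  arr _ := rfl
  var i hi := absurd hi (Nat.not_lt_zero i)

theorem HasOutput.holdsOutput {n : ℕ} {s : State} {e : ℕ → ℕ} {m : Memory} {J : GraphInstance}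
    (h : HasOutput s J) (hR : Represents n s 0 e m) : HoldsOutput m J := by
  refine ⟨(hR.reg 0).trans h.order, (hR.reg 1).trans h.param, fun i j => ?_⟩
  have h1 : m.arr 0 = s.arr 0 := hR.arr 0
  obtain ⟨h2, h3⟩ := h.matrix i j
  rw [h1]
  split_ifs with hadj
  · have := h3.2 hadj
    omega
  · by_contra hc
    exact hadj (h3.1 hc)

theorem hasMatrix_inputMemory (I : GraphInstance) :
    HasMatrix (inputMemory I).state 0 I.graph := by
  intro i j
  simp only [Memory.state, inputMemory, Fin.val_zero, true_and, i.isLt, j.isLt, exists_true_left,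
    Fin.eta]
  by_cases h : I.graph.Adj i j <;> simp [h]

theorem mem_pawFreeEditing {I : GraphInstance} :
    I ∈ PawFreeEditing ↔ Editable I.graph I.param :=
  editable_iff.symm

theorem exists_polynomialKernelization {C : ℕ}
    (hC : ∀ k, 10400 * (k + 1) ^ 6 ≤ C * (k ^ 6 + 1)) (hC4 : 4 ≤ C) :
    ∃ κ : GraphInstance → GraphInstance, IsPolynomialKernelization PawFreeEditing κ ∧
      ∀ I : GraphInstance, (κ I).order ≤ C * (I.param ^ 6 + 1) := by
  obtain ⟨p, hp⟩ := (kernelCmd C).correct 0 0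
  have key : ∀ I : GraphInstance, ∃ J : GraphInstance, (∃ t m,
      Runs ((Prog.assign 10 (Expr.reg 0)).seq ((kernelCmd C).compile 0 0)) (inputMemory I) t m ∧
        HoldsOutput m J ∧ t ≤ 1 + p.eval I.order) ∧
      (Editable J.graph J.param ↔ Editable I.graph I.param) ∧
        J.order ≤ C * (I.param ^ 6 + 1) ∧ J.param ≤ I.param ∧ J.order ≤ I.order + 4 := by
    intro I
    have hn : (inputMemory I).reg 0 = I.order := by simp [inputMemory]
    obtain ⟨J, h1, h2⟩ := kernelCmd_spec (e := fun _ => 0) (hC I.param) hC4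
      (s := (inputMemory I).state) (by simp [Memory.state, inputMemory])
      (by simp [Memory.state, inputMemory]) (by simp [Memory.state, inputMemory])
      (hasMatrix_inputMemory I) (by funext i j; simp [Memory.state, inputMemory])
    obtain ⟨t, m, r, ht, hR, -⟩ := hp I.order _ _ _
      (represents_state (inputMemory I) I.order fun _ => 0)
    have ra := Runs.assign 10 (Expr.reg 0) (inputMemory I)
    rw [Expr.eval, hn] at ra
    exact ⟨J, ⟨_, m, Runs.seq ra r, h1.holdsOutput hR, by omega⟩, h2⟩
  choose κ hrun hequiv horder hparam hle using key
  -- The first assignment provides the loop bound. The output has at most four vertices more than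
  -- the input, whence `(X + 4) ^ 2`, and no larger parameter, whence `X`.
  refine ⟨κ, ⟨⟨(Prog.assign 10 (Expr.reg 0)).seq ((kernelCmd C).compile 0 0),
    p + 1 + (Polynomial.X + 4) ^ 2 + Polynomial.X, fun I => ?_⟩, fun I => ?_,
    ⟨(Polynomial.C C * (Polynomial.X ^ 6 + 1)) ^ 2 + Polynomial.X, fun I => ?_⟩⟩, horder⟩
  · obtain ⟨t, m, h1, h2, h3⟩ := hrun I
    refine ⟨t, m, h1, h2, ?_⟩
    have e1 : I.order ≤ I.length :=
      (Nat.le_self_pow two_ne_zero _).trans (Nat.le_add_right _ _)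
    have e2 : p.eval I.order ≤ p.eval I.length := monotone_eval_nat p e1
    have e3 : (κ I).order ^ 2 ≤ (I.length + 4) ^ 2 := Nat.pow_le_pow_left ((hle I).trans (by omega)) 2
    have e4 : Nat.size (κ I).param ≤ I.length :=
      (Nat.size_le_size (hparam I)).trans (Nat.le_add_left _ _)
    simp only [Polynomial.eval_add, Polynomial.eval_one, Polynomial.eval_pow, Polynomial.eval_X,
      Polynomial.eval_ofNat]
    change t + ((κ I).order ^ 2 + Nat.size (κ I).param) ≤ _
    omega
  · rw [mem_pawFreeEditing, mem_pawFreeEditing, hequiv]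
  · simp only [Polynomial.eval_add, Polynomial.eval_mul, Polynomial.eval_C, Polynomial.eval_one,
      Polynomial.eval_pow, Polynomial.eval_X]
    exact Nat.add_le_add (Nat.pow_le_pow_left (horder I) 2) (hparam I)

end Kernelization

end PawEditing

theorem mainTheorem1 :
    ∃ κ : PawEditing.GraphInstance → PawEditing.GraphInstance,
      PawEditing.IsPolynomialKernelization PawEditing.PawFreeEditing κ ∧
        ∃ C : ℕ, ∀ I : PawEditing.GraphInstance,
          (κ I).order ≤ C * (I.param ^ 6 + 1) := by
  -- `add_pow_le` gives (k + 1)^6 ≤ 2^5 (k^6 + 1), and 665600 = 2^6 · 10400 is more than enough.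
  obtain ⟨κ, h1, h2⟩ := PawEditing.exists_polynomialKernelization (C := 665600) (fun k => by
    have := add_pow_le (Nat.zero_le k) (Nat.zero_le 1) 6
    rw [one_pow] at this
    omega) (by omega)
  exact ⟨κ, h1, _, h2⟩
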